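/- **Definitions.** For a finite set $H$ of indices with $|H|=n$ and $0\le h\le n$, let $e_h(x_H)$ be the $h$-th elementary symmetric function of the variables $x_i$, $i\in H$, and $\tilde e_h=\frac{(n-h)!}{n!}e_h(x_H)$. For $1\le r\le n$ put $$\hat u_r^{n}(x_H)=\frac{n!}{(n-r)!}\sum_{\lambda\vdash r}(-1)^{l(\lambda)-1}\frac{(l(\lambda)-1)!}{\prod_{h=1}^r m_h!}\prod_{h=1}^r\tilde e_h^{\,m_h},$$ where $m_h$ is the multiplicity of $h$ in the partition $\lambda$ and $l(\lambda)=\sum_h m_h$. At a point where all $x_i$, $i\in H$, are equal, and for a function $\phi$ that is symmetric in these variables near that point, let $\partial_H^\sigma\phi$ (for $\sigma\vdash g$, $1\le g\le n$) be the mixed partial derivative of order $g$ in which the parts of $\sigma$ are the multiplicities of differentiation with respect to distinct variables $x_i$, $i\in H$ (it does not depend on the assignment), and put $$\partial_H^g\phi=\sum_{\sigma\vdash g}(-1)^{g-l(\sigma)}\frac{g\,(l(\sigma)-1)!}{\prod_{h=1}^g h!^{m_h}m_h!}\,\partial_H^\sigma\phi .$$ **Theorem 3.11.** Let $x^0\in\mathbb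 R^N$, and let $H_1,\dots,H_M$ be the partition of $\{1,\dots,N\}$ into non-empty blocks such that $x^0_i=y_\alpha$ for $i\in H_\alpha$, with $y_\alpha\ne y_\beta$ for $\alpha\ne\beta$. Let $\phi$ be a real function that is, near $x^0$, invariant under the permutations of the variables that preserve every block, and that is $C^{|H_\alpha|}$ at $x^0$ for every $\alpha$. Let $\hat u(x)=\big(\hat u_r^{|H_\alpha|}(x_{H_\alpha})\big)_{1\le\alpha\le M,\ 1\le r\le|H_\alpha|}$. Then: 1. $\phi$ can be expressed in these coordinates: there is a function $\psi$ on $\mathbb R^N$ (with coordinates $\hat u_{\alpha,r}$) such that $\phi(x)=\psi(\hat u(x))$ for all $x$ near $x^0$. 2. For every such $\psi$, the derivatives of $\psi$ at $\hat u(x^0)$ with respect to the coordinates $\hat u_d^{|H_\alpha|}(x_{H_\alpha})$ are the numbers $\partial_{H_\alpha}^d\phi(x^0)$, $1\le\alpha\le M$, $1\le d\le|H_\alpha|$, in the following senses (in general $\hat u(x^0)$ is a boundary point of $\hat u(\mathbb R^N)$): * the linear form with these coefficients is a derivative of $\psi$ at $\hat u(x^0)$ relative to the set $\hat u(\mathbb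 R^N)$; * $\psi$ is differentiable at $\hat u(x)$ for every $x$ near $x^0$ with pairwise distinct coordinates, and for every $\alpha$ and $d$ its partial derivative $\partial\psi/\partial\hat u_{\alpha,d}$ at $\hat u(x)$ tends to $\partial_{H_\alpha}^d\phi(x^0)$ as $x\to x^0$ through such points; * if $\psi$ is $C^1$ at $\hat u(x^0)$ (on a full neighbourhood), then $\frac{\partial\psi}{\partial\hat u_{\alpha,d}}(\hat u(x^0))=\partial_{H_\alpha}^d\phi(x^0)$ for every $\alpha$ and $d$. 3. If $\phi(x)=\sum_{i=1}^N f(x_i)$ near $x^0$ for a function $f$ of one variable, then these numbers are $$\partial_{H_\alpha}^d\phi(x^0)=\frac{(-1)^{d-1}f^{(d)}(y_\alpha)}{(d-1)!},\qquad 1\le\alpha\le M,\ 1\le d\le|H_\alpha|.$$ -/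

import Mathlib

open Filter Topology

noncomputable section

namespace BlockCoord

variable {N : ℕ}

/-- The normalized elementary symmetric function `ẽ_h = e_h / (h! * binom(n,h))` of the variables
`x_i`, `i ∈ H`, where `n = |H|` (note that `h! * binom(n,h) = n.descFactorial h`). -/
def eTilde (H : Finset (Fin N)) (h : ℕ) (x : Fin N → ℝ) : ℝ :=
  (H.val.map x).esymm h / (H.card.descFactorial h : ℝ)

/-- The product `ẽ_λ = ∏_q ẽ_{h_q}` over the parts `h_q` of the partition `λ`. -/
def eTildePart (H : Finset (Fin N)) {r : ℕ} (lam : r.Partition) (x : Fin N → ℝ) : ℝ :=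
  (lam.parts.map fun h => eTilde H h x).prod

/-- `u_r = ∑_{λ ⊢ r} (-1)^(l(λ)-1) (l(λ)-1)! / (∏_h m_h!) ẽ_λ` in the variables `x_i`, `i ∈ H`,
where `m_h` is the multiplicity of `h` in `λ`. It is used for `1 ≤ r ≤ |H|` only. -/
def u (H : Finset (Fin N)) (r : ℕ) (x : Fin N → ℝ) : ℝ :=
  ∑ lam : r.Partition,
    (-1 : ℝ) ^ (lam.parts.card - 1) * ((lam.parts.card - 1).factorial : ℝ) /
      (∏ h ∈ Finset.Icc 1 r, ((lam.parts.count h).factorial : ℝ)) * eTildePart H lam x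

/-- `û_r = n! / (n-r)! * u_r`, where `n = |H|`. -/
def uHat (H : Finset (Fin N)) (r : ℕ) (x : Fin N → ℝ) : ℝ :=
  (H.card.descFactorial r : ℝ) * u H r x

/-- The index set of the coordinates attached to the blocks `H_α`: the pair `⟨α, j⟩` stands for
the block `α` and the degree `r = j + 1`, so that `1 ≤ r ≤ |H_α|`. -/
abbrev Idx {M : ℕ} (H : Fin M → Finset (Fin N)) : Type :=
  (α : Fin M) × Fin (H α).card

/-- The map sending `x` to all the coordinates `û_r^{|H_α|}(x_{H_α})`. -/
def coords {M : ℕ} (H : Fin M → Finset (Fin N)) (x : Fin N → ℝ) : Idx H → ℝ :=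
  fun p => uHat (H p.1) (p.2 + 1) x

/-- The sequences `i_1, …, i_g` of indices from `J` in which the multiplicities of the indices
that do appear are the parts of the partition `σ` of `g`. -/
def seqsOfType (J : Finset (Fin N)) {g : ℕ} (σ : g.Partition) : Finset (Fin g → Fin N) :=
  Finset.univ.filter fun i =>
    (∀ q, i q ∈ J) ∧
      (Finset.univ.image i).val.map (fun k => (Finset.univ.filter fun q => i q = k).card) = σ.parts

/-- The mixed partial derivative `∂_J^σ φ` of order `g` at `x`, in which the parts of `σ ⊢ g` are
assigned as multiplicities to distinct indices from `J`. When the `x_i`, `i ∈ J`, are all equal and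
`φ` is symmetric in them, this does not depend on the assignment; in order to avoid a choice we
take the average over all of them. -/
def partialType (J : Finset (Fin N)) {g : ℕ} (σ : g.Partition) (φ : (Fin N → ℝ) → ℝ)
    (x : Fin N → ℝ) : ℝ :=
  (∑ i ∈ seqsOfType J σ, iteratedFDeriv ℝ g φ x fun q => Pi.single (i q) (1 : ℝ)) /
    ((seqsOfType J σ).card : ℝ)

/-- `∂_J^g φ = ∑_{σ ⊢ g} (-1)^(g-l(σ)) g (l(σ)-1)! / (∏_h h!^{m_h} m_h!) ∂_J^σ φ`, where `m_h` is
the multiplicity of `h` in `σ`. It is used for `1 ≤ g ≤ |J|` only. -/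
def blockDeriv (J : Finset (Fin N)) (g : ℕ) (φ : (Fin N → ℝ) → ℝ) (x : Fin N → ℝ) : ℝ :=
  ∑ σ : g.Partition,
    (-1 : ℝ) ^ (g - σ.parts.card) * ((g : ℝ) * ((σ.parts.card - 1).factorial : ℝ)) /
      (∏ h ∈ Finset.Icc 1 g,
        ((h.factorial : ℝ) ^ σ.parts.count h * ((σ.parts.count h).factorial : ℝ))) *
      partialType J σ φ x

/-- The linear form on the space of coordinates whose partial derivatives (in the directions of
the coordinates `û_d^{|H_α|}(x_{H_α})`) are the numbers `∂_{H_α}^d φ` at `x`. -/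
def blockForm {M : ℕ} (H : Fin M → Finset (Fin N)) (φ : (Fin N → ℝ) → ℝ) (x : Fin N → ℝ) :
    (Idx H → ℝ) →L[ℝ] ℝ :=
  ∑ p : Idx H, blockDeriv (H p.1) (p.2 + 1) φ x • ContinuousLinearMap.proj (R := ℝ) p

end BlockCoord

end

open Filter Topology

noncomputable section

namespace BlockCoord

variable {N : ℕ}

/-! Within a block of n variables, the `u` are the coefficients of the logarithm of the series with
coefficients ẽ_h. Newton's recursion r ẽ_r = Σ j u_j ẽ_{r-j} therefore lets the û_r and the e_r, r ≤
n, determine each other. Equal coordinates thus mean equal multisets of values in every block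
(`exists_perm_of_coords_eq`), so an invariant φ factors through `coords`.

At a point with pairwise distinct coordinates, `coords` is a local diffeomorphism. Hence ψ inherits
differentiability from φ, and ∂_i φ = Σ_j ψ_j ∂_i û_j for i in the block. This linear system
degenerates at x⁰. It becomes regular after taking divided differences of both sides over k+1 of the
nodes x_i, for k = 0, …, n-1. On the right, ∂_i e_{r+1}(H) = e_r(H∖i) has divided difference (-1)^k
e_{r-k}(H∖S) over a set S of k+1 indices. With the normalisation and the logarithm, the matrix of
the system tends to diag((-1)^k) (`tendsto_gradDivDiff_uHat`). On the left, the divided difference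
of the gradient of a symmetric C^{k+1} function has the limit D^{k+1}φ(h_0, …, h_k)/k! at x⁰, where
h_0 = e_{a 0} and h_q = Σ_{p<q} e_{a p} - q e_{a q} (`tendsto_gradDivDiff`). Solving the system
shows that the derivative of ψ in û_{k+1} tends to (-1)^k/k! · D^{k+1}φ(h_0, …, h_k). Multilinear
expansion turns this into a sum over set partitions with the Möbius coefficients (-1)^(l-1) (l-1)!;
collecting set partitions by type gives `blockDeriv` (`blockDeriv_eq_iteratedFDeriv_helmert`).

For the derivative relative to the image: around a point whose block is constant, û_r is homogeneous
of degree r up to its value there, so the segment from x⁰ to x maps to a curve with components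
û_r(x⁰) + s^r (û_r(x) - û_r(x⁰)). The mean value theorem on this curve bounds the remainder by a
small multiple of ‖û(x) - û(x⁰)‖. Points of the image near û(x⁰) come only from x near x⁰
(`tendsto_of_coords`).

For φ = Σ f(x_i) the higher derivatives are diagonal. The vector h_0 selects the index a 0, where
every other h_q has entry 1, which leaves f^{(k+1)}(y_α). -/

/-! ### The logarithm of a formal series and Newton's recursion. -/

/-- The `r`-th coefficient of the logarithm of the formal series `1 + ∑ a_h X^h`, as a sum over
partitions. -/
def logCoeff (a : ℕ → ℝ) (r : ℕ) : ℝ :=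
  ∑ lam : r.Partition,
    (-1 : ℝ) ^ (lam.parts.card - 1) * ((lam.parts.card - 1).factorial : ℝ) /
      (∏ h ∈ Finset.Icc 1 r, ((lam.parts.count h).factorial : ℝ)) * (lam.parts.map a).prod

lemma prod_map_eq_prod_pow_count {r R : ℕ} (hr : r ≤ R) (lam : r.Partition) (a : ℕ → ℝ) :
    (lam.parts.map a).prod = ∏ h ∈ Finset.Icc 1 R, a h ^ lam.parts.count h := by
  rw [Finset.prod_multiset_map_count]
  refine Finset.prod_subset (fun h hh => ?_) (fun h _ hh => ?_)
  · rw [Multiset.mem_toFinset] at hh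
    exact Finset.mem_Icc.2 ⟨lam.parts_pos hh, (lam.le_of_mem_parts hh).trans hr⟩
  · rw [Multiset.mem_toFinset] at hh
    rw [Multiset.count_eq_zero_of_notMem hh, pow_zero]

lemma sum_count_eq_card {r R : ℕ} (hr : r ≤ R) (lam : r.Partition) :
    ∑ h ∈ Finset.Icc 1 R, lam.parts.count h = lam.parts.card := by
  rw [← Multiset.toFinset_sum_count_eq]
  refine (Finset.sum_subset (fun h hh => ?_) (fun h _ hh => ?_)).symm
  · rw [Multiset.mem_toFinset] at hh
    exact Finset.mem_Icc.2 ⟨lam.parts_pos hh, (lam.le_of_mem_parts hh).trans hr⟩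
  · rw [Multiset.mem_toFinset] at hh
    exact Multiset.count_eq_zero_of_notMem hh

lemma sum_mul_count_eq {r R : ℕ} (hr : r ≤ R) (lam : r.Partition) :
    ∑ h ∈ Finset.Icc 1 R, h * lam.parts.count h = r := by
  conv_rhs => rw [← lam.parts_sum]
  rw [Finset.sum_multiset_count]
  refine (Finset.sum_subset (fun h hh => ?_) (fun h _ hh => ?_)).symm.trans
    (Finset.sum_congr rfl fun h _ => ?_)
  · rw [Multiset.mem_toFinset] at hh
    exact Finset.mem_Icc.2 ⟨lam.parts_pos hh, (lam.le_of_mem_parts hh).trans hr⟩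
  · rw [Multiset.mem_toFinset] at hh
    rw [Multiset.count_eq_zero_of_notMem hh, mul_zero]
  · rw [smul_eq_mul, mul_comm]

lemma prod_factorial_count {r R : ℕ} (hr : r ≤ R) (lam : r.Partition) :
    ∏ h ∈ Finset.Icc 1 R, (lam.parts.count h).factorial =
      ∏ h ∈ Finset.Icc 1 r, (lam.parts.count h).factorial := by
  refine (Finset.prod_subset (Finset.Icc_subset_Icc_right hr) (fun h hh hh' => ?_)).symm
  have : h ∉ lam.parts := fun hm => hh' (Finset.mem_Icc.2
    ⟨lam.parts_pos hm, lam.le_of_mem_parts hm⟩)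
  rw [Multiset.count_eq_zero_of_notMem this, Nat.factorial_zero]

/-- The coefficients of the powers of a polynomial without constant term, as sums over
partitions. -/
lemma coeff_pow_eq_sum_partition (a : ℕ → ℝ) {R m : ℕ} (hm : m ≤ R) (l : ℕ) :
    ((∑ h ∈ Finset.Icc 1 R, Polynomial.C (a h) * Polynomial.X ^ h) ^ l).coeff m =
      ∑ lam : m.Partition with lam.parts.card = l,
        (l.factorial : ℝ) / (∏ h ∈ Finset.Icc 1 m, ((lam.parts.count h).factorial : ℝ)) *
          (lam.parts.map a).prod := by
  rw [Finset.sum_pow_eq_sum_piAntidiag, Polynomial.finsetSum_coeff]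
  have key : ∀ k : ℕ → ℕ, ((Nat.multinomial (Finset.Icc 1 R) k : Polynomial ℝ) *
      ∏ h ∈ Finset.Icc 1 R, (Polynomial.C (a h) * Polynomial.X ^ h) ^ k h).coeff m =
      if ∑ h ∈ Finset.Icc 1 R, h * k h = m then
        (Nat.multinomial (Finset.Icc 1 R) k : ℝ) * ∏ h ∈ Finset.Icc 1 R, a h ^ k h else 0 := by
    intro k
    have : (Nat.multinomial (Finset.Icc 1 R) k : Polynomial ℝ) *
      ∏ h ∈ Finset.Icc 1 R, (Polynomial.C (a h) * Polynomial.X ^ h) ^ k h =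
      Polynomial.C ((Nat.multinomial (Finset.Icc 1 R) k : ℝ) * ∏ h ∈ Finset.Icc 1 R, a h ^ k h) *
        Polynomial.X ^ (∑ h ∈ Finset.Icc 1 R, h * k h) := by
      simp only [mul_pow, Finset.prod_mul_distrib, map_mul, map_prod, map_pow, map_natCast,
        ← pow_mul, Finset.prod_pow_eq_pow_sum, mul_assoc]
    rw [this, Polynomial.coeff_C_mul_X_pow]
    simp only [eq_comm]
  simp only [key]
  rw [← Finset.sum_filter]
  symm
  -- A partition is encoded by its multiplicities k_h; the conditions Σ k_h = l and Σ h k_h = m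
  -- select exactly the terms of the multinomial expansion that contribute to X^m.
  refine Finset.sum_bij (fun lam _ h => lam.parts.count h) ?_ ?_ ?_ ?_
  · intro lam hlam
    rw [Finset.mem_filter] at hlam ⊢
    refine ⟨Finset.mem_piAntidiag.2 ⟨?_, fun h hh => ?_⟩, sum_mul_count_eq hm lam⟩
    · rw [← hlam.2]; exact sum_count_eq_card hm lam
    · have := Multiset.count_ne_zero.1 hh
      exact Finset.mem_Icc.2 ⟨lam.parts_pos this, (lam.le_of_mem_parts this).trans hm⟩
  · intro lam _ lam' _ h
    refine Nat.Partition.ext (Multiset.ext.2 fun q => congrFun h q)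
  · intro k hk
    rw [Finset.mem_filter, Finset.mem_piAntidiag] at hk
    have hc : ∀ q, (∑ h ∈ Finset.Icc 1 R, Multiset.replicate (k h) h).count q = k q := by
      intro q
      rw [Multiset.count_sum']
      simp only [Multiset.count_replicate]
      rw [Finset.sum_ite_eq']
      split_ifs with hq
      · rfl
      · by_contra h0
        exact hq (hk.1.2 q (Ne.symm h0))
    refine ⟨⟨∑ h ∈ Finset.Icc 1 R, Multiset.replicate (k h) h, ?_, ?_⟩, ?_, ?_⟩
    · intro i hi
      obtain ⟨h, hh, hi⟩ := Multiset.mem_sum.1 hi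
      rw [Multiset.eq_of_mem_replicate hi]
      exact (Finset.mem_Icc.1 hh).1
    · rw [← hk.2, ← Multiset.coe_sumAddMonoidHom, map_sum]
      simp [mul_comm]
    · simp only [Finset.mem_filter, Finset.mem_univ, true_and]
      rw [← hk.1.1, Multiset.card_sum]
      simp
    · exact funext hc
  · intro lam hlam
    rw [Finset.mem_filter] at hlam
    rw [prod_map_eq_prod_pow_count hm, Nat.multinomial, sum_count_eq_card hm, hlam.2]
    congr 1
    rw [Nat.cast_div, prod_factorial_count hm]
    · push_cast; rfl
    · rw [← hlam.2, ← sum_count_eq_card hm]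
      exact Nat.prod_factorial_dvd_factorial_sum _ _
    · positivity

/-- Partitions are grouped by their length l + 1, and (l+1)!/(l+1) = l!. Stopping at l + 1 = R loses
nothing because a partition of m has at most m ≤ R parts. -/
lemma logCoeff_eq_sum_coeff_pow (a : ℕ → ℝ) {R m : ℕ} (hm : m ≤ R) (hm0 : 1 ≤ m) :
    logCoeff a m = ∑ l ∈ Finset.range R, (-1 : ℝ) ^ l / (l + 1) *
      ((∑ h ∈ Finset.Icc 1 R, Polynomial.C (a h) * Polynomial.X ^ h) ^ (l + 1)).coeff m := by
  have hcard : ∀ lam : m.Partition, 1 ≤ lam.parts.card ∧ lam.parts.card ≤ m := by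
    intro lam
    constructor
    · rw [Nat.one_le_iff_ne_zero]
      intro h
      have := lam.parts_sum
      rw [Multiset.card_eq_zero.1 h] at this
      simp at this
      omega
    · conv_rhs => rw [← lam.parts_sum]
      have := Multiset.card_nsmul_le_sum (s := lam.parts) (a := 1) fun x hx => lam.parts_pos hx
      simpa using this
  simp only [coeff_pow_eq_sum_partition a hm, Finset.mul_sum]
  rw [logCoeff, ← Finset.sum_fiberwise_of_maps_to (s := Finset.univ) (t := Finset.range R)
    (g := fun lam : m.Partition => lam.parts.card - 1)]
  · refine Finset.sum_congr rfl fun l _ => ?_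
    refine Finset.sum_congr ?_ fun lam hlam => ?_
    · ext lam
      have := hcard lam
      simp only [Finset.mem_filter, Finset.mem_univ, true_and]
      omega
    · rw [Finset.mem_filter] at hlam
      have : (l : ℝ) + 1 ≠ 0 := by positivity
      rw [hlam.2, Nat.add_sub_cancel, Nat.factorial_succ]
      push_cast
      field_simp
  · intro lam _
    have := hcard lam
    rw [Finset.mem_range]
    omega

/-- Newton's recursion between a formal series and its logarithm. -/
lemma newton_logCoeff (a : ℕ → ℝ) (ha : a 0 = 1) {r : ℕ} (hr : 1 ≤ r) :
    (r : ℝ) * a r = ∑ j ∈ Finset.Icc 1 r, (j : ℝ) * logCoeff a j * a (r - j) := by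
  set B : Polynomial ℝ := ∑ h ∈ Finset.Icc 1 r, Polynomial.C (a h) * Polynomial.X ^ h with hB
  have hBc : ∀ m, m ≤ r → (1 + B).coeff m = a m := by
    intro m hm
    rw [Polynomial.coeff_add, hB, Polynomial.finsetSum_coeff]
    simp only [Polynomial.coeff_C_mul_X_pow, Polynomial.coeff_one]
    rw [Finset.sum_ite_eq]
    rcases Nat.eq_zero_or_pos m with rfl | h
    · simp [ha]
    · rw [if_neg (by omega), if_pos (Finset.mem_Icc.2 ⟨h, hm⟩), zero_add]
  -- The truncated logarithm of 1 + B.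
  set Cp : Polynomial ℝ := ∑ l ∈ Finset.range r, Polynomial.C ((-1 : ℝ) ^ l / (l + 1)) * B ^ (l + 1)
    with hCp
  have hCc : ∀ m, 1 ≤ m → m ≤ r → Cp.coeff m = logCoeff a m := by
    intro m h1 hm
    rw [logCoeff_eq_sum_coeff_pow a hm h1, hCp, Polynomial.finsetSum_coeff]
    simp only [Polynomial.coeff_C_mul, hB]
  have hder : Polynomial.derivative Cp =
      (∑ l ∈ Finset.range r, (-B) ^ l) * Polynomial.derivative B := by
    rw [hCp, Polynomial.derivative_sum, Finset.sum_mul]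
    refine Finset.sum_congr rfl fun l _ => ?_
    rw [Polynomial.derivative_C_mul, Polynomial.derivative_pow, neg_pow B l]
    have h1 : (l : ℝ) + 1 ≠ 0 := by positivity
    have h2 : Polynomial.C ((-1 : ℝ) ^ l / (l + 1)) * Polynomial.C ((l + 1 : ℕ) : ℝ) =
        (-1 : Polynomial ℝ) ^ l := by
      rw [← Polynomial.C_mul]
      push_cast
      rw [div_mul_cancel₀ _ h1]
      simp
    rw [← h2, Nat.add_sub_cancel]
    ring
  -- The geometric sum gives (1 + B) Cp' = B' up to a multiple of B^r. Since X divides B, the error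
  -- does not reach the coefficient of X^(r-1), where the recursion is read off.
  have hgeom : (1 + B) * Polynomial.derivative Cp =
      Polynomial.derivative B - (-B) ^ r * Polynomial.derivative B := by
    rw [hder, ← mul_assoc]
    have := mul_neg_geom_sum (-B) r
    rw [sub_neg_eq_add] at this
    rw [this]; ring
  have hXB : Polynomial.X ∣ B := by
    refine Finset.dvd_sum fun h hh => Dvd.dvd.mul_left (dvd_pow_self _ ?_) _
    have := (Finset.mem_Icc.1 hh).1
    omega
  obtain ⟨s, rfl⟩ : ∃ s, r = s + 1 := ⟨r - 1, by omega⟩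
  have hco := congrArg (fun p => Polynomial.coeff p s) hgeom
  simp only [Polynomial.coeff_sub] at hco
  have hz : ((-B) ^ (s + 1) * Polynomial.derivative B).coeff s = 0 := by
    obtain ⟨q, hq⟩ : Polynomial.X ^ (s + 1) ∣ (-B) ^ (s + 1) * Polynomial.derivative B :=
      Dvd.dvd.mul_right (pow_dvd_pow_of_dvd ((dvd_neg).2 hXB) _) _
    rw [hq, Polynomial.coeff_X_pow_mul']
    simp
  have hdB : (Polynomial.derivative B).coeff s = ((s + 1 : ℕ) : ℝ) * a (s + 1) := by
    have : Polynomial.derivative B = Polynomial.derivative (1 + B) := by simp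
    rw [this, Polynomial.coeff_derivative, hBc _ le_rfl]
    push_cast; ring
  rw [hz, sub_zero, hdB, Polynomial.coeff_mul, Finset.Nat.sum_antidiagonal_eq_sum_range_succ_mk]
    at hco
  rw [← hco, ← Finset.sum_range_reflect, Finset.range_eq_Ico,
    Finset.sum_Ico_eq_sum_range, ← Finset.Ico_add_one_right_eq_Icc, Finset.sum_Ico_eq_sum_range]
  refine Finset.sum_congr (by simp) fun j hj => ?_
  have hj' : j < s + 1 := by simpa using hj
  rw [hBc _ (by omega), Polynomial.coeff_derivative]
  have e1 : s - (s + 1 - 1 - (0 + j)) = j := by omega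
  have e2 : s + 1 - (1 + j) = s + 1 - 1 - (0 + j) := by omega
  simp only [Nat.succ_eq_add_one, e1] at *
  rw [hCc _ (by omega) (by omega)]
  rw [e2, add_comm 1 j]
  push_cast
  ring

/-- If a derivation is applied to Newton's recursion, then the derivatives of the coefficients of a
series are expressed by those of the coefficients of its logarithm. -/
lemma derivation_eq_sum_of_newton (a c da dc : ℕ → ℝ) (hda : da 0 = 0)
    (hN : ∀ r : ℕ, 1 ≤ r → (r : ℝ) * a r = ∑ j ∈ Finset.Icc 1 r, (j : ℝ) * c j * a (r - j))
    (hD : ∀ r : ℕ, 1 ≤ r → (r : ℝ) * da r =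
      ∑ j ∈ Finset.Icc 1 r, (j : ℝ) * (dc j * a (r - j) + c j * da (r - j))) (r : ℕ) :
    da r = ∑ j ∈ Finset.Icc 1 r, a (r - j) * dc j := by
  induction r using Nat.strong_induction_on with
  | _ r ih =>
  rcases Nat.eq_zero_or_pos r with rfl | hr
  · simpa using hda
  have hr0 : (r : ℝ) ≠ 0 := by positivity
  apply mul_left_cancel₀ hr0
  rw [hD r hr]
  -- The induction hypothesis is inserted for da (r - j), the sums are exchanged, and the inner sum
  -- is Newton's recursion for a (r - i). Its factor r - i completes the weight i of the other
  -- summand to r.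
  have h1 : ∑ j ∈ Finset.Icc 1 r, (j : ℝ) * (c j * da (r - j)) =
      ∑ i ∈ Finset.Icc 1 r, ((r : ℝ) - i) * a (r - i) * dc i := by
    have h2 : ∀ j ∈ Finset.Icc 1 r, (j : ℝ) * (c j * da (r - j)) =
        ∑ i ∈ Finset.Icc 1 (r - j), (j : ℝ) * c j * a (r - j - i) * dc i := by
      intro j hj
      rw [Finset.mem_Icc] at hj
      rw [ih (r - j) (by omega), Finset.mul_sum, Finset.mul_sum]
      exact Finset.sum_congr rfl fun i _ => by ring
    have h3 : ∀ i ∈ Finset.Icc 1 r, ((r : ℝ) - i) * a (r - i) * dc i =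
        ∑ j ∈ Finset.Icc 1 (r - i), (j : ℝ) * c j * a (r - j - i) * dc i := by
      intro i hi
      rw [Finset.mem_Icc] at hi
      rw [← Nat.cast_sub hi.2]
      rcases Nat.eq_zero_or_pos (r - i) with h | h
      · simp [h]
      · rw [hN _ h, Finset.sum_mul]
        exact Finset.sum_congr rfl fun j _ => by rw [Nat.sub_right_comm]
    rw [Finset.sum_congr rfl h2, Finset.sum_congr rfl h3]
    refine Finset.sum_comm' fun i j => ?_
    simp only [Finset.mem_Icc]
    omega
  simp only [mul_add, Finset.sum_add_distrib]
  rw [h1, ← Finset.sum_add_distrib, Finset.mul_sum]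
  exact Finset.sum_congr rfl fun i _ => by ring

/-! ### Elementary symmetric functions and the smoothness of the coordinates. -/

/-- The elementary symmetric function of the variables `x_i`, `i ∈ H`. -/
def esym (H : Finset (Fin N)) (r : ℕ) (x : Fin N → ℝ) : ℝ := (H.val.map x).esymm r

lemma esym_eq_sum (H : Finset (Fin N)) (r : ℕ) (x : Fin N → ℝ) :
    esym H r x = ∑ t ∈ H.powersetCard r, ∏ i ∈ t, x i := Finset.esymm_map_val x H r

@[simp] lemma esym_zero (H : Finset (Fin N)) (x : Fin N → ℝ) : esym H 0 x = 1 := by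
  simp [esym_eq_sum]

lemma esym_eq_zero_of_card_lt {H : Finset (Fin N)} {r : ℕ} (h : H.card < r) (x : Fin N → ℝ) :
    esym H r x = 0 := by
  rw [esym_eq_sum, Finset.powersetCard_eq_empty.2 h, Finset.sum_empty]

lemma esym_congr {H : Finset (Fin N)} (r : ℕ) {x x' : Fin N → ℝ} (h : ∀ i ∈ H, x i = x' i) :
    esym H r x = esym H r x' := by
  simp only [esym_eq_sum]
  refine Finset.sum_congr rfl fun t ht => Finset.prod_congr rfl fun i hi => h i ?_
  exact (Finset.mem_powersetCard.1 ht).1 hi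

lemma esym_insert {R : Finset (Fin N)} {j : Fin N} (hj : j ∉ R) (r : ℕ) (x : Fin N → ℝ) :
    esym (insert j R) (r + 1) x = esym R (r + 1) x + x j * esym R r x := by
  unfold esym Multiset.esymm
  rw [Finset.insert_val_of_notMem hj, Multiset.map_cons, Multiset.powersetCard_cons,
    Multiset.map_add, Multiset.sum_add, Multiset.map_map]
  congr 1
  simp only [Function.comp_def, Multiset.prod_cons, Multiset.sum_map_mul_left]

lemma esym_eq_erase {H : Finset (Fin N)} {j : Fin N} (hj : j ∈ H) (r : ℕ) (x : Fin N → ℝ) :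
    esym H (r + 1) x = esym (H.erase j) (r + 1) x + x j * esym (H.erase j) r x := by
  conv_lhs => rw [← Finset.insert_erase hj]
  exact esym_insert (Finset.notMem_erase j H) r x

lemma contDiff_esym (H : Finset (Fin N)) (r : ℕ) {m : WithTop ℕ∞} :
    ContDiff ℝ m (esym H r) := by
  have : esym H r = fun x => ∑ t ∈ H.powersetCard r, ∏ i ∈ t, x i :=
    funext fun x => esym_eq_sum H r x
  rw [this]
  exact ContDiff.sum fun t _ => contDiff_prod fun i _ => contDiff_apply ℝ ℝ i

lemma contDiff_eTilde (H : Finset (Fin N)) (r : ℕ) {m : WithTop ℕ∞} :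
    ContDiff ℝ m (eTilde H r) := (contDiff_esym H r).div_const _

lemma u_eq_logCoeff (H : Finset (Fin N)) (r : ℕ) (x : Fin N → ℝ) :
    u H r x = logCoeff (fun h => eTilde H h x) r := rfl

lemma contDiff_u (H : Finset (Fin N)) (r : ℕ) {m : WithTop ℕ∞} : ContDiff ℝ m (u H r) := by
  unfold u eTildePart
  simp only [fun (lam : r.Partition) (x : Fin N → ℝ) =>
    prod_map_eq_prod_pow_count le_rfl lam (fun h => eTilde H h x)]
  exact ContDiff.sum fun lam _ => contDiff_const.mul
    (contDiff_prod fun h _ => (contDiff_eTilde H h).pow _)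

lemma contDiff_uHat (H : Finset (Fin N)) (r : ℕ) {m : WithTop ℕ∞} : ContDiff ℝ m (uHat H r) :=
  contDiff_const.mul (contDiff_u H r)

@[simp] lemma eTilde_zero (H : Finset (Fin N)) (x : Fin N → ℝ) : eTilde H 0 x = 1 := by
  have := esym_zero H x
  unfold esym at this
  simp [eTilde, this]

lemma newton_eTilde (H : Finset (Fin N)) (x : Fin N → ℝ) {r : ℕ} (hr : 1 ≤ r) :
    (r : ℝ) * eTilde H r x = ∑ j ∈ Finset.Icc 1 r, (j : ℝ) * u H j x * eTilde H (r - j) x :=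
  newton_logCoeff (fun h => eTilde H h x) (eTilde_zero H x) hr

/-- This is dE = E · d(log E) for the generating series E of the ẽ_h. It is a triangular system with
unit diagonal, and every later statement about derivatives of `u` is obtained from those of `eTilde`
through it. -/
lemma fderiv_eTilde_eq_sum (H : Finset (Fin N)) (x v : Fin N → ℝ) (r : ℕ) :
    fderiv ℝ (eTilde H r) x v =
      ∑ j ∈ Finset.Icc 1 r, eTilde H (r - j) x * fderiv ℝ (u H j) x v := by
  have du : ∀ j, HasFDerivAt (u H j) (fderiv ℝ (u H j) x) x := fun j =>
    ((contDiff_u H j (m := 1)).differentiable (by simp) x).hasFDerivAt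
  have de : ∀ j, HasFDerivAt (eTilde H j) (fderiv ℝ (eTilde H j) x) x := fun j =>
    ((contDiff_eTilde H j (m := 1)).differentiable (by simp) x).hasFDerivAt
  refine derivation_eq_sum_of_newton (fun h => eTilde H h x) (fun j => u H j x)
    (fun r => fderiv ℝ (eTilde H r) x v) (fun j => fderiv ℝ (u H j) x v) ?_
    (fun r hr => newton_eTilde H x hr) ?_ r
  · have : eTilde H 0 = fun _ => (1 : ℝ) := funext fun x => eTilde_zero H x
    simp [this]
  · intro r hr
    have h1 : HasFDerivAt (fun x => (r : ℝ) * eTilde H r x)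
        ((r : ℝ) • fderiv ℝ (eTilde H r) x) x := (de r).const_mul _
    have h2 : HasFDerivAt (fun x => ∑ j ∈ Finset.Icc 1 r, (j : ℝ) * u H j x * eTilde H (r - j) x)
        (∑ j ∈ Finset.Icc 1 r, (((j : ℝ) * u H j x) • fderiv ℝ (eTilde H (r - j)) x +
          eTilde H (r - j) x • ((j : ℝ) • fderiv ℝ (u H j) x))) x :=
      HasFDerivAt.fun_sum fun j _ => ((du j).const_mul _).mul (de (r - j))
    have h3 : (fun x => (r : ℝ) * eTilde H r x) =
        fun x => ∑ j ∈ Finset.Icc 1 r, (j : ℝ) * u H j x * eTilde H (r - j) x :=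
      funext fun x => newton_eTilde H x hr
    rw [h3] at h1
    have h4 := congrArg (fun L => L v) (h1.unique h2)
    simp only [smul_apply, smul_eq_mul, sum_apply,
      add_apply] at h4
    rw [h4]
    exact Finset.sum_congr rfl fun j _ => by ring

/-! ### Partial derivatives of elementary symmetric functions -/

lemma fderiv_esym_single_of_mem {H : Finset (Fin N)} {i : Fin N} (hi : i ∈ H) (r : ℕ)
    (x : Fin N → ℝ) :
    fderiv ℝ (esym H (r + 1)) x (Pi.single i 1) = esym (H.erase i) r x := by
  have h1 : HasFDerivAt (esym H (r + 1)) (fderiv ℝ (esym H (r + 1)) x) x :=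
    ((contDiff_esym H (r + 1) (m := 1)).differentiable (by simp) x).hasFDerivAt
  have h2 : HasDerivAt (fun t : ℝ => esym H (r + 1) (x + t • Pi.single i (1 : ℝ)))
      (fderiv ℝ (esym H (r + 1)) x (Pi.single i 1)) 0 := h1.hasLineDerivAt _
  have h3 : (fun t : ℝ => esym H (r + 1) (x + t • Pi.single i (1 : ℝ))) =
      fun t => esym (H.erase i) (r + 1) x + (x i + t) * esym (H.erase i) r x := by
    funext t
    have hc : ∀ k ∈ H.erase i, (x + t • Pi.single i (1 : ℝ) : Fin N → ℝ) k = x k := by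
      intro k hk
      simp [Finset.ne_of_mem_erase hk]
    rw [esym_eq_erase hi, esym_congr _ hc, esym_congr _ hc]
    simp
  rw [h3] at h2
  have h4 : HasDerivAt (fun t : ℝ => esym (H.erase i) (r + 1) x + (x i + t) * esym (H.erase i) r x)
      (1 * esym (H.erase i) r x) 0 :=
    ((((hasDerivAt_id (0 : ℝ)).const_add (x i))).mul_const _).const_add _
  rw [h2.unique h4, one_mul]

lemma fderiv_eq_zero_of_congr {H : Finset (Fin N)} {F : (Fin N → ℝ) → ℝ}
    (hF : ∀ x x' : Fin N → ℝ, (∀ i ∈ H, x i = x' i) → F x = F x') (x : Fin N → ℝ)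
    (hd : DifferentiableAt ℝ F x) {i : Fin N} (hi : i ∉ H) :
    fderiv ℝ F x (Pi.single i 1) = 0 := by
  have h2 : HasDerivAt (fun t : ℝ => F (x + t • Pi.single i (1 : ℝ)))
      (fderiv ℝ F x (Pi.single i 1)) 0 := hd.hasFDerivAt.hasLineDerivAt _
  have h3 : (fun t : ℝ => F (x + t • Pi.single i (1 : ℝ))) = fun _ => F x := by
    funext t
    refine hF _ _ fun k hk => ?_
    have : k ≠ i := fun h => hi (h ▸ hk)
    simp [this]
  rw [h3] at h2
  exact h2.unique (hasDerivAt_const _ _)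

lemma eTilde_congr {H : Finset (Fin N)} (r : ℕ) {x x' : Fin N → ℝ} (h : ∀ i ∈ H, x i = x' i) :
    eTilde H r x = eTilde H r x' :=
  congrArg (· / (H.card.descFactorial r : ℝ)) (esym_congr r h)

lemma u_congr {H : Finset (Fin N)} (r : ℕ) {x x' : Fin N → ℝ} (h : ∀ i ∈ H, x i = x' i) :
    u H r x = u H r x' := by
  simp only [u_eq_logCoeff]
  congr 1
  exact funext fun r => eTilde_congr r h

lemma uHat_congr {H : Finset (Fin N)} (r : ℕ) {x x' : Fin N → ℝ} (h : ∀ i ∈ H, x i = x' i) :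
    uHat H r x = uHat H r x' := congrArg (fun t => (H.card.descFactorial r : ℝ) * t) (u_congr r h)

lemma eTilde_eq (H : Finset (Fin N)) (r : ℕ) (x : Fin N → ℝ) :
    eTilde H r x = esym H r x / (H.card.descFactorial r : ℝ) := rfl

/-- For r > |H| the quotient defining `eTilde` has denominator 0, but both sides vanish. -/
lemma esym_eq (H : Finset (Fin N)) (r : ℕ) (x : Fin N → ℝ) :
    esym H r x = (H.card.descFactorial r : ℝ) * eTilde H r x := by
  rcases le_or_gt r H.card with h | h
  · have : (H.card.descFactorial r : ℝ) ≠ 0 := by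
      rw [Nat.cast_ne_zero]
      exact (Nat.pos_iff_ne_zero.1 (Nat.descFactorial_pos.2 h))
    rw [eTilde_eq, mul_div_cancel₀ _ this]
  · rw [esym_eq_zero_of_card_lt h, Nat.descFactorial_of_lt h]
    simp

/-- Double counting: an r-subset of H avoids exactly |H| - r elements of H. -/
lemma sum_esym_erase (H : Finset (Fin N)) (r : ℕ) (x : Fin N → ℝ) :
    ∑ i ∈ H, esym (H.erase i) r x = ((H.card : ℝ) - r) * esym H r x := by
  simp only [esym_eq_sum, Finset.mul_sum]
  rw [Finset.sum_comm' (t' := H.powersetCard r) (s' := fun t => H \ t)]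
  · refine Finset.sum_congr rfl fun t ht => ?_
    rw [Finset.mem_powersetCard] at ht
    rw [Finset.sum_const, Finset.card_sdiff_of_subset ht.1, ht.2, nsmul_eq_mul, Nat.cast_sub]
    rw [← ht.2]; exact Finset.card_le_card ht.1
  · intro i t
    simp only [Finset.mem_powersetCard, Finset.mem_sdiff, Finset.subset_erase]
    tauto

/-! ### The coordinates under translation and scaling. -/

lemma fderiv_esym_const (H : Finset (Fin N)) (r : ℕ) (x : Fin N → ℝ) :
    fderiv ℝ (esym H (r + 1)) x (fun _ => 1) = ((H.card : ℝ) - r) * esym H r x := by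
  have : (fun _ => 1 : Fin N → ℝ) = ∑ i, Pi.single i (1 : ℝ) := by
    rw [Finset.univ_sum_single]
  rw [this, map_sum, ← sum_esym_erase, ← Finset.sum_subset (Finset.subset_univ H)]
  · exact Finset.sum_congr rfl fun i hi => fderiv_esym_single_of_mem hi r x
  · intro i _ hi
    exact fderiv_eq_zero_of_congr (fun _ _ h => esym_congr _ h) x
      ((contDiff_esym H (r + 1) (m := 1)).differentiable (by simp) x) hi

lemma fderiv_eTilde (H : Finset (Fin N)) (r : ℕ) (x v : Fin N → ℝ) :
    fderiv ℝ (eTilde H r) x v = fderiv ℝ (esym H r) x v / (H.card.descFactorial r : ℝ) := by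
  have : eTilde H r = fun x => ((H.card.descFactorial r : ℝ))⁻¹ * esym H r x := by
    funext x; rw [eTilde_eq]; ring
  rw [this, fderiv_const_mul ((contDiff_esym H r (m := 1)).differentiable (by simp) x)]
  simp only [smul_apply, smul_eq_mul]
  ring

/-- The normalisation of ẽ serves to cancel the factor |H| - r here, so that translation acts on ẽ_r
as differentiation acts on t^r/r!. -/
lemma fderiv_eTilde_const {H : Finset (Fin N)} {r : ℕ} (hr : r + 1 ≤ H.card) (x : Fin N → ℝ) :
    fderiv ℝ (eTilde H (r + 1)) x (fun _ => 1) = eTilde H r x := by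
  rw [fderiv_eTilde, fderiv_esym_const, eTilde_eq, Nat.descFactorial_succ, Nat.cast_mul,
    Nat.cast_sub (by omega)]
  have : (H.card : ℝ) - r ≠ 0 := by
    rw [← Nat.cast_sub (by omega), Nat.cast_ne_zero]; omega
  rw [mul_div_mul_left _ _ this]

lemma eq_of_triangular {a b b' : ℕ → ℝ} (ha : a 0 = 1) {n : ℕ}
    (h : ∀ r, 1 ≤ r → r ≤ n → ∑ j ∈ Finset.Icc 1 r, a (r - j) * b j =
      ∑ j ∈ Finset.Icc 1 r, a (r - j) * b' j) {r : ℕ} (h1 : 1 ≤ r) (hr : r ≤ n) : b r = b' r := by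
  induction r using Nat.strong_induction_on with
  | _ r ih =>
  have := h r h1 hr
  obtain ⟨s, rfl⟩ : ∃ s, r = s + 1 := ⟨r - 1, by omega⟩
  rw [Finset.sum_Icc_succ_top (by omega), Finset.sum_Icc_succ_top (by omega), Nat.sub_self, ha,
    one_mul, one_mul] at this
  have h2 : ∑ j ∈ Finset.Icc 1 s, a (s + 1 - j) * b j =
      ∑ j ∈ Finset.Icc 1 s, a (s + 1 - j) * b' j := by
    refine Finset.sum_congr rfl fun j hj => ?_
    rw [Finset.mem_Icc] at hj
    rw [ih j (by omega) hj.1 (by omega)]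
  linarith

/-- The derivatives along (1, …, 1) solve the unit triangular system of `fderiv_eTilde_eq_sum` with
right-hand side ẽ_{r-1}, which is also solved by the indicator of r = 1. -/
lemma fderiv_u_const {H : Finset (Fin N)} {r : ℕ} (h1 : 1 ≤ r) (hr : r ≤ H.card)
    (x : Fin N → ℝ) :
    fderiv ℝ (u H r) x (fun _ => 1) = if r = 1 then 1 else 0 := by
  refine eq_of_triangular (a := fun h => eTilde H h x) (eTilde_zero H x)
    (b := fun r => fderiv ℝ (u H r) x (fun _ => 1)) (b' := fun r => if r = 1 then 1 else 0)
    (fun r h1 hr => ?_) h1 hr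
  rw [← fderiv_eTilde_eq_sum]
  obtain ⟨s, rfl⟩ : ∃ s, r = s + 1 := ⟨r - 1, by omega⟩
  rw [fderiv_eTilde_const hr]
  simp

lemma u_add_const {H : Finset (Fin N)} {r : ℕ} (h1 : 1 ≤ r) (hr : r ≤ H.card)
    (x : Fin N → ℝ) (s : ℝ) :
    u H r (fun i => x i + s) = u H r x + if r = 1 then s else 0 := by
  set c : ℝ := if r = 1 then 1 else 0 with hc
  have hd : ∀ t : ℝ, HasDerivAt (fun t : ℝ => u H r (fun i => x i + t) - t * c) 0 t := by
    intro t
    have h0 : HasDerivAt (fun t : ℝ => (fun i => x i + t : Fin N → ℝ)) (fun _ => 1) t :=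
      hasDerivAt_pi.2 fun i => (hasDerivAt_id t).const_add _
    have h2 := ((contDiff_u H r (m := 1)).differentiable (by simp)
      (fun i => x i + t)).hasFDerivAt.comp_hasDerivAt t h0
    rw [fderiv_u_const h1 hr] at h2
    have h3 := h2.sub ((hasDerivAt_id t).mul_const c)
    rwa [one_mul, sub_self] at h3
  have h := is_const_of_deriv_eq_zero (fun t => (hd t).differentiableAt) (fun t => (hd t).deriv) s 0
  simp only [add_zero, zero_mul, sub_zero] at h
  have : (if r = 1 then s else 0) = s * c := by rw [hc]; split_ifs <;> simp
  rw [this]; linarith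

lemma u_smul (H : Finset (Fin N)) (r : ℕ) (x : Fin N → ℝ) (s : ℝ) :
    u H r (fun i => s * x i) = s ^ r * u H r x := by
  have he : ∀ h, eTilde H h (fun i => s * x i) = s ^ h * eTilde H h x := by
    intro h
    rw [eTilde_eq, eTilde_eq, ← mul_div_assoc]
    congr 1
    rw [esym_eq_sum, esym_eq_sum, Finset.mul_sum]
    refine Finset.sum_congr rfl fun t ht => ?_
    rw [Finset.prod_mul_distrib, Finset.prod_const, (Finset.mem_powersetCard.1 ht).2]
  rw [u, u, Finset.mul_sum]
  refine Finset.sum_congr rfl fun lam _ => ?_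
  have : eTildePart H lam (fun i => s * x i) = s ^ r * eTildePart H lam x := by
    rw [eTildePart, eTildePart]
    simp only [he]
    rw [Multiset.prod_map_mul]
    congr 1
    rw [prod_map_eq_prod_pow_count le_rfl]
    simp only [← pow_mul]
    rw [Finset.prod_pow_eq_pow_sum, sum_mul_count_eq le_rfl]
  rw [this]; ring

/-! ### Counting sequences of a given type -/

/-- Orbit and stabiliser: the permutations fixing f form the product of the symmetric groups of its
fibres. -/
lemma card_image_comp_perm {α ι : Type*} [Fintype α] [DecidableEq α] [DecidableEq ι]
    (f : α → ι) :
    (Finset.univ.image fun τ : Equiv.Perm α => f ∘ τ).card *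
      ∏ i ∈ Finset.univ.image f, (Finset.univ.filter fun a => f a = i).card.factorial =
      (Fintype.card α).factorial := by
  have h1 := DomMulAct.stabilizer_card' f
  rw [← Fintype.card_perm, ← Finset.card_univ (α := Equiv.Perm α),
    Finset.card_eq_sum_card_image (fun τ : Equiv.Perm α => f ∘ τ) Finset.univ]
  rw [Finset.sum_const_nat (m := ∏ i ∈ Finset.univ.image f,
    (Finset.univ.filter fun a => f a = i).card.factorial)]
  intro g hg
  obtain ⟨τ, -, rfl⟩ := Finset.mem_image.1 hg
  simp only [← Fintype.card_subtype]
  rw [← h1]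
  refine Fintype.card_congr ((Equiv.mulRight τ⁻¹).subtypeEquiv fun ρ => ?_)
  simp only [Equiv.coe_mulRight, Equiv.Perm.coe_mul, ← Function.comp_assoc]
  constructor
  · intro h
    rw [h, Function.comp_assoc, ← Equiv.Perm.coe_mul, mul_inv_cancel]; rfl
  · intro h
    conv_rhs => rw [← h]
    rw [Function.comp_assoc, ← Equiv.Perm.coe_mul, inv_mul_cancel]; rfl

lemma map_univ_eq_iff_exists_perm {α β : Type*} [Fintype α] [DecidableEq β] (f g : α → β) :
    Finset.univ.val.map f = Finset.univ.val.map g ↔ ∃ τ : Equiv.Perm α, g ∘ τ = f := by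
  constructor
  · intro h
    have hc : ∀ b, Fintype.card {a // f a = b} = Fintype.card {a // g a = b} := by
      intro b
      have := congrArg (Multiset.count b) h
      rw [Multiset.count_map, Multiset.count_map, ← Finset.filter_val, ← Finset.filter_val,
        Finset.card_val, Finset.card_val] at this
      simp only [Fintype.card_subtype, eq_comm (b := b)]
      exact this
    refine ⟨Equiv.ofFiberEquiv fun b => Fintype.equivOfCardEq (hc b), funext fun a => ?_⟩
    exact Equiv.ofFiberEquiv_map _ a
  · rintro ⟨τ, rfl⟩
    rw [← Multiset.map_map, Multiset.map_univ_val_equiv]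

lemma exists_map_univ_eq {α β : Type*} [Fintype α] (M : Multiset β)
    (h : M.card = Fintype.card α) : ∃ f : α → β, Finset.univ.val.map f = M := by
  obtain ⟨l, rfl⟩ := Quotient.exists_rep M
  change ∃ f : α → β, Finset.univ.val.map f = (l : Multiset β)
  have hl : l.length = Fintype.card α := h
  let e : α ≃ Fin l.length := (Fintype.equivFin α).trans (finCongr hl.symm)
  refine ⟨fun a => l.get (e a), ?_⟩
  have h1 : (fun a => l.get (e a)) = l.get ∘ e := rfl
  rw [h1, ← Multiset.map_map, Multiset.map_univ_val_equiv, Fin.univ_val_map]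
  simp

/-- The multiplicities of the elements of `J` in a sequence. -/
def multiplicity (J : Finset (Fin N)) {g : ℕ} (i : Fin g → Fin N) (j : J) : ℕ :=
  (Finset.univ.filter fun q => i q = j).card

/-- The unused indices of J contribute zeros. Keeping them makes a type a multiset of size |J|, on
which orbit counting for permutations of J applies. -/
lemma map_multiplicity (J : Finset (Fin N)) {g : ℕ} (i : Fin g → Fin N) (hi : ∀ q, i q ∈ J) :
    Finset.univ.val.map (multiplicity J i) =
      (Finset.univ.image i).val.map (fun k => (Finset.univ.filter fun q => i q = k).card) +
        Multiset.replicate (J.card - (Finset.univ.image i).card) 0 := by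
  have hsub : Finset.univ.image i ⊆ J := fun k hk => by
    obtain ⟨q, -, rfl⟩ := Finset.mem_image.1 hk
    exact hi q
  have h1 : Finset.univ.val.map (multiplicity J i) =
      J.val.map (fun k => (Finset.univ.filter fun q => i q = k).card) := by
    have := Multiset.attach_map_val J.val
    conv_rhs => rw [← this]
    rw [Multiset.map_map]
    rfl
  have h2 : J.val = (Finset.univ.image i).val + (J \ Finset.univ.image i).val := by
    rw [Finset.sdiff_val]
    exact (add_tsub_cancel_of_le (Finset.val_le_iff.2 hsub)).symm
  rw [h1, h2, Multiset.map_add]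
  congr 1
  rw [Multiset.eq_replicate]
  constructor
  · rw [Multiset.card_map, Finset.card_val, Finset.card_sdiff_of_subset hsub]
  · intro b hb
    obtain ⟨k, hk, rfl⟩ := Multiset.mem_map.1 hb
    rw [Finset.card_eq_zero, Finset.filter_eq_empty_iff]
    intro q _ hq
    exact (Finset.mem_sdiff.1 hk).2 (Finset.mem_image.2 ⟨q, Finset.mem_univ _, hq⟩)

lemma mem_seqsOfType_iff {J : Finset (Fin N)} {g : ℕ} {σ : g.Partition} {i : Fin g → Fin N} :
    i ∈ seqsOfType J σ ↔ (∀ q, i q ∈ J) ∧ Finset.univ.val.map (multiplicity J i) =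
      σ.parts + Multiset.replicate (J.card - σ.parts.card) 0 := by
  rw [seqsOfType, Finset.mem_filter, and_iff_right (Finset.mem_univ _)]
  refine and_congr_right fun hi => ?_
  rw [map_multiplicity J i hi]
  constructor
  · intro h
    rw [← h, Multiset.card_map, Finset.card_val]
  · intro h
    have h2 := congrArg (Multiset.filter fun k => k ≠ 0) h
    rw [Multiset.filter_add, Multiset.filter_add, Multiset.filter_eq_self.2,
      Multiset.filter_eq_nil.2, Multiset.filter_eq_self.2, Multiset.filter_eq_nil.2] at h2
    · simpa using h2
    · intro a ha; simp [Multiset.eq_of_mem_replicate ha]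
    · intro a ha; exact (σ.parts_pos ha).ne'
    · intro a ha; simp [Multiset.eq_of_mem_replicate ha]
    · intro a ha
      obtain ⟨k, hk, rfl⟩ := Multiset.mem_map.1 ha
      obtain ⟨q, -, rfl⟩ := Finset.mem_image.1 (show k ∈ Finset.univ.image i from hk)
      exact (Finset.card_pos.2 ⟨q, by simp⟩).ne'

/-- The sequences with prescribed multiplicities form one orbit under permutations of the positions,
so their number is a multinomial coefficient. -/
lemma card_eq_multiplicity (J : Finset (Fin N)) {g : ℕ} (c : J → ℕ) (hc : ∑ j, c j = g) :
    (Finset.univ.filter fun i : Fin g → Fin N => (∀ q, i q ∈ J) ∧ multiplicity J i = c).card *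
      ∏ j, (c j).factorial = g.factorial := by
  obtain ⟨i₀, hi₀⟩ := exists_map_univ_eq (α := Fin g)
    (∑ j : J, Multiset.replicate (c j) (j : Fin N)) (by
      rw [Multiset.card_sum]; simpa using hc)
  have hmem : ∀ q, i₀ q ∈ J := by
    intro q
    have : i₀ q ∈ ∑ j : J, Multiset.replicate (c j) (j : Fin N) := by
      rw [← hi₀]; exact Multiset.mem_map_of_mem _ (Finset.mem_univ q)
    obtain ⟨j, -, hj⟩ := Multiset.mem_sum.1 this
    rw [Multiset.eq_of_mem_replicate hj]; exact j.2
  have hcount : ∀ (i : Fin g → Fin N) (k : Fin N),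
      (Finset.univ.val.map i).count k = (Finset.univ.filter fun q => i q = k).card := by
    intro i k
    rw [Multiset.count_map, ← Finset.filter_val, Finset.card_val]
    simp only [eq_comm]
  have hm₀ : multiplicity J i₀ = c := by
    funext j
    rw [multiplicity, ← hcount, hi₀, Multiset.count_sum']
    simp only [Multiset.count_replicate, Subtype.coe_inj]
    simp
  have hset : (Finset.univ.filter fun i : Fin g → Fin N => (∀ q, i q ∈ J) ∧ multiplicity J i = c) =
      Finset.univ.image fun τ : Equiv.Perm (Fin g) => i₀ ∘ τ := by
    ext i
    simp only [Finset.mem_filter, Finset.mem_univ, true_and, Finset.mem_image]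
    rw [← hm₀]
    constructor
    · rintro ⟨h1, h2⟩
      have : Finset.univ.val.map i = Finset.univ.val.map i₀ := by
        ext k
        rw [hcount, hcount]
        by_cases hk : k ∈ J
        · exact congrFun h2 ⟨k, hk⟩
        · rw [Finset.filter_false_of_mem, Finset.filter_false_of_mem]
          · intro q _ hq; exact hk (hq ▸ hmem q)
          · intro q _ hq; exact hk (hq ▸ h1 q)
      exact (map_univ_eq_iff_exists_perm i i₀).1 this
    · rintro ⟨τ, rfl⟩
      refine ⟨fun q => hmem _, ?_⟩
      have : Finset.univ.val.map (i₀ ∘ τ) = Finset.univ.val.map i₀ :=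
        (map_univ_eq_iff_exists_perm _ _).2 ⟨τ, rfl⟩
      funext j
      rw [multiplicity, multiplicity, ← hcount, ← hcount, this]
  have h := card_image_comp_perm i₀
  rw [Fintype.card_fin] at h
  rw [hset, ← h]
  congr 1
  have : ∏ j, (c j).factorial = ∏ k ∈ J, (Finset.univ.filter fun q => i₀ q = k).card.factorial := by
    rw [← Finset.prod_coe_sort J fun k => (Finset.univ.filter fun q => i₀ q = k).card.factorial,
      ← hm₀]; rfl
  rw [this]
  refine (Finset.prod_subset ?_ fun k _ hk => ?_).symm
  · intro k hk
    obtain ⟨q, -, rfl⟩ := Finset.mem_image.1 hk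
    exact hmem q
  · rw [Finset.filter_false_of_mem]
    · rfl
    · intro q _ hq
      exact hk (Finset.mem_image.2 ⟨q, Finset.mem_univ _, hq⟩)

/-- Two orbit counts are combined: the multiplicity functions J → ℕ of type σ are an orbit under
permutations of J, and each is realised by a multinomial number of sequences. The |J| - l zeros
enlarge the stabiliser by (|J| - l)!, which produces the falling factorial. -/
lemma card_seqsOfType {J : Finset (Fin N)} {g : ℕ} (σ : g.Partition)
    (hl : σ.parts.card ≤ J.card) :
    (seqsOfType J σ).card * ∏ h ∈ Finset.Icc 1 g,
      (h.factorial ^ σ.parts.count h * (σ.parts.count h).factorial) =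
      g.factorial * J.card.descFactorial σ.parts.card := by
  set P := σ.parts + Multiset.replicate (J.card - σ.parts.card) 0 with hP
  obtain ⟨c₀, hc₀⟩ := exists_map_univ_eq (α := J) P (by
    rw [hP, Multiset.card_add, Multiset.card_replicate, Fintype.card_coe]; omega)
  have hC := card_image_comp_perm c₀
  set C := Finset.univ.image fun τ : Equiv.Perm J => c₀ ∘ τ with hCdef
  have hmemC : ∀ c : J → ℕ, c ∈ C ↔ Finset.univ.val.map c = P := by
    intro c
    rw [← hc₀, map_univ_eq_iff_exists_perm, hCdef, Finset.mem_image]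
    simp
  have hz : (0 : ℕ) ∉ σ.parts := fun h => lt_irrefl 0 (σ.parts_pos h)
  have hfact : ∀ c ∈ C, ∏ j, (c j).factorial =
      ∏ h ∈ Finset.Icc 1 g, h.factorial ^ σ.parts.count h := by
    intro c hc
    have h1 : ∏ j, (c j).factorial = ((Finset.univ.val.map c).map Nat.factorial).prod := by
      rw [Multiset.map_map]; rfl
    rw [h1, (hmemC c).1 hc, hP, Multiset.map_add, Multiset.prod_add, Multiset.map_replicate,
      Nat.factorial_zero, Multiset.prod_replicate, one_pow, mul_one]
    have h2 := prod_map_eq_prod_pow_count le_rfl σ (fun h => (h.factorial : ℝ))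
    have h3 : (σ.parts.map fun h => (h.factorial : ℝ)).prod =
        (((σ.parts.map Nat.factorial).prod : ℕ) : ℝ) := by
      rw [Nat.cast_multiset_prod, Multiset.map_map]; rfl
    rw [h3] at h2
    exact_mod_cast h2
  have hsum : ∀ c ∈ C, ∑ j, c j = g := by
    intro c hc
    have h1 : ∑ j, c j = (Finset.univ.val.map c).sum := rfl
    rw [h1, (hmemC c).1 hc, hP, Multiset.sum_add, σ.parts_sum]
    simp
  have hT : (seqsOfType J σ).card = ∑ c ∈ C, (Finset.univ.filter fun i : Fin g → Fin N =>
      (∀ q, i q ∈ J) ∧ multiplicity J i = c).card := by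
    rw [Finset.card_eq_sum_card_fiberwise (f := multiplicity J) (t := C)]
    · refine Finset.sum_congr rfl fun c hc => congrArg Finset.card ?_
      ext i
      rw [Finset.mem_filter, mem_seqsOfType_iff, Finset.mem_filter,
        and_iff_right (Finset.mem_univ _)]
      constructor
      · rintro ⟨⟨h1, -⟩, h2⟩; exact ⟨h1, h2⟩
      · rintro ⟨h1, h2⟩; exact ⟨⟨h1, by rw [h2]; exact (hmemC c).1 hc⟩, h2⟩
    · intro i hi
      exact Finset.mem_coe.2 ((hmemC _).2 (mem_seqsOfType_iff.1 hi).2)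
  have hT2 : (seqsOfType J σ).card * ∏ h ∈ Finset.Icc 1 g, h.factorial ^ σ.parts.count h =
      C.card * g.factorial := by
    rw [hT, Finset.sum_mul]
    refine Finset.sum_const_nat fun c hc => ?_
    rw [← hfact c hc]
    exact card_eq_multiplicity J c (hsum c hc)
  have hC2 : ∏ h ∈ Finset.univ.image c₀, (Finset.univ.filter fun a => c₀ a = h).card.factorial =
      (J.card - σ.parts.card).factorial *
        ∏ h ∈ Finset.Icc 1 g, (σ.parts.count h).factorial := by
    have hcount : ∀ h, (Finset.univ.filter fun a => c₀ a = h).card = P.count h := by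
      intro h
      rw [← hc₀, Multiset.count_map, ← Finset.filter_val, Finset.card_val]
      simp only [eq_comm]
    simp only [hcount]
    have h0 : (0 : ℕ) ∉ Finset.Icc 1 g := by simp
    have hsub : Finset.univ.image c₀ ⊆ insert 0 (Finset.Icc 1 g) := by
      intro h hh
      have : h ∈ P := by
        obtain ⟨j, -, rfl⟩ := Finset.mem_image.1 hh
        rw [← hc₀]; exact Multiset.mem_map_of_mem _ (Finset.mem_univ j)
      rw [hP, Multiset.mem_add] at this
      rcases this with h1 | h1
      · exact Finset.mem_insert_of_mem (Finset.mem_Icc.2 ⟨σ.parts_pos h1, σ.le_of_mem_parts h1⟩)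
      · rw [Multiset.eq_of_mem_replicate h1]; exact Finset.mem_insert_self _ _
    rw [Finset.prod_subset hsub, Finset.prod_insert h0]
    · congr 1
      · rw [hP, Multiset.count_add, Multiset.count_eq_zero_of_notMem hz]; simp
      · refine Finset.prod_congr rfl fun h hh => ?_
        have : h ≠ 0 := by have := (Finset.mem_Icc.1 hh).1; omega
        rw [hP, Multiset.count_add, Multiset.count_replicate, if_neg (Ne.symm this), add_zero]
    · intro h _ hh
      rw [← hcount, Finset.filter_false_of_mem]
      · rfl
      · intro q _ hq
        exact hh (Finset.mem_image.2 ⟨q, Finset.mem_univ _, hq⟩)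
  rw [Fintype.card_coe, hC2] at hC
  have hdf := Nat.factorial_mul_descFactorial hl
  have hpos : 0 < (J.card - σ.parts.card).factorial := Nat.factorial_pos _
  rw [Finset.prod_mul_distrib, ← mul_assoc, hT2]
  apply Nat.eq_of_mul_eq_mul_left hpos
  calc _ = g.factorial * (C.card * ((J.card - σ.parts.card).factorial *
        ∏ h ∈ Finset.Icc 1 g, (σ.parts.count h).factorial)) := by ring
    _ = _ := by rw [hC, ← hdf]; ring

/-! ### Sums over set partitions -/

/-- The sum of `β i l` over all restricted growth sequences `i` of length `k`, where `l` is the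
number of values of `i`. These sequences encode the set partitions of `k` elements. -/
def partSum : (k : ℕ) → ((Fin k → ℕ) → ℕ → ℝ) → ℝ
  | 0, β => β Fin.elim0 0
  | k + 1, β => partSum k fun i l =>
      ∑ j ∈ Finset.range l, β (Fin.snoc (α := fun _ => ℕ) i j) l +
        β (Fin.snoc (α := fun _ => ℕ) i l) (l + 1)

lemma image_snoc {ι : Type*} [DecidableEq ι] {k : ℕ} (i : Fin k → ι) (j : ι) :
    Finset.univ.image (Fin.snoc (α := fun _ => ι) i j : Fin (k + 1) → ι) =
      insert j (Finset.univ.image i) := by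
  ext m
  simp only [Finset.mem_image, Finset.mem_univ, true_and, Finset.mem_insert, Fin.exists_fin_succ',
    Fin.snoc_castSucc, Fin.snoc_last]
  tauto

lemma partSum_congr {k : ℕ} {β β' : (Fin k → ℕ) → ℕ → ℝ}
    (h : ∀ i l, l ≤ k → Finset.univ.image i = Finset.range l → β i l = β' i l) :
    partSum k β = partSum k β' := by
  induction k with
  | zero => exact h _ _ le_rfl (by simp)
  | succ k ih =>
    refine ih fun i l hl hi => ?_
    congr 1
    · refine Finset.sum_congr rfl fun j hj => h _ _ (by omega) ?_
      rw [image_snoc, hi, Finset.insert_eq_of_mem hj]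
    · refine h _ _ (by omega) ?_
      rw [image_snoc, hi, Finset.range_add_one]

lemma partSum_mul_left (c : ℝ) {k : ℕ} (β : (Fin k → ℕ) → ℕ → ℝ) :
    partSum k (fun i l => c * β i l) = c * partSum k β := by
  induction k with
  | zero => rfl
  | succ k ih =>
    simp only [partSum, ← ih, Finset.mul_sum, mul_add]

lemma comp_snoc {α β : Type*} {k : ℕ} (f : α → β) (i : Fin k → α) (j : α) :
    f ∘ (Fin.snoc (α := fun _ => α) i j : Fin (k + 1) → α) =
      Fin.snoc (α := fun _ => β) (f ∘ i) (f j) := Fin.comp_snoc f i j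

/-- If the restricted growth sequence `i` has fewer than `l` values then exchanging `a l` and `a j`
does not affect it. -/
lemma swap_comp_eq {a : ℕ → Fin N} {n : ℕ} (ha : Set.InjOn a (Finset.range n)) {k l p q : ℕ}
    {i : Fin k → ℕ} (hi : Finset.univ.image i = Finset.range l) (hp : l ≤ p) (hq : l ≤ q)
    (hpn : p < n) (hqn : q < n) :
    Equiv.swap (a p) (a q) ∘ a ∘ i = a ∘ i := by
  funext r
  have hr : i r < l := by
    rw [← Finset.mem_range, ← hi]
    exact Finset.mem_image_of_mem _ (Finset.mem_univ _)
  simp only [Function.comp]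
  refine Equiv.swap_apply_of_ne_of_ne (fun h => ?_) (fun h => ?_)
  · have := ha (by simp; omega) (by simp; omega) h; omega
  · have := ha (by simp; omega) (by simp; omega) h; omega

lemma sum_piFinset_snoc (J : Finset (Fin N)) {k : ℕ} (β : (Fin (k + 1) → Fin N) → ℝ) :
    ∑ i ∈ Fintype.piFinset (fun _ : Fin (k + 1) => J), β i =
      ∑ i ∈ Fintype.piFinset (fun _ : Fin k => J),
        ∑ j ∈ J, β (Fin.snoc (α := fun _ => Fin N) i j) := by
  rw [← Finset.sum_product']
  symm
  refine Finset.sum_bij' (fun p _ => Fin.snoc (α := fun _ => Fin N) p.1 p.2)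
    (fun i _ => (Fin.init (α := fun _ => Fin N) i, i (Fin.last k))) ?_ ?_ ?_ ?_ ?_
  · rintro ⟨i, j⟩ h
    simp only [Finset.mem_product, Fintype.mem_piFinset] at h ⊢
    intro q
    refine Fin.lastCases ?_ (fun q => ?_) q
    · simpa using h.2
    · simpa using h.1 q
  · intro i h
    simp only [Finset.mem_product, Fintype.mem_piFinset] at h ⊢
    exact ⟨fun q => h _, h _⟩
  · rintro ⟨i, j⟩ _
    simp
  · intro i _
    simp
  · intro p _
    rfl

/-- Numbering the values in order of first appearance turns a sequence into a restricted growth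
sequence. If it has l values, they can be chosen in n(n-1)⋯(n-l+1) ways, all with the same value of
β by invariance. -/
lemma sum_piFinset_eq_partSum {a : ℕ → Fin N} {n : ℕ} (ha : Set.InjOn a (Finset.range n))
    {k : ℕ} (hk : k ≤ n) (β : (Fin k → Fin N) → ℝ)
    (hβ : ∀ p < n, ∀ q < n, ∀ i, β (Equiv.swap (a p) (a q) ∘ i) = β i) :
    ∑ i ∈ Fintype.piFinset (fun _ : Fin k => (Finset.range n).image a), β i =
      partSum k fun i l => (n.descFactorial l : ℝ) * β (a ∘ i) := by
  induction k with
  | zero =>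
    rw [partSum]
    simp only [Nat.descFactorial_zero, Nat.cast_one, one_mul]
    have : ∀ i : Fin 0 → Fin N, β i = β (a ∘ Fin.elim0) := fun i =>
      congrArg β (Subsingleton.elim _ _)
    simp [this]
  | succ k ih =>
    rw [sum_piFinset_snoc, ih (by omega), partSum]
    · refine partSum_congr fun i l hl hi => ?_
      rw [Finset.sum_image ha, ← Finset.sum_range_add_sum_Ico _ (show l ≤ n by omega), mul_add,
        Finset.mul_sum]
      congr 1
      · refine Finset.sum_congr rfl fun j _ => ?_
        rw [comp_snoc]
      -- The n - l indices not yet used are interchangeable; they supply the next factor of the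
      -- falling factorial.
      · have : ∀ j ∈ Finset.Ico l n, β (Fin.snoc (α := fun _ => Fin N) (a ∘ i) (a j)) =
            β (a ∘ Fin.snoc (α := fun _ => ℕ) i l) := by
          intro j hj
          rw [Finset.mem_Ico] at hj
          rw [comp_snoc, ← hβ l (by omega) j hj.2, comp_snoc, swap_comp_eq ha hi le_rfl hj.1
            (by omega) hj.2, Equiv.swap_apply_right]
        rw [Finset.sum_congr rfl this, Finset.sum_const, Nat.card_Ico, nsmul_eq_mul,
          Nat.descFactorial_succ]
        push_cast
        ring
    · intro p hp q hq i
      have hJ : ∀ m, m ∈ (Finset.range n).image a →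
          Equiv.swap (a p) (a q) m ∈ (Finset.range n).image a := by
        intro m hm
        rcases eq_or_ne m (a p) with rfl | h1
        · rw [Equiv.swap_apply_left]; exact Finset.mem_image_of_mem _ (Finset.mem_range.2 hq)
        rcases eq_or_ne m (a q) with rfl | h2
        · rw [Equiv.swap_apply_right]; exact Finset.mem_image_of_mem _ (Finset.mem_range.2 hp)
        · rwa [Equiv.swap_apply_of_ne_of_ne h1 h2]
      refine Finset.sum_bij' (fun m _ => Equiv.swap (a p) (a q) m)
        (fun m _ => Equiv.swap (a p) (a q) m) (fun m hm => hJ m hm) (fun m hm => hJ m hm)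
        (fun m _ => by simp) (fun m _ => by simp) fun m _ => ?_
      rw [← hβ p hp q hq (Fin.snoc (α := fun _ => Fin N) _ m), comp_snoc, ← Function.comp_assoc]
      congr 2
      funext r
      simp

/-! ### Helmert vectors and the block derivative as a single derivative. -/

/-- The vectors `e_{a 0}`, `e_{a 0} - e_{a 1}`, `e_{a 0} + e_{a 1} - 2 e_{a 2}`, … -/
def helmert (a : ℕ → Fin N) (q : ℕ) : Fin N → ℝ :=
  if q = 0 then Pi.single (a 0) 1
  else ∑ p ∈ Finset.range q, Pi.single (a p) 1 - (q : ℝ) • Pi.single (a q) 1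

lemma single_comp_swap (i p q : Fin N) :
    (Pi.single i (1 : ℝ) : Fin N → ℝ) ∘ Equiv.swap p q = Pi.single (Equiv.swap p q i) 1 := by
  funext r
  simp only [Function.comp, Pi.single_apply]
  congr 1
  rw [eq_iff_iff]
  exact ⟨fun h => by rw [← h, Equiv.swap_apply_self], fun h => by rw [h, Equiv.swap_apply_self]⟩

lemma helmert_comp_swap {a : ℕ → Fin N} {n : ℕ} (ha : Set.InjOn a (Finset.range n)) {p q k : ℕ}
    (hk0 : k ≠ 0) (hp : p < k) (hq : q < k) (hk : k < n) :
    helmert a k ∘ Equiv.swap (a p) (a q) = helmert a k := by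
  have hinj : ∀ r < n, ∀ s < n, a r = a s → r = s := fun r hr s hs h =>
    ha (by simpa using hr) (by simpa using hs) h
  have key : ∀ m, m ∈ (Finset.range k).image a →
      Equiv.swap (a p) (a q) m ∈ (Finset.range k).image a := by
    intro m hm
    rcases eq_or_ne m (a p) with rfl | h1
    · rw [Equiv.swap_apply_left]; exact Finset.mem_image_of_mem _ (Finset.mem_range.2 hq)
    rcases eq_or_ne m (a q) with rfl | h2
    · rw [Equiv.swap_apply_right]; exact Finset.mem_image_of_mem _ (Finset.mem_range.2 hp)
    · rwa [Equiv.swap_apply_of_ne_of_ne h1 h2]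
  have hs : ∑ r ∈ Finset.range k, (Pi.single (a r) (1 : ℝ) : Fin N → ℝ) =
      ∑ m ∈ (Finset.range k).image a, Pi.single m 1 := by
    rw [Finset.sum_image fun r hr s hs h => hinj _ ?_ _ ?_ h]
    · exact (Finset.mem_range.1 hr).trans hk
    · exact (Finset.mem_range.1 hs).trans hk
  have hcomp : ∀ v w : Fin N → ℝ, (v - w) ∘ Equiv.swap (a p) (a q) =
    v ∘ Equiv.swap (a p) (a q) - w ∘ Equiv.swap (a p) (a q) := fun _ _ => rfl
  rw [helmert, if_neg hk0, hcomp]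
  congr 1
  · rw [hs]
    have : (∑ m ∈ (Finset.range k).image a, (Pi.single m (1 : ℝ) : Fin N → ℝ)) ∘
        Equiv.swap (a p) (a q) =
        ∑ m ∈ (Finset.range k).image a, (Pi.single m (1 : ℝ)) ∘ Equiv.swap (a p) (a q) := by
      funext r; simp [Finset.sum_apply]
    rw [this]
    simp only [single_comp_swap]
    exact Finset.sum_bij' (fun m _ => Equiv.swap (a p) (a q) m)
        (fun m _ => Equiv.swap (a p) (a q) m) (fun m hm => key m hm) (fun m hm => key m hm)
        (fun m _ => by simp) (fun m _ => by simp) fun m _ => rfl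
  · have : ((k : ℝ) • Pi.single (a k) (1 : ℝ) : Fin N → ℝ) ∘ Equiv.swap (a p) (a q) =
        (k : ℝ) • ((Pi.single (a k) (1 : ℝ) : Fin N → ℝ) ∘ Equiv.swap (a p) (a q)) := rfl
    rw [this, single_comp_swap, Equiv.swap_apply_of_ne_of_ne]
    · intro h; have := hinj _ hk _ (by omega) h; omega
    · intro h; have := hinj _ hk _ (by omega) h; omega

/-- A symmetric multilinear form evaluated at the vectors `helmert a q` is a sum over set
partitions, with the values of the Möbius function as coefficients. -/
lemma multilinear_helmert_eq_partSum {a : ℕ → Fin N} {n : ℕ} (ha : Set.InjOn a (Finset.range n))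
    {k : ℕ} (hk : k + 1 ≤ n) (B : MultilinearMap ℝ (fun _ : Fin (k + 1) => Fin N → ℝ) ℝ)
    (hB : ∀ p < k + 1, ∀ q < k + 1, ∀ v : Fin (k + 1) → Fin N → ℝ,
      B (fun r => v r ∘ Equiv.swap (a p) (a q)) = B v) :
    B (fun q => helmert a q) = partSum (k + 1) fun i l =>
      (-1 : ℝ) ^ (l - 1) * ((l - 1).factorial : ℝ) * B (fun r => Pi.single (a (i r)) 1) := by
  induction k with
  | zero =>
    simp only [partSum, Finset.range_zero, Finset.sum_empty, zero_add, Nat.sub_self, pow_zero,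
      Nat.factorial_zero, Nat.cast_one, one_mul]
    congr 1
    funext q
    have : q = Fin.last 0 := Fin.ext (by have := q.2; simp only [Fin.val_last]; omega)
    subst this
    rw [Fin.snoc_last, helmert, if_pos (by simp)]
  | succ k ih =>
    set v := helmert a (k + 1) with hv
    -- With h_{k+1} fixed as last argument, the form stays invariant under swaps of a 0, …, a k,
    -- since these swaps preserve h_{k+1}.
    let B' : MultilinearMap ℝ (fun _ : Fin (k + 1) => Fin N → ℝ) ℝ :=
      (LinearMap.applyₗ v).compMultilinearMap B.curryRight
    have hB' : ∀ w : Fin (k + 1) → Fin N → ℝ,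
        B' w = B (Fin.snoc (α := fun _ => Fin N → ℝ) w v) := fun w => rfl
    have h1 : B (fun q => helmert a q) = B' (fun q => helmert a q) := by
      rw [hB']
      congr 1
      funext q
      refine Fin.lastCases ?_ (fun q => ?_) q
      · simp [hv]
      · simp
    rw [h1, ih (by omega) B' ?_]
    · conv_rhs => rw [partSum]
      refine partSum_congr fun i l hl hi => ?_
      have hl0 : 1 ≤ l := by
        have : i 0 ∈ Finset.range l := by
          rw [← hi]; exact Finset.mem_image_of_mem _ (Finset.mem_univ _)
        rw [Finset.mem_range] at this; omega
      set w : Fin (k + 1) → Fin N → ℝ := fun r => Pi.single (a (i r)) 1 with hw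
      have hsn : ∀ j, (fun r => Pi.single (a (Fin.snoc (α := fun _ => ℕ) i j r)) 1 :
          Fin (k + 2) → Fin N → ℝ) = Fin.snoc (α := fun _ => Fin N → ℝ) w (Pi.single (a j) 1) := by
        intro j
        funext r
        refine Fin.lastCases ?_ (fun q => ?_) r
        · simp
        · simp [hw]
      simp only [hsn, hB']
      have hlin : B (Fin.snoc (α := fun _ => Fin N → ℝ) w v) =
          ∑ j ∈ Finset.range (k + 1),
            B (Fin.snoc (α := fun _ => Fin N → ℝ) w (Pi.single (a j) 1)) -
          ((k + 1 : ℕ) : ℝ) *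
            B (Fin.snoc (α := fun _ => Fin N → ℝ) w (Pi.single (a (k + 1)) 1)) := by
        simp only [← MultilinearMap.curryRight_apply]
        rw [hv, helmert, if_neg (by omega), map_sub, map_sum, map_smul, smul_eq_mul]
      have hsw : ∀ j, l ≤ j → j < k + 2 →
          B (Fin.snoc (α := fun _ => Fin N → ℝ) w (Pi.single (a j) 1)) =
          B (Fin.snoc (α := fun _ => Fin N → ℝ) w (Pi.single (a l) 1)) := by
        intro j hlj hj
        rw [← hB l (by omega) j hj]
        congr 1
        funext r
        refine Fin.lastCases ?_ (fun q => ?_) r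
        · simp [single_comp_swap]
        · have := congrFun (swap_comp_eq ha hi le_rfl hlj (by omega) (by omega)) q
          simp only [Function.comp] at this
          simp [hw, single_comp_swap, this]
      have hl' : l ≤ k + 1 := hl
      -- Indices j < l join an existing block. The other k + 1 - l indices open a new one, and
      -- together with the entry -(k+1) of h_{k+1} they contribute -l, which turns (-1)^(l-1) (l-1)!
      -- into (-1)^l l!.
      rw [hlin, ← Finset.sum_range_add_sum_Ico _ hl',
        Finset.sum_congr rfl fun j hj => hsw j (Finset.mem_Ico.1 hj).1
          (by have := (Finset.mem_Ico.1 hj).2; omega), hsw (k + 1) hl' (by omega),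
        Finset.sum_const, Nat.card_Ico, nsmul_eq_mul, ← Finset.mul_sum, Nat.cast_sub hl']
      obtain ⟨s, rfl⟩ : ∃ s, l = s + 1 := ⟨l - 1, by omega⟩
      simp only [Nat.add_sub_cancel]
      rw [Nat.factorial_succ, pow_succ]
      push_cast
      ring
    · intro p hp q hq w
      rw [hB', hB', ← hB p (by omega) q (by omega) (Fin.snoc (α := fun _ => Fin N → ℝ) w v)]
      congr 1
      funext r
      refine Fin.lastCases ?_ (fun q => ?_) r
      · simp only [Fin.snoc_last]
        exact (helmert_comp_swap ha (by omega) hp hq (by omega)).symm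
      · simp

lemma exists_mem_seqsOfType {J : Finset (Fin N)} {g : ℕ} (i : Fin g → Fin N) (hi : ∀ q, i q ∈ J) :
    ∃ σ : g.Partition, i ∈ seqsOfType J σ := by
  refine ⟨⟨(Finset.univ.image i).val.map fun k => (Finset.univ.filter fun q => i q = k).card,
    ?_, ?_⟩, ?_⟩
  · intro m hm
    obtain ⟨k, hk, rfl⟩ := Multiset.mem_map.1 hm
    obtain ⟨q, -, rfl⟩ := Finset.mem_image.1 (show k ∈ Finset.univ.image i from hk)
    exact Finset.card_pos.2 ⟨q, by simp⟩
  · have := Finset.card_eq_sum_card_image i (Finset.univ : Finset (Fin g))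
    rw [Finset.card_univ, Fintype.card_fin] at this
    exact this.symm
  · rw [seqsOfType, Finset.mem_filter]
    exact ⟨Finset.mem_univ _, hi, rfl⟩

lemma card_image_of_mem_seqsOfType {J : Finset (Fin N)} {g : ℕ} {σ : g.Partition}
    {i : Fin g → Fin N} (h : i ∈ seqsOfType J σ) :
    (Finset.univ.image i).card = σ.parts.card := by
  rw [seqsOfType, Finset.mem_filter] at h
  rw [← h.2.2, Multiset.card_map, Finset.card_val]

lemma card_parts_le {g : ℕ} (σ : g.Partition) : σ.parts.card ≤ g := by
  conv_rhs => rw [← σ.parts_sum]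
  have := Multiset.card_nsmul_le_sum (s := σ.parts) (a := 1) fun x hx => σ.parts_pos hx
  simpa using this

/-- By `card_seqsOfType`, the coefficient of a type divided by its number of sequences depends only
on the number of distinct values. The bound g ≤ |J| guarantees that no type is empty, so no average
divides by 0. -/
lemma blockDeriv_eq_sum_piFinset {J : Finset (Fin N)} {g : ℕ} (hg : 1 ≤ g) (hgJ : g ≤ J.card)
    (φ : (Fin N → ℝ) → ℝ) (x : Fin N → ℝ) :
    blockDeriv J g φ x = ∑ i ∈ Fintype.piFinset (fun _ : Fin g => J),
      (-1 : ℝ) ^ (g - (Finset.univ.image i).card) *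
        (((Finset.univ.image i).card - 1).factorial : ℝ) / ((g - 1).factorial : ℝ) /
        (J.card.descFactorial (Finset.univ.image i).card : ℝ) *
        iteratedFDeriv ℝ g φ x fun q => Pi.single (i q) (1 : ℝ) := by
  have hun : Fintype.piFinset (fun _ : Fin g => J) =
      Finset.univ.biUnion fun σ : g.Partition => seqsOfType J σ := by
    ext i
    simp only [Fintype.mem_piFinset, Finset.mem_biUnion, Finset.mem_univ, true_and]
    constructor
    · exact exists_mem_seqsOfType i
    · rintro ⟨σ, hσ⟩
      rw [seqsOfType, Finset.mem_filter] at hσ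
      exact hσ.2.1
  rw [hun, Finset.sum_biUnion]
  · refine Finset.sum_congr rfl fun σ _ => ?_
    rw [partialType, mul_div_assoc', div_eq_iff, Finset.mul_sum, Finset.sum_mul]
    · refine Finset.sum_congr rfl fun i hi => ?_
      rw [card_image_of_mem_seqsOfType hi]
      have hc := card_seqsOfType (J := J) σ ((card_parts_le σ).trans hgJ)
      have hc' : ((seqsOfType J σ).card : ℝ) * ∏ h ∈ Finset.Icc 1 g,
        ((h.factorial : ℝ) ^ σ.parts.count h * ((σ.parts.count h).factorial : ℝ)) =
        (g.factorial : ℝ) * (J.card.descFactorial σ.parts.card : ℝ) := by exact_mod_cast hc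
      have hP : (∏ h ∈ Finset.Icc 1 g,
        ((h.factorial : ℝ) ^ σ.parts.count h * ((σ.parts.count h).factorial : ℝ))) ≠ 0 := by
        refine Finset.prod_ne_zero_iff.2 fun h _ => ?_
        positivity
      have hd : (J.card.descFactorial σ.parts.card : ℝ) ≠ 0 := by
        rw [Nat.cast_ne_zero]
        exact (Nat.descFactorial_pos.2 ((card_parts_le σ).trans hgJ)).ne'
      have hf : (g.factorial : ℝ) = g * ((g - 1).factorial : ℝ) := by
        exact_mod_cast (Nat.mul_factorial_pred (by omega)).symm
      have hf0 : ((g - 1).factorial : ℝ) ≠ 0 := by positivity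
      rw [hf] at hc'
      set P := ∏ h ∈ Finset.Icc 1 g,
        ((h.factorial : ℝ) ^ σ.parts.count h * ((σ.parts.count h).factorial : ℝ))
      have : (g : ℝ) / P = (((seqsOfType J σ).card : ℝ)) / (((g - 1).factorial : ℝ) *
          (J.card.descFactorial σ.parts.card : ℝ)) := by
        rw [div_eq_div_iff hP (mul_ne_zero hf0 hd), hc']; ring
      calc _ = (-1 : ℝ) ^ (g - σ.parts.card) * ((σ.parts.card - 1).factorial : ℝ) *
            ((g : ℝ) / P) * (iteratedFDeriv ℝ g φ x fun q => Pi.single (i q) (1 : ℝ)) := by ring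
        _ = _ := by rw [this]; field_simp
    · have hc := card_seqsOfType (J := J) σ ((card_parts_le σ).trans hgJ)
      rw [Nat.cast_ne_zero]
      intro h0
      rw [h0, zero_mul] at hc
      have h1 := Nat.factorial_pos g
      have h2 := Nat.descFactorial_pos.2 ((card_parts_le σ).trans hgJ)
      have := Nat.mul_pos h1 h2
      omega
  · intro σ _ σ' _ hne
    refine Finset.disjoint_left.2 fun i h h' => hne ?_
    exact Nat.Partition.ext ((Finset.mem_filter.1 h).2.2.symm.trans (Finset.mem_filter.1 h').2.2)

/-- The operator `∂_J^g` at a point where the derivative of order `g` is symmetric is a single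
derivative of order `g` in the directions of the vectors `helmert a q`. -/
lemma blockDeriv_eq_iteratedFDeriv_helmert {a : ℕ → Fin N} {n : ℕ}
    (ha : Set.InjOn a (Finset.range n)) {k : ℕ} (hk : k + 1 ≤ n) {φ : (Fin N → ℝ) → ℝ}
    {x : Fin N → ℝ}
    (hB : ∀ p < n, ∀ q < n, ∀ v : Fin (k + 1) → Fin N → ℝ,
      iteratedFDeriv ℝ (k + 1) φ x (fun r => v r ∘ Equiv.swap (a p) (a q)) =
        iteratedFDeriv ℝ (k + 1) φ x v) :
    blockDeriv ((Finset.range n).image a) (k + 1) φ x =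
      (-1 : ℝ) ^ k / (k.factorial : ℝ) *
        iteratedFDeriv ℝ (k + 1) φ x (fun q => helmert a q) := by
  have hcard : ((Finset.range n).image a).card = n := by
    rw [Finset.card_image_of_injOn ha, Finset.card_range]
  rw [blockDeriv_eq_sum_piFinset (by omega) (by omega), sum_piFinset_eq_partSum ha hk]
  · have h := multilinear_helmert_eq_partSum ha hk
      (iteratedFDeriv ℝ (k + 1) φ x).toMultilinearMap
      (fun p hp q hq v => hB p (by omega) q (by omega) v)
    rw [ContinuousMultilinearMap.coe_coe] at h
    rw [h, ← partSum_mul_left]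
    refine partSum_congr fun i l hl hi => ?_
    have hl0 : 1 ≤ l := by
      have : i 0 ∈ Finset.range l := by
        rw [← hi]; exact Finset.mem_image_of_mem _ (Finset.mem_univ _)
      rw [Finset.mem_range] at this; omega
    have him : (Finset.univ.image (a ∘ i)).card = l := by
      rw [← Finset.image_image, hi, Finset.card_image_of_injOn, Finset.card_range]
      exact ha.mono (by simpa using (by omega : l ≤ n))
    rw [him, hcard]
    have hd : (n.descFactorial l : ℝ) ≠ 0 := by
      rw [Nat.cast_ne_zero]
      exact (Nat.descFactorial_pos.2 (by omega)).ne'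
    obtain ⟨s, rfl⟩ : ∃ s, l = s + 1 := ⟨l - 1, by omega⟩
    have hsgn : (-1 : ℝ) ^ (k + 1 - (s + 1)) = (-1) ^ k * (-1) ^ s := by
      obtain ⟨t, rfl⟩ : ∃ t, k = s + t := ⟨k - s, by omega⟩
      rw [show s + t + 1 - (s + 1) = t by omega, pow_add]
      have : ((-1 : ℝ) ^ s) * (-1) ^ s = 1 := by rw [← mul_pow]; simp
      linear_combination (-((-1 : ℝ) ^ t)) * this
    simp only [Nat.add_sub_cancel, hsgn]
    have hf0 : (k.factorial : ℝ) ≠ 0 := by positivity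
    simp only [Function.comp]
    field_simp
  · intro p hp q hq i
    have h1 : (Finset.univ.image (Equiv.swap (a p) (a q) ∘ i)).card =
        (Finset.univ.image i).card := by
      rw [← Finset.image_image, Finset.card_image_of_injective _ (Equiv.injective _)]
    rw [h1, ← hB p hp q hq]
    simp only [single_comp_swap, Function.comp, Equiv.swap_apply_self]

/-! ### Smoothness of integrals depending on a parameter -/

section Parametric

/-- Tube lemma: compactness of [0, 1] makes the bound uniform near x, which is the domination needed
under the integral. -/
lemma exists_bound_of_continuousAt {E G : Type} [NormedAddCommGroup E] [NormedAddCommGroup G]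
    {H : E × ℝ → G} {x : E}
    (hH : ∀ t ∈ Set.Icc (0 : ℝ) 1, ContinuousAt H (x, t)) :
    ∃ C : ℝ, ∀ᶠ z in 𝓝 x, ∀ t ∈ Set.Icc (0 : ℝ) 1, ‖H (z, t)‖ ≤ C := by
  have hc : ContinuousOn (fun t => H (x, t)) (Set.Icc (0 : ℝ) 1) := fun t ht =>
    ((hH t ht).comp (f := fun t => (x, t)) (by fun_prop)).continuousWithinAt
  obtain ⟨C, hC⟩ := isCompact_Icc.exists_bound_of_continuousOn hc
  refine ⟨C + 1, isCompact_Icc.eventually_forall_of_forall_eventually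
    (P := fun z t => ‖H (z, t)‖ ≤ C + 1) fun t ht => ?_⟩
  have : ∀ᶠ z in 𝓝 (x, t), ‖H z‖ < C + 1 :=
    (hH t ht).norm.eventually_lt_const (by have := hC t ht; linarith)
  exact this.mono fun z hz => hz.le

variable {E G : Type} [NormedAddCommGroup E] [NormedAddCommGroup G] [NormedSpace ℝ G]

lemma continuousAt_parametric_integral {H : E × ℝ → G} {U : Set E} (hU : IsOpen U)
    (hH : ∀ x ∈ U, ∀ t ∈ Set.Icc (0 : ℝ) 1, ContinuousAt H (x, t)) {x : E} (hx : x ∈ U) :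
    ContinuousAt (fun x => ∫ t in (0 : ℝ)..1, H (x, t)) x := by
  obtain ⟨C, hC⟩ := exists_bound_of_continuousAt (hH x hx)
  have hsub : Set.uIoc (0 : ℝ) 1 ⊆ Set.Icc 0 1 := by
    rw [Set.uIoc_of_le zero_le_one]; exact Set.Ioc_subset_Icc_self
  refine intervalIntegral.continuousAt_of_dominated_interval (bound := fun _ => C) ?_ ?_ ?_ ?_
  · filter_upwards [hU.mem_nhds hx] with z hz
    refine ContinuousOn.aestronglyMeasurable (fun t ht => ?_) measurableSet_uIoc
    exact ((hH z hz t (hsub ht)).comp (f := fun t => (z, t)) (by fun_prop)).continuousWithinAt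
  · filter_upwards [hC] with z hz
    exact Eventually.of_forall fun t ht => hz t (hsub ht)
  · exact intervalIntegrable_const
  · exact Eventually.of_forall fun t ht =>
      (hH x hx t (hsub ht)).comp (f := fun z => (z, t)) (by fun_prop)

variable [NormedSpace ℝ E]

lemma hasFDerivAt_parametric_integral {H : E × ℝ → G} {U : Set E} (hU : IsOpen U)
    (hH : ∀ x ∈ U, ∀ t ∈ Set.Icc (0 : ℝ) 1, ContDiffAt ℝ 1 H (x, t)) {x : E} (hx : x ∈ U) :
    HasFDerivAt (fun x => ∫ t in (0 : ℝ)..1, H (x, t))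
      (∫ t in (0 : ℝ)..1, (fderiv ℝ H (x, t)).comp (ContinuousLinearMap.inl ℝ E ℝ)) x := by
  have hsub : Set.uIoc (0 : ℝ) 1 ⊆ Set.Icc 0 1 := by
    rw [Set.uIoc_of_le zero_le_one]; exact Set.Ioc_subset_Icc_self
  have hcont : ∀ z ∈ U, ∀ t ∈ Set.Icc (0 : ℝ) 1,
      ContinuousAt (fun z => (fderiv ℝ H z).comp (ContinuousLinearMap.inl ℝ E ℝ)) (z, t) := by
    intro z hz t ht
    have h1 : ContinuousAt (fderiv ℝ H) (z, t) :=
      ((hH z hz t ht).fderiv_right (m := 0) (by simp)).continuousAt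
    exact h1.clm_comp continuousAt_const
  obtain ⟨C, hC⟩ := exists_bound_of_continuousAt (hcont x hx)
  refine intervalIntegral.hasFDerivAt_integral_of_dominated_of_fderiv_le
    (F := fun x t => H (x, t))
    (F' := fun x t => (fderiv ℝ H (x, t)).comp (ContinuousLinearMap.inl ℝ E ℝ))
    (s := U ∩ {z | ∀ t ∈ Set.Icc (0 : ℝ) 1,
      ‖(fderiv ℝ H (z, t)).comp (ContinuousLinearMap.inl ℝ E ℝ)‖ ≤ C})
    (bound := fun _ => C) (inter_mem (hU.mem_nhds hx) hC) ?_ ?_ ?_ ?_ ?_ ?_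
  · filter_upwards [hU.mem_nhds hx] with z hz
    refine ContinuousOn.aestronglyMeasurable (fun t ht => ?_) measurableSet_uIoc
    exact ((hH z hz t (hsub ht)).continuousAt.comp (f := fun t => (z, t))
      (by fun_prop)).continuousWithinAt
  · refine ContinuousOn.intervalIntegrable fun t ht => ?_
    rw [Set.uIcc_of_le zero_le_one] at ht
    exact ((hH x hx t ht).continuousAt.comp (f := fun t => (x, t))
      (by fun_prop)).continuousWithinAt
  · refine ContinuousOn.aestronglyMeasurable (fun t ht => ?_) measurableSet_uIoc
    exact ((hcont x hx t (hsub ht)).comp (f := fun t => (x, t)) (by fun_prop)).continuousWithinAt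
  · exact Eventually.of_forall fun t ht z hz => hz.2 t (hsub ht)
  · exact intervalIntegrable_const
  · refine Eventually.of_forall fun t ht z hz => ?_
    have h1 := ((hH z hz.1 t (hsub ht)).differentiableAt (by simp)).hasFDerivAt
    exact h1.comp z (hasFDerivAt_prodMk_left z t)

/-- The derivative is again a parametric integral, with values in a space of linear maps; hence the
induction runs over all target spaces G. -/
lemma contDiffOn_parametric_integral (m : ℕ) {G : Type} [NormedAddCommGroup G] [NormedSpace ℝ G]
    {H : E × ℝ → G} {U : Set E} (hU : IsOpen U)
    (hH : ∀ x ∈ U, ∀ t ∈ Set.Icc (0 : ℝ) 1, ContDiffAt ℝ m H (x, t)) :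
    ContDiffOn ℝ m (fun x => ∫ t in (0 : ℝ)..1, H (x, t)) U := by
  induction m generalizing G with
  | zero =>
    rw [Nat.cast_zero, contDiffOn_zero]
    exact fun x hx => (continuousAt_parametric_integral hU
      (fun x hx t ht => (hH x hx t ht).continuousAt) hx).continuousWithinAt
  | succ m ih =>
    have hd : ∀ x ∈ U, HasFDerivAt (fun x => ∫ t in (0 : ℝ)..1, H (x, t))
      (∫ t in (0 : ℝ)..1, (fderiv ℝ H (x, t)).comp (ContinuousLinearMap.inl ℝ E ℝ)) x :=
      fun x hx => hasFDerivAt_parametric_integral hU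
        (fun x hx t ht => (hH x hx t ht).of_le (by exact_mod_cast Nat.le_add_left 1 m)) hx
    rw [Nat.cast_add, Nat.cast_one, contDiffOn_succ_iff_fderiv_of_isOpen hU]
    refine ⟨fun x hx => (hd x hx).differentiableAt.differentiableWithinAt, by simp, ?_⟩
    refine ContDiffOn.congr (ih (H := fun z =>
      (fderiv ℝ H z).comp (ContinuousLinearMap.inl ℝ E ℝ)) fun x hx t ht => ?_)
      fun x hx => (hd x hx).fderiv
    exact ((hH x hx t ht).fderiv_right (m := m) (by simp)).clm_comp contDiffAt_const

end Parametric

/-! ### Permutations of the coordinates -/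

/-- The permutation of coordinates as a continuous linear equivalence. -/
def permCLE (τ : Equiv.Perm (Fin N)) : (Fin N → ℝ) ≃L[ℝ] (Fin N → ℝ) :=
  (LinearEquiv.funCongrLeft ℝ ℝ τ).toContinuousLinearEquiv

@[simp] lemma permCLE_apply (τ : Equiv.Perm (Fin N)) (x : Fin N → ℝ) : permCLE τ x = x ∘ τ := rfl

/-- Balls of the sup metric are stable under permutations fixing the centre, so smoothness and
invariance can be used on one common ball. -/
lemma dist_comp_perm_lt {x₀ x : Fin N → ℝ} {τ : Equiv.Perm (Fin N)} (hτ : ∀ i, x₀ (τ i) = x₀ i)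
    {ρ : ℝ} (hx : x ∈ Metric.ball x₀ ρ) : x ∘ τ ∈ Metric.ball x₀ ρ := by
  have hρ : 0 < ρ := dist_nonneg.trans_lt hx
  rw [Metric.mem_ball, dist_pi_lt_iff hρ] at hx ⊢
  intro i
  rw [← hτ i]
  exact hx (τ i)

lemma apply_swap_eq {x₀ : Fin N → ℝ} {i j : Fin N} (h : x₀ i = x₀ j) (l : Fin N) :
    x₀ (Equiv.swap i j l) = x₀ l := by
  rcases eq_or_ne l i with rfl | h1
  · rw [Equiv.swap_apply_left, h]
  rcases eq_or_ne l j with rfl | h2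
  · rw [Equiv.swap_apply_right, h]
  rw [Equiv.swap_apply_of_ne_of_ne h1 h2]

lemma fderiv_comp_perm {F : (Fin N → ℝ) → ℝ} {x : Fin N → ℝ} {τ : Equiv.Perm (Fin N)}
    (h : ∀ᶠ z in 𝓝 x, F (z ∘ τ) = F z) (v : Fin N → ℝ) :
    fderiv ℝ F (x ∘ τ) (v ∘ τ) = fderiv ℝ F x v := by
  have h1 : F ∘ permCLE τ =ᶠ[𝓝 x] F := h
  have h2 := h1.fderiv_eq (𝕜 := ℝ)
  rw [(permCLE τ).comp_right_fderiv] at h2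
  rw [← h2]
  rfl

lemma iteratedFDeriv_comp_perm {F : (Fin N → ℝ) → ℝ} {x : Fin N → ℝ} {τ : Equiv.Perm (Fin N)}
    (hx : x ∘ τ = x) (h : ∀ᶠ z in 𝓝 x, F (z ∘ τ) = F z) {k : ℕ} (v : Fin k → Fin N → ℝ) :
    iteratedFDeriv ℝ k F x (fun q => v q ∘ τ) = iteratedFDeriv ℝ k F x v := by
  have h1 : F ∘ permCLE τ =ᶠ[𝓝 x] F := h
  have h2 := (h1.iteratedFDeriv ℝ k).eq_of_nhds
  have h3 := (permCLE τ).iteratedFDerivWithin_comp_right F (s := Set.univ) uniqueDiffOn_univ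
    (x := x) (Set.mem_univ _) k
  rw [Set.preimage_univ, iteratedFDerivWithin_univ, iteratedFDerivWithin_univ, h2, permCLE_apply,
    hx] at h3
  conv_rhs => rw [h3]
  rfl

/-! ### Divided differences with respect to two variables -/

/-- The quotient `(F x - F (x ∘ swap i j)) / (x i - x j)` in integral form. -/
def swapQuot (i j : Fin N) (F : (Fin N → ℝ) → ℝ) (x : Fin N → ℝ) : ℝ :=
  ∫ t in (0 : ℝ)..1, fderiv ℝ F
    (x - ((1 - t) * (x i - x j)) • (Pi.single i 1 - Pi.single j 1 : Fin N → ℝ))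
    (Pi.single i 1 - Pi.single j 1)

/-- The path of `swapQuot` is the segment from x ∘ swap at t = 0 to x at t = 1; convexity keeps it
inside the ball. -/
lemma swap_path_eq {i j : Fin N} (hij : i ≠ j) (x : Fin N → ℝ) (t : ℝ) :
    x - ((1 - t) * (x i - x j)) • (Pi.single i 1 - Pi.single j 1 : Fin N → ℝ) =
      t • x + (1 - t) • (x ∘ Equiv.swap i j) := by
  funext l
  simp only [Pi.sub_apply, Pi.smul_apply, Pi.add_apply, smul_eq_mul, Function.comp]
  rcases eq_or_ne l i with rfl | h1
  · rw [Equiv.swap_apply_left, Pi.single_eq_same, Pi.single_eq_of_ne hij]; ring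
  rcases eq_or_ne l j with rfl | h2
  · rw [Equiv.swap_apply_right, Pi.single_eq_same, Pi.single_eq_of_ne h1]; ring
  rw [Equiv.swap_apply_of_ne_of_ne h1 h2, Pi.single_eq_of_ne h1, Pi.single_eq_of_ne h2]; ring

lemma swap_path_mem {x₀ : Fin N → ℝ} {i j : Fin N} (hij : i ≠ j) (h0 : x₀ i = x₀ j) {ρ : ℝ}
    {x : Fin N → ℝ} (hx : x ∈ Metric.ball x₀ ρ) {t : ℝ} (ht : t ∈ Set.Icc (0 : ℝ) 1) :
    x - ((1 - t) * (x i - x j)) • (Pi.single i 1 - Pi.single j 1 : Fin N → ℝ) ∈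
      Metric.ball x₀ ρ := by
  rw [swap_path_eq hij]
  exact convex_ball x₀ ρ hx (dist_comp_perm_lt (apply_swap_eq h0) hx) ht.1
    (by linarith [ht.2]) (by ring)

/-- One derivative is lost, but the points with x i = x j, where the quotient is singular, are
included. -/
lemma contDiffOn_swapQuot {x₀ : Fin N → ℝ} {i j : Fin N} (hij : i ≠ j) (h0 : x₀ i = x₀ j) {ρ : ℝ}
    {m : ℕ} {F : (Fin N → ℝ) → ℝ} (hF : ContDiffOn ℝ (m + 1 : ℕ) F (Metric.ball x₀ ρ)) :
    ContDiffOn ℝ m (swapQuot i j F) (Metric.ball x₀ ρ) := by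
  set v : Fin N → ℝ := Pi.single i 1 - Pi.single j 1 with hv
  refine contDiffOn_parametric_integral m (H := fun z : (Fin N → ℝ) × ℝ =>
    fderiv ℝ F (z.1 - ((1 - z.2) * (z.1 i - z.1 j)) • v) v) Metric.isOpen_ball
    fun x hx t ht => ?_
  have hp := swap_path_mem hij h0 hx ht
  have h1 : ContDiffAt ℝ m (fderiv ℝ F) (x - ((1 - t) * (x i - x j)) • v) :=
    ((hF.contDiffAt (Metric.isOpen_ball.mem_nhds hp)).fderiv_right (m := m) (by simp))
  have h2 : ContDiffAt ℝ m (fun z : (Fin N → ℝ) × ℝ =>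
      z.1 - ((1 - z.2) * (z.1 i - z.1 j)) • v) (x, t) := by
    have e1 : ∀ l, ContDiff ℝ m (fun z : (Fin N → ℝ) × ℝ => z.1 l) := fun l =>
      (contDiff_apply ℝ ℝ l).comp contDiff_fst
    exact (contDiff_fst.sub (((contDiff_const.sub contDiff_snd).mul
      ((e1 i).sub (e1 j))).smul contDiff_const)).contDiffAt
  exact (ContDiffAt.comp (x, t) (g := fderiv ℝ F) h1 h2).clm_apply contDiffAt_const

lemma mul_swapQuot {x₀ : Fin N → ℝ} {i j : Fin N} (hij : i ≠ j) (h0 : x₀ i = x₀ j) {ρ : ℝ}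
    {F : (Fin N → ℝ) → ℝ} (hF : ContDiffOn ℝ 1 F (Metric.ball x₀ ρ)) {x : Fin N → ℝ}
    (hx : x ∈ Metric.ball x₀ ρ) :
    (x i - x j) * swapQuot i j F x = F x - F (x ∘ Equiv.swap i j) := by
  set v : Fin N → ℝ := Pi.single i 1 - Pi.single j 1 with hv
  have hF' : ∀ t ∈ Set.Icc (0 : ℝ) 1, ContDiffAt ℝ 1 F (x - ((1 - t) * (x i - x j)) • v) :=
    fun t ht => hF.contDiffAt (Metric.isOpen_ball.mem_nhds (swap_path_mem hij h0 hx ht))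
  have hpath : ∀ t : ℝ, HasDerivAt (fun t : ℝ => x - ((1 - t) * (x i - x j)) • v)
      ((x i - x j) • v) t := by
    intro t
    have h1 : HasDerivAt (fun t : ℝ => (1 - t) * (x i - x j)) (-1 * (x i - x j)) t :=
      ((hasDerivAt_id t).const_sub 1).mul_const _
    have h2 := (h1.smul_const v).const_sub x
    rwa [neg_one_mul, neg_smul, neg_neg] at h2
  have hI := intervalIntegral.integral_eq_sub_of_hasDerivAt
    (f := fun t : ℝ => F (x - ((1 - t) * (x i - x j)) • v))
    (f' := fun t : ℝ => (x i - x j) * fderiv ℝ F (x - ((1 - t) * (x i - x j)) • v) v)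
    (a := 0) (b := 1) ?_ ?_
  · rw [swapQuot, ← intervalIntegral.integral_const_mul, hI]
    congr 1
    · simp
    · rw [swap_path_eq hij]; simp
  · intro t ht
    rw [Set.uIcc_of_le zero_le_one] at ht
    have h3 := ((hF' t ht).differentiableAt (by simp)).hasFDerivAt.comp_hasDerivAt t (hpath t)
    rw [map_smul, smul_eq_mul] at h3
    exact h3
  · refine ContinuousOn.intervalIntegrable fun t ht => ?_
    rw [Set.uIcc_of_le zero_le_one] at ht
    have h1 : ContinuousAt (fderiv ℝ F) (x - ((1 - t) * (x i - x j)) • v) :=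
      ((hF' t ht).fderiv_right (m := 0) (by simp)).continuousAt
    have h2 : ContinuousAt (fun t : ℝ => fderiv ℝ F (x - ((1 - t) * (x i - x j)) • v)) t :=
      ContinuousAt.comp (g := fderiv ℝ F) (f := fun t : ℝ => x - ((1 - t) * (x i - x j)) • v)
        h1 (by fun_prop)
    exact ((h2.clm_apply continuousAt_const).const_mul _).continuousWithinAt

lemma swapQuot_self {x₀ : Fin N → ℝ} {i j : Fin N} (h0 : x₀ i = x₀ j) (F : (Fin N → ℝ) → ℝ) :
    swapQuot i j F x₀ = fderiv ℝ F x₀ (Pi.single i 1 - Pi.single j 1) := by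
  simp [swapQuot, h0]

/-! ### Divided differences of gradients -/

/-- The divided difference, with the coordinates of `x` as nodes, of the values `g i`, `i ∈ S`. -/
def divDiff (S : Finset (Fin N)) (x g : Fin N → ℝ) : ℝ :=
  ∑ i ∈ S, g i / ∏ l ∈ S.erase i, (x i - x l)

lemma divDiff_sum {ι : Type*} (S : Finset (Fin N)) (x : Fin N → ℝ) (T : Finset ι) (c : ι → ℝ)
    (g : ι → Fin N → ℝ) :
    divDiff S x (fun i => ∑ p ∈ T, c p * g p i) = ∑ p ∈ T, c p * divDiff S x (g p) := by
  simp only [divDiff, Finset.mul_sum, Finset.sum_div]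
  rw [Finset.sum_comm]
  exact Finset.sum_congr rfl fun p _ => Finset.sum_congr rfl fun i _ => by ring

lemma divDiff_congr {S : Finset (Fin N)} {x g g' : Fin N → ℝ} (h : ∀ i ∈ S, g i = g' i) :
    divDiff S x g = divDiff S x g' :=
  Finset.sum_congr rfl fun i hi => by rw [h i hi]

/-- The recursion of divided differences. -/
lemma divDiff_insert_sub {R : Finset (Fin N)} {i j : Fin N} (hi : i ∉ R) (hj : j ∉ R) (hij : i ≠ j)
    {x : Fin N → ℝ} (hx : Function.Injective x) (g : Fin N → ℝ) :
    divDiff (insert i R) x g - divDiff (insert j R) x g =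
      (x i - x j) * divDiff (insert i (insert j R)) x g := by
  have hne : ∀ k l, k ≠ l → x k - x l ≠ 0 := fun k l h => sub_ne_zero.2 fun h' => h (hx h')
  have hiR : i ∉ insert j R := by simp [hij, hi]
  have hjR : j ∉ insert i R := by simp [hij.symm, hj]
  have hswap : insert i (insert j R) = insert j (insert i R) := Finset.insert_comm i j R
  simp only [divDiff]
  rw [Finset.sum_insert hi, Finset.sum_insert hj, Finset.sum_insert hiR, Finset.sum_insert hj,
    Finset.erase_insert hi, Finset.erase_insert hj, Finset.erase_insert hiR, hswap,
    Finset.erase_insert hjR, Finset.prod_insert hi, Finset.prod_insert hj, mul_add, mul_add,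
    Finset.mul_sum]
  have h1 : (x i - x j) * (g i / ((x i - x j) * ∏ l ∈ R, (x i - x l))) =
      g i / ∏ l ∈ R, (x i - x l) := by
    rw [mul_div_assoc', mul_div_mul_left _ _ (hne i j hij)]
  have h2 : (x i - x j) * (g j / ((x j - x i) * ∏ l ∈ R, (x j - x l))) =
      -(g j / ∏ l ∈ R, (x j - x l)) := by
    rw [← neg_sub (x j) (x i), neg_mul, mul_div_assoc', mul_div_mul_left _ _ (hne j i hij.symm)]
  have h3 : ∀ r ∈ R, (x i - x j) * (g r / ∏ l ∈ (insert j (insert i R)).erase r, (x r - x l)) =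
      g r / ∏ l ∈ (insert i R).erase r, (x r - x l) -
        g r / ∏ l ∈ (insert j R).erase r, (x r - x l) := by
    intro r hr
    have hri : r ≠ i := fun h => hi (h ▸ hr)
    have hrj : r ≠ j := fun h => hj (h ▸ hr)
    have hir : i ∉ R.erase r := fun h => hi (Finset.mem_of_mem_erase h)
    have hjr : j ∉ R.erase r := fun h => hj (Finset.mem_of_mem_erase h)
    have hjir : j ∉ insert i (R.erase r) := by simp [hij.symm, hjr]
    rw [Finset.erase_insert_of_ne hrj.symm, Finset.erase_insert_of_ne hri.symm,
      Finset.erase_insert_of_ne hrj.symm, Finset.prod_insert hjir, Finset.prod_insert hir,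
      Finset.prod_insert hjr]
    have hP : ∏ l ∈ R.erase r, (x r - x l) ≠ 0 :=
      Finset.prod_ne_zero_iff.2 fun l hl => hne r l (Finset.ne_of_mem_erase hl).symm
    have e1 := hne r i hri
    have e2 := hne r j hrj
    field_simp
    ring
  rw [h1, h2, Finset.sum_congr rfl h3, Finset.sum_sub_distrib]
  ring

/-- The divided difference of the partial derivatives of `F`. -/
def gradDivDiff (S : Finset (Fin N)) (F : (Fin N → ℝ) → ℝ) (x : Fin N → ℝ) : ℝ :=
  divDiff S x fun i => fderiv ℝ F x (Pi.single i 1)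

/-- Invariance of F makes the partial derivatives move together with the nodes. -/
lemma gradDivDiff_comp_swap (S : Finset (Fin N)) {F : (Fin N → ℝ) → ℝ} {x : Fin N → ℝ}
    {p q : Fin N} (h : ∀ᶠ z in 𝓝 x, F (z ∘ Equiv.swap p q) = F z) :
    gradDivDiff S F (x ∘ Equiv.swap p q) = gradDivDiff (S.image (Equiv.swap p q)) F x := by
  rw [gradDivDiff, gradDivDiff, divDiff, divDiff, Finset.sum_image (Equiv.injective _).injOn]
  refine Finset.sum_congr rfl fun i _ => ?_
  congr 1
  · rw [← fderiv_comp_perm h, single_comp_swap, Equiv.swap_apply_self]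
  · rw [← Finset.image_erase (Equiv.injective _), Finset.prod_image (Equiv.injective _).injOn]
    rfl

/-! ### Points with pairwise distinct coordinates -/

lemma dense_injective : Dense {x : Fin N → ℝ | Function.Injective x} := by
  intro x
  -- For small t ≠ 0 the perturbation x i + t i separates equal coordinates and keeps different ones
  -- apart.
  have hc : ContinuousAt (fun t : ℝ => (fun i => x i + t * (i : ℕ) : Fin N → ℝ)) 0 := by fun_prop
  have h0 : (fun i => x i + 0 * (i : ℕ) : Fin N → ℝ) = x := by simp
  have ht : Tendsto (fun t : ℝ => (fun i => x i + t * (i : ℕ) : Fin N → ℝ)) (𝓝[≠] 0) (𝓝 x) := by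
    have := hc.tendsto
    rw [h0] at this
    exact this.mono_left nhdsWithin_le_nhds
  refine mem_closure_of_tendsto ht ?_
  have hev : ∀ i j : Fin N, ∀ᶠ t : ℝ in 𝓝[≠] 0, i ≠ j → x i + t * (i : ℕ) ≠ x j + t * (j : ℕ) := by
    intro i j
    by_cases hij : i = j
    · exact Eventually.of_forall fun t h => absurd hij h
    have hij' : ((i : ℕ) : ℝ) - (j : ℕ) ≠ 0 := by
      rw [sub_ne_zero, Ne, Nat.cast_inj]
      exact fun h => hij (Fin.ext h)
    by_cases hx : x i = x j
    · filter_upwards [self_mem_nhdsWithin] with t ht _ h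
      have : t * (((i : ℕ) : ℝ) - (j : ℕ)) = 0 := by rw [hx] at h; linarith
      exact (mul_ne_zero ht hij') this
    · have h1 : ContinuousAt (fun t : ℝ => x i + t * (i : ℕ) - (x j + t * (j : ℕ))) 0 := by fun_prop
      have h2 : ∀ᶠ t : ℝ in 𝓝 0, x i + t * (i : ℕ) - (x j + t * (j : ℕ)) ≠ 0 :=
        h1.eventually_ne (by simpa using sub_ne_zero.2 hx)
      exact (h2.filter_mono nhdsWithin_le_nhds).mono fun t ht _ => sub_ne_zero.1 ht
  have hall : ∀ᶠ t : ℝ in 𝓝[≠] 0, ∀ i j : Fin N, i ≠ j →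
      x i + t * (i : ℕ) ≠ x j + t * (j : ℕ) :=
    eventually_all.2 fun i => eventually_all.2 fun j => hev i j
  exact hall.mono fun t ht i j h => by_contra fun hne => ht i j hne h

lemma isOpen_injective : IsOpen {x : Fin N → ℝ | Function.Injective x} := by
  have : {x : Fin N → ℝ | Function.Injective x} =
      ⋂ i, ⋂ j, {x : Fin N → ℝ | i ≠ j → x i ≠ x j} := by
    ext x
    simp only [Set.mem_ofPred_eq, Set.mem_iInter, Function.Injective]
    exact ⟨fun h i j hij he => hij (h he), fun h i j he => by_contra fun hij => h i j hij he⟩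
  rw [this]
  refine isOpen_iInter_of_finite fun i => isOpen_iInter_of_finite fun j => ?_
  by_cases hij : i = j
  · simp [hij]
  · simp only [ne_eq, hij, not_false_eq_true, forall_const]
    exact isOpen_ne_fun (continuous_apply i) (continuous_apply j)

instance neBot_injective (x : Fin N → ℝ) :
    (𝓝[{x : Fin N → ℝ | Function.Injective x}] x).NeBot :=
  mem_closure_iff_nhdsWithin_neBot.1 (dense_injective x)

/-! ### Continuation of divided differences of gradients -/

lemma image_swap_image_range {a : ℕ → Fin N} {k p q : ℕ} (hp : p < k) (hq : q < k) :
    ((Finset.range k).image a).image (Equiv.swap (a p) (a q)) = (Finset.range k).image a := by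
  refine Finset.eq_of_subset_of_card_le ?_ ?_
  · intro m hm
    obtain ⟨l, hl, rfl⟩ := Finset.mem_image.1 hm
    rcases eq_or_ne l (a p) with rfl | h1
    · rw [Equiv.swap_apply_left]; exact Finset.mem_image_of_mem _ (Finset.mem_range.2 hq)
    rcases eq_or_ne l (a q) with rfl | h2
    · rw [Equiv.swap_apply_right]; exact Finset.mem_image_of_mem _ (Finset.mem_range.2 hp)
    · rwa [Equiv.swap_apply_of_ne_of_ne h1 h2]
  · rw [Finset.card_image_of_injective _ (Equiv.injective _)]

lemma injective_comp_swap {x : Fin N → ℝ} (hx : Function.Injective x) (p q : Fin N) :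
    Function.Injective (x ∘ Equiv.swap p q) := hx.comp (Equiv.injective _)

/-- The divided difference over one more node is a difference quotient of the previous one. -/
lemma swapQuot_eq_gradDivDiff {x₀ : Fin N → ℝ} {ρ : ℝ} {a : ℕ → Fin N} {n : ℕ}
    (ha : Set.InjOn a (Finset.range n)) (h0 : ∀ p < n, ∀ q < n, x₀ (a p) = x₀ (a q))
    {k : ℕ} (hk : k + 1 < n) {F G : (Fin N → ℝ) → ℝ} (hG : ContDiffOn ℝ 1 G (Metric.ball x₀ ρ))
    (hF : ∀ p < k + 2, ∀ q < k + 2, ∀ x ∈ Metric.ball x₀ ρ,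
      F (x ∘ Equiv.swap (a p) (a q)) = F x)
    (hGF : ∀ x ∈ Metric.ball x₀ ρ, Function.Injective x →
      G x = gradDivDiff ((Finset.range (k + 1)).image a) F x)
    {x : Fin N → ℝ} (hx : x ∈ Metric.ball x₀ ρ) (hinj : Function.Injective x) :
    swapQuot (a k) (a (k + 1)) G x = gradDivDiff ((Finset.range (k + 2)).image a) F x := by
  have hinja : ∀ p < n, ∀ q < n, a p = a q → p = q := fun p hp q hq h =>
    ha (by simpa using hp) (by simpa using hq) h
  have hij : a k ≠ a (k + 1) := fun h => by
    have := hinja k (by omega) (k + 1) (by omega) h; omega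
  have h00 := h0 k (by omega) (k + 1) (by omega)
  have hxs := dist_comp_perm_lt (apply_swap_eq h00) hx
  set R := (Finset.range k).image a with hR
  have hkR : a k ∉ R := fun h => by
    obtain ⟨p, hp, he⟩ := Finset.mem_image.1 h
    have hp' := Finset.mem_range.1 hp
    have := hinja p (by omega) k (by omega) he; omega
  have hkR' : a (k + 1) ∉ R := fun h => by
    obtain ⟨p, hp, he⟩ := Finset.mem_image.1 h
    have hp' := Finset.mem_range.1 hp
    have := hinja p (by omega) (k + 1) (by omega) he; omega
  have hS : (Finset.range (k + 1)).image a = insert (a k) R := by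
    rw [Finset.range_add_one, Finset.image_insert]
  have hT : (Finset.range (k + 2)).image a = insert (a k) (insert (a (k + 1)) R) := by
    rw [Finset.range_add_one, Finset.image_insert, hS, Finset.insert_comm]
  have hRs : R.image (Equiv.swap (a k) (a (k + 1))) = R := by
    have : R.image (Equiv.swap (a k) (a (k + 1))) = R.image id := by
      refine Finset.image_congr fun m hm => ?_
      exact Equiv.swap_apply_of_ne_of_ne (fun h => hkR (h ▸ hm)) (fun h => hkR' (h ▸ hm))
    rw [this, Finset.image_id]
  have hne : x (a k) - x (a (k + 1)) ≠ 0 := sub_ne_zero.2 fun h => hij (hinj h)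
  apply mul_left_cancel₀ hne
  -- The swap fixes R and exchanges the two remaining nodes, so the value of G at the swapped point
  -- is the divided difference over R and a (k+1); the recursion of divided differences then
  -- applies.
  rw [mul_swapQuot hij h00 hG hx, hGF x hx hinj, hGF _ hxs (injective_comp_swap hinj _ _),
    gradDivDiff_comp_swap, hS, Finset.image_insert, hRs, Equiv.swap_apply_left, hT]
  · exact divDiff_insert_sub hkR hkR' hij hinj _
  · filter_upwards [Metric.isOpen_ball.mem_nhds hx] with z hz
    exact hF k (by omega) (k + 1) (by omega) z hz

/-- The divided difference of the gradient of a symmetric function of class `C^(m+k+1)` at `k+1`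
nodes continues to a function of class `C^m`. -/
lemma exists_contDiffOn_eq_gradDivDiff {x₀ : Fin N → ℝ} {ρ : ℝ} {a : ℕ → Fin N} {n : ℕ}
    (ha : Set.InjOn a (Finset.range n)) (h0 : ∀ p < n, ∀ q < n, x₀ (a p) = x₀ (a q))
    {k : ℕ} (hk : k < n) (m : ℕ) {F : (Fin N → ℝ) → ℝ}
    (hF : ContDiffOn ℝ (m + (k + 1) : ℕ) F (Metric.ball x₀ ρ))
    (hs : ∀ p < k + 1, ∀ q < k + 1, ∀ x ∈ Metric.ball x₀ ρ,
      F (x ∘ Equiv.swap (a p) (a q)) = F x) :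
    ∃ G : (Fin N → ℝ) → ℝ, ContDiffOn ℝ m G (Metric.ball x₀ ρ) ∧
      ∀ x ∈ Metric.ball x₀ ρ, Function.Injective x →
        G x = gradDivDiff ((Finset.range (k + 1)).image a) F x := by
  induction k generalizing m with
  | zero =>
    refine ⟨fun x => fderiv ℝ F x (Pi.single (a 0) 1),
      (hF.fderiv_of_isOpen (m := m) Metric.isOpen_ball (by simp)).clm_apply contDiffOn_const,
      fun x _ _ => ?_⟩
    simp [gradDivDiff, divDiff]
  | succ k ih =>
    obtain ⟨G, hG, hGF⟩ := ih (by omega) (m + 1)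
      (by rwa [show m + 1 + (k + 1) = m + (k + 1 + 1) by omega])
      (fun p hp q hq => hs p (by omega) q (by omega))
    have hij : a k ≠ a (k + 1) := fun h => by
      have : k = k + 1 := ha (by simp; omega) (by simp; omega) h
      omega
    refine ⟨swapQuot (a k) (a (k + 1)) G,
      contDiffOn_swapQuot hij (h0 k (by omega) (k + 1) (by omega)) hG, fun x hx hinj => ?_⟩
    exact swapQuot_eq_gradDivDiff ha h0 hk
      (hG.of_le (by exact_mod_cast Nat.le_add_left 1 m)) hs hGF hx hinj

lemma fderiv_fderiv_apply_comm {F : (Fin N → ℝ) → ℝ} {x : Fin N → ℝ} (hF : ContDiffAt ℝ 2 F x)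
    (v w : Fin N → ℝ) :
    fderiv ℝ (fun z => fderiv ℝ F z v) x w = fderiv ℝ (fun z => fderiv ℝ F z w) x v := by
  have hd : DifferentiableAt ℝ (fderiv ℝ F) x :=
    (hF.fderiv_right (m := 1) (by norm_num)).differentiableAt (by simp)
  have h : ∀ v w, fderiv ℝ (fun z => fderiv ℝ F z v) x w = fderiv ℝ (fderiv ℝ F) x w v := by
    intro v w
    rw [fderiv_clm_apply hd (differentiableAt_const v)]
    simp
  rw [h, h]
  exact (hF.isSymmSndFDerivAt (by simp)).eq w v

/-- Differentiation in a direction in which the differences of the nodes do not change. -/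
lemma fderiv_gradDivDiff {S : Finset (Fin N)} {F : (Fin N → ℝ) → ℝ} {x v : Fin N → ℝ}
    (hF : ContDiffAt ℝ 2 F x) (hv : ∀ i ∈ S, ∀ l ∈ S, v i = v l)
    (hd : DifferentiableAt ℝ (gradDivDiff S F) x) :
    fderiv ℝ (gradDivDiff S F) x v = gradDivDiff S (fun z => fderiv ℝ F z v) x := by
  have h1 : HasDerivAt (fun t : ℝ => gradDivDiff S F (x + t • v))
      (fderiv ℝ (gradDivDiff S F) x v) 0 := hd.hasFDerivAt.hasLineDerivAt v
  have h2 : (fun t : ℝ => gradDivDiff S F (x + t • v)) = fun t : ℝ =>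
      ∑ i ∈ S, fderiv ℝ F (x + t • v) (Pi.single i 1) / ∏ l ∈ S.erase i, (x i - x l) := by
    funext t
    refine Finset.sum_congr rfl fun i hi => ?_
    congr 1
    refine Finset.prod_congr rfl fun l hl => ?_
    simp only [Pi.add_apply, Pi.smul_apply, smul_eq_mul, hv i hi l (Finset.mem_of_mem_erase hl)]
    ring
  have h3 : ∀ i, HasDerivAt (fun t : ℝ => fderiv ℝ F (x + t • v) (Pi.single i 1))
      (fderiv ℝ (fun z => fderiv ℝ F z v) x (Pi.single i 1)) 0 := by
    intro i
    rw [fderiv_fderiv_apply_comm hF]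
    have hdi : DifferentiableAt ℝ (fun z => fderiv ℝ F z (Pi.single i 1)) x :=
      ((hF.fderiv_right (m := 1) (by norm_num)).differentiableAt (by simp)).clm_apply
        (differentiableAt_const _)
    exact hdi.hasFDerivAt.hasLineDerivAt v
  rw [h2] at h1
  exact h1.unique (HasDerivAt.fun_sum fun i _ => (h3 i).div_const _)

lemma iteratedFDeriv_succ_snoc {F : (Fin N → ℝ) → ℝ} {x : Fin N → ℝ} {k : ℕ}
    (hF : ContDiffAt ℝ (k + 1 : ℕ) F x) (w : Fin (k + 1) → Fin N → ℝ) :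
    iteratedFDeriv ℝ (k + 1) F x w =
      iteratedFDeriv ℝ k (fun z => fderiv ℝ F z (w (Fin.last k))) x (Fin.init w) := by
  rw [iteratedFDeriv_succ_apply_right]
  have h := ContinuousLinearMap.iteratedFDeriv_comp_left
    (ContinuousLinearMap.apply ℝ ℝ (w (Fin.last k))) (f := fderiv ℝ F) (x := x) (n := k)
    (hF.fderiv_right (by simp)) (i := k) le_rfl
  have h2 := congrArg (fun L => L (Fin.init w)) h
  exact h2.symm

lemma helmert_apply_lt {a : ℕ → Fin N} {n : ℕ} (ha : Set.InjOn a (Finset.range n)) {p q : ℕ}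
    (hq : q < n) (hpq : p < q) : helmert a q (a p) = 1 := by
  have hinj : ∀ r < n, ∀ s < n, a r = a s → r = s := fun r hr s hs h =>
    ha (by simpa using hr) (by simpa using hs) h
  have h1 : a p ≠ a q := fun h => by have := hinj p (by omega) q hq h; omega
  rw [helmert, if_neg (by omega)]
  simp only [Pi.sub_apply, Finset.sum_apply, Pi.smul_apply, Pi.single_apply, h1, if_false,
    smul_eq_mul, mul_zero, sub_zero]
  rw [Finset.sum_eq_single p]
  · simp
  · intro r hr hrp
    rw [if_neg]
    intro h
    exact hrp (hinj r ((Finset.mem_range.1 hr).trans hq) p (by omega) h.symm)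
  · intro h; exact absurd (Finset.mem_range.2 hpq) h

/-- The limit of the divided difference of the gradient of a symmetric function at a point where
all the nodes coincide. -/
lemma tendsto_gradDivDiff {x₀ : Fin N → ℝ} {ρ : ℝ} (hρ : 0 < ρ) {a : ℕ → Fin N} {n : ℕ}
    (ha : Set.InjOn a (Finset.range n)) (h0 : ∀ p < n, ∀ q < n, x₀ (a p) = x₀ (a q))
    {k : ℕ} (hk : k < n) {F : (Fin N → ℝ) → ℝ}
    (hF : ContDiffOn ℝ (k + 1 : ℕ) F (Metric.ball x₀ ρ))
    (hs : ∀ p < k + 1, ∀ q < k + 1, ∀ x ∈ Metric.ball x₀ ρ,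
      F (x ∘ Equiv.swap (a p) (a q)) = F x) :
    Tendsto (gradDivDiff ((Finset.range (k + 1)).image a) F)
      (𝓝[{x | Function.Injective x}] x₀)
      (𝓝 (iteratedFDeriv ℝ (k + 1) F x₀ (fun q => helmert a q) / (k.factorial : ℝ))) := by
  have hball : Metric.ball x₀ ρ ∈ 𝓝 x₀ := Metric.ball_mem_nhds x₀ hρ
  have hx₀ : x₀ ∈ Metric.ball x₀ ρ := Metric.mem_ball_self hρ
  have hev : ∀ᶠ x in 𝓝[{x | Function.Injective x}] x₀,
      x ∈ Metric.ball x₀ ρ ∧ Function.Injective x :=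
    inter_mem (mem_nhdsWithin_of_mem_nhds hball) self_mem_nhdsWithin
  have key : ∀ {G G' : (Fin N → ℝ) → ℝ}, ContinuousAt G x₀ →
      (∀ x ∈ Metric.ball x₀ ρ, Function.Injective x → G x = G' x) →
      Tendsto G' (𝓝[{x | Function.Injective x}] x₀) (𝓝 (G x₀)) := by
    intro G G' hG hGG'
    refine (hG.tendsto.mono_left nhdsWithin_le_nhds).congr' ?_
    filter_upwards [hev] with x hx
    exact hGG' x hx.1 hx.2
  induction k generalizing F with
  | zero =>
    have hc : ContinuousAt (fun x => fderiv ℝ F x (Pi.single (a 0) 1)) x₀ :=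
      (((hF.contDiffAt hball).fderiv_right (m := 0) (by simp)).continuousAt).clm_apply
        continuousAt_const
    have h1 := key hc (G' := gradDivDiff ((Finset.range (0 + 1)).image a) F) fun x _ _ => by
      simp [gradDivDiff, divDiff]
    have h2 : iteratedFDeriv ℝ (0 + 1) F x₀ (fun q => helmert a q) / ((0 : ℕ).factorial : ℝ) =
        fderiv ℝ F x₀ (Pi.single (a 0) 1) := by
      rw [iteratedFDeriv_succ_apply_right]
      simp [helmert]
    rw [h2]
    exact h1
  | succ k ih =>
    obtain ⟨G, hG, hGF⟩ := exists_contDiffOn_eq_gradDivDiff ha h0 (k := k) (by omega) 1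
      (hF.of_le (by exact_mod_cast (by omega : 1 + (k + 1) ≤ k + 1 + 1)))
      (fun p hp q hq => hs p (by omega) q (by omega))
    rw [Nat.cast_one] at hG
    have hij : a k ≠ a (k + 1) := fun h => by
      have : k = k + 1 := ha (by simp; omega) (by simp; omega) h
      omega
    have h00 := h0 k (by omega) (k + 1) (by omega)
    have hq : ContinuousAt (swapQuot (a k) (a (k + 1)) G) x₀ :=
      ((contDiffOn_swapQuot (m := 0) hij h00 (by simpa using hG)).contDiffAt hball).continuousAt
    have h1 := key hq fun x hx hinj =>
      swapQuot_eq_gradDivDiff ha h0 hk hG hs hGF hx hinj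
    set v := helmert a (k + 1) with hv
    -- The symmetry of G is clear where G is a divided difference, and extends to the whole ball by
    -- density and continuity.
    have hGs : ∀ p < k + 1, ∀ q < k + 1, ∀ x ∈ Metric.ball x₀ ρ,
        G (x ∘ Equiv.swap (a p) (a q)) = G x := by
      intro p hp q hq
      have hmaps : ∀ x ∈ Metric.ball x₀ ρ, x ∘ Equiv.swap (a p) (a q) ∈ Metric.ball x₀ ρ :=
        fun x hx => dist_comp_perm_lt (apply_swap_eq (h0 p (by omega) q (by omega))) hx
      have hcont : ContinuousOn (fun x : Fin N → ℝ => G (x ∘ Equiv.swap (a p) (a q)))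
          (Metric.ball x₀ ρ) :=
        hG.continuousOn.comp (permCLE (Equiv.swap (a p) (a q))).continuous.continuousOn hmaps
      refine Set.EqOn.of_subset_closure
        (s := Metric.ball x₀ ρ ∩ {x | Function.Injective x}) ?_ hcont hG.continuousOn
        Set.inter_subset_left (dense_injective.open_subset_closure_inter Metric.isOpen_ball)
      rintro x ⟨hx, hinj⟩
      change G (x ∘ Equiv.swap (a p) (a q)) = G x
      rw [hGF _ (hmaps x hx) (injective_comp_swap hinj _ _), hGF x hx hinj,
        gradDivDiff_comp_swap, image_swap_image_range hp hq]
      filter_upwards [Metric.isOpen_ball.mem_nhds hx] with z hz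
      exact hs p (by omega) q (by omega) z hz
    have hGe : ∀ p < k + 1, fderiv ℝ G x₀ (Pi.single (a p) 1) =
        fderiv ℝ G x₀ (Pi.single (a k) 1) := by
      intro p hp
      have h2 := fderiv_comp_perm (F := G) (x := x₀) (τ := Equiv.swap (a p) (a k))
        (by filter_upwards [hball] with z hz; exact hGs p hp k (by omega) z hz)
        (Pi.single (a p) 1)
      have h3 : x₀ ∘ Equiv.swap (a p) (a k) = x₀ :=
        funext fun l => apply_swap_eq (h0 p (by omega) k (by omega)) l
      rw [h3, single_comp_swap, Equiv.swap_apply_left] at h2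
      exact h2.symm
    -- By symmetry the partial derivatives of G at x₀ in a 0, …, a k agree, so h_{k+1} yields k + 1
    -- copies of ∂_{a k} G - ∂_{a (k+1)} G. This dictates the shape of the Helmert vectors, and the
    -- factors k + 1 accumulate to the factorial.
    have hGv : fderiv ℝ G x₀ v = ((k + 1 : ℕ) : ℝ) * swapQuot (a k) (a (k + 1)) G x₀ := by
      rw [swapQuot_self h00, hv, helmert, if_neg (by omega), map_sub, map_sum, map_smul,
        Finset.sum_congr rfl fun p hp => hGe p (Finset.mem_range.1 hp), Finset.sum_const,
        Finset.card_range, map_sub, nsmul_eq_mul, smul_eq_mul]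
      ring
    have hvS : ∀ i ∈ (Finset.range (k + 1)).image a, v i = 1 := by
      intro i hi
      obtain ⟨p, hp, rfl⟩ := Finset.mem_image.1 hi
      exact helmert_apply_lt ha hk (Finset.mem_range.1 hp)
    have hcG : ContinuousAt (fun x => fderiv ℝ G x v) x₀ :=
      (((hG.contDiffAt hball).fderiv_right (m := 0) (by simp)).continuousAt).clm_apply
        continuousAt_const
    -- Since v equals 1 on all nodes, differentiation along v passes inside the divided difference.
    -- Thus DG(v) is also the limit given by the induction hypothesis for the derivative of F along
    -- v, which is still symmetric in a 0, …, a k.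
    have h4 := key hcG (G' := gradDivDiff ((Finset.range (k + 1)).image a)
        (fun z => fderiv ℝ F z v)) fun x hx hinj => by
      have hxn := Metric.isOpen_ball.mem_nhds hx
      have heq : G =ᶠ[𝓝 x] gradDivDiff ((Finset.range (k + 1)).image a) F := by
        filter_upwards [hxn, isOpen_injective.mem_nhds hinj] with z hz hzi
        exact hGF z hz hzi
      rw [heq.fderiv_eq]
      refine fderiv_gradDivDiff ((hF.contDiffAt hxn).of_le ?_)
        (fun i hi l hl => by rw [hvS i hi, hvS l hl]) ?_
      · exact_mod_cast (by omega : 2 ≤ k + 1 + 1)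
      · exact heq.differentiableAt_iff.1 ((hG.contDiffAt hxn).differentiableAt (by simp))
    have h5 := ih (by omega) (F := fun z => fderiv ℝ F z v)
      ((hF.fderiv_of_isOpen (m := (k + 1 : ℕ)) Metric.isOpen_ball (by simp)).clm_apply
        contDiffOn_const) (fun p hp q hq x hx => by
        have h6 := fderiv_comp_perm (F := F) (x := x) (τ := Equiv.swap (a p) (a q))
          (by filter_upwards [Metric.isOpen_ball.mem_nhds hx] with z hz
              exact hs p (by omega) q (by omega) z hz) v
        rwa [hv, helmert_comp_swap ha (by omega) hp hq hk] at h6)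
    have h6 := tendsto_nhds_unique h4 h5
    have h7 : swapQuot (a k) (a (k + 1)) G x₀ =
        iteratedFDeriv ℝ (k + 1 + 1) F x₀ (fun q => helmert a q) / ((k + 1).factorial : ℝ) := by
      rw [iteratedFDeriv_succ_snoc (hF.contDiffAt hball)]
      have h8 : iteratedFDeriv ℝ (k + 1) (fun z => fderiv ℝ F z (helmert a (Fin.last (k + 1)))) x₀
          (Fin.init fun q => helmert a q) = (k.factorial : ℝ) * fderiv ℝ G x₀ v := by
        rw [h6, mul_div_cancel₀ _ (by positivity)]
        rfl
      rw [h8, hGv, Nat.factorial_succ]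
      push_cast
      field_simp
    rw [← h7]
    exact h1

lemma exists_enumeration {J : Finset (Fin N)} (hJ : J.Nonempty) :
    ∃ a : ℕ → Fin N, Set.InjOn a (Finset.range J.card) ∧ (Finset.range J.card).image a = J := by
  obtain ⟨i₀, -⟩ := hJ
  refine ⟨fun k => if h : k < J.card then (J.equivFin.symm ⟨k, h⟩ : Fin N) else i₀, ?_, ?_⟩
  · intro p hp q hq h
    have hp' : p < J.card := by simpa using hp
    have hq' : q < J.card := by simpa using hq
    simp only [hp', hq', dif_pos] at h
    have := J.equivFin.symm.injective (Subtype.ext h)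
    simpa using this
  · ext i
    simp only [Finset.mem_image, Finset.mem_range]
    constructor
    · rintro ⟨k, hk, rfl⟩
      rw [dif_pos hk]
      exact Subtype.coe_prop _
    · intro hi
      refine ⟨J.equivFin ⟨i, hi⟩, (J.equivFin ⟨i, hi⟩).2, ?_⟩
      rw [dif_pos (J.equivFin ⟨i, hi⟩).2]
      simp

/-! ### Divided differences of the gradients of the coordinates -/

/-- Each step of the recursion uses e_{q+1}(T ∪ j) - e_{q+1}(T ∪ i) = (x_j - x_i) e_q(T) with T =
H∖S; the order of the nodes accounts for the sign. -/
lemma divDiff_esym_erase {H : Finset (Fin N)} {x : Fin N → ℝ} (hx : Function.Injective x) (r : ℕ)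
    {k : ℕ} {S : Finset (Fin N)} (hS : S ⊆ H) (hk : S.card = k + 1) :
    divDiff S x (fun i => esym (H.erase i) r x) =
      if k ≤ r then (-1 : ℝ) ^ k * esym (H \ S) (r - k) x else 0 := by
  induction k generalizing S with
  | zero =>
    obtain ⟨i, rfl⟩ := Finset.card_eq_one.1 hk
    simp [divDiff, Finset.sdiff_singleton_eq_erase]
  | succ k ih =>
    obtain ⟨i, hi⟩ : S.Nonempty := Finset.card_pos.1 (by omega)
    obtain ⟨j, hj⟩ : (S.erase i).Nonempty :=
      Finset.card_pos.1 (by rw [Finset.card_erase_of_mem hi]; omega)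
    set R := (S.erase i).erase j with hR
    have hjS := Finset.mem_of_mem_erase hj
    have hij : i ≠ j := (Finset.ne_of_mem_erase hj).symm
    have hiR : i ∉ R := fun h => Finset.notMem_erase i S (Finset.mem_of_mem_erase h)
    have hjR : j ∉ R := Finset.notMem_erase j _
    have hSR : insert i (insert j R) = S := by
      rw [hR, Finset.insert_erase hj, Finset.insert_erase hi]
    have hcR : R.card = k := by
      rw [hR, Finset.card_erase_of_mem hj, Finset.card_erase_of_mem hi]; omega
    have hRS : R ⊆ S := fun m hm => Finset.mem_of_mem_erase (Finset.mem_of_mem_erase hm)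
    have hne : x i - x j ≠ 0 := sub_ne_zero.2 fun h => hij (hx h)
    have h := divDiff_insert_sub hiR hjR hij hx (fun i => esym (H.erase i) r x)
    rw [hSR, ih (Finset.insert_subset (hS hi) (hRS.trans hS))
        (by rw [Finset.card_insert_of_notMem hiR, hcR]),
      ih (Finset.insert_subset (hS hjS) (hRS.trans hS))
        (by rw [Finset.card_insert_of_notMem hjR, hcR])] at h
    have hjT : j ∉ H \ S := fun h => (Finset.mem_sdiff.1 h).2 hjS
    have hiT : i ∉ H \ S := fun h => (Finset.mem_sdiff.1 h).2 hi
    have h1 : H \ insert i R = insert j (H \ S) := by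
      ext m
      rw [← hSR]
      simp only [Finset.mem_sdiff, Finset.mem_insert]
      constructor
      · rintro ⟨h1, h2⟩
        by_cases hm : m = j
        · exact Or.inl hm
        · exact Or.inr ⟨h1, by tauto⟩
      · rintro (rfl | ⟨h1, h2⟩)
        · exact ⟨hS hjS, by rintro (h | h); exacts [hij h.symm, hjR h]⟩
        · exact ⟨h1, by tauto⟩
    have h2 : H \ insert j R = insert i (H \ S) := by
      ext m
      rw [← hSR]
      simp only [Finset.mem_sdiff, Finset.mem_insert]
      constructor
      · rintro ⟨h1, h2⟩
        by_cases hm : m = i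
        · exact Or.inl hm
        · exact Or.inr ⟨h1, by tauto⟩
      · rintro (rfl | ⟨h1, h2⟩)
        · exact ⟨hS hi, by rintro (h | h); exacts [hij h, hiR h]⟩
        · exact ⟨h1, by tauto⟩
    apply mul_left_cancel₀ hne
    rw [← h, h1, h2]
    rcases lt_trichotomy r k with hr | rfl | hr
    · rw [if_neg (by omega), if_neg (by omega), if_neg (by omega)]; simp
    · rw [if_pos le_rfl, if_pos le_rfl, if_neg (by omega)]; simp
    · rw [if_pos hr.le, if_pos hr.le, if_pos (by omega)]
      obtain ⟨s, rfl⟩ : ∃ s, r = k + 1 + s := ⟨r - (k + 1), by omega⟩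
      rw [show k + 1 + s - k = s + 1 by omega, show k + 1 + s - (k + 1) = s by omega,
        esym_insert hjT, esym_insert hiT, pow_succ]
      ring

lemma gradDivDiff_eTilde {H : Finset (Fin N)} {x : Fin N → ℝ} (hx : Function.Injective x) (r : ℕ)
    {k : ℕ} {S : Finset (Fin N)} (hS : S ⊆ H) (hk : S.card = k + 1) :
    gradDivDiff S (eTilde H (r + 1)) x =
      (if k ≤ r then (-1 : ℝ) ^ k * esym (H \ S) (r - k) x else 0) /
        (H.card.descFactorial (r + 1) : ℝ) := by
  rw [← divDiff_esym_erase hx r hS hk, gradDivDiff, divDiff, divDiff, Finset.sum_div]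
  refine Finset.sum_congr rfl fun i hi => ?_
  rw [fderiv_eTilde, fderiv_esym_single_of_mem (hS hi)]
  ring

lemma esym_of_eq {H : Finset (Fin N)} {x : Fin N → ℝ} {y : ℝ} (h : ∀ i ∈ H, x i = y) (r : ℕ) :
    esym H r x = (H.card.choose r : ℝ) * y ^ r := by
  rw [esym_eq_sum, ← Finset.card_powersetCard, ← nsmul_eq_mul, ← Finset.sum_const]
  refine Finset.sum_congr rfl fun t ht => ?_
  rw [Finset.mem_powersetCard] at ht
  rw [Finset.prod_congr rfl fun i hi => h i (ht.1 hi), Finset.prod_const, ht.2]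

lemma eTilde_of_eq {H : Finset (Fin N)} {x : Fin N → ℝ} {y : ℝ} (h : ∀ i ∈ H, x i = y) {r : ℕ}
    (hr : r ≤ H.card) : eTilde H r x = y ^ r / (r.factorial : ℝ) := by
  have hd : (H.card.descFactorial r : ℝ) ≠ 0 := by
    rw [Nat.cast_ne_zero]; exact (Nat.descFactorial_pos.2 hr).ne'
  have hf : (r.factorial : ℝ) ≠ 0 := by positivity
  rw [eTilde_eq, esym_of_eq h, div_eq_div_iff hd hf, Nat.descFactorial_eq_factorial_mul_choose]
  push_cast; ring

/-- The divided differences of `u` solve a unit triangular system against those of `eTilde`. At x₀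
its right-hand side for r = s + 1 is (-1)^k ẽ_{s-k} divided by the falling factorial of |H| of
length k + 1 (zero for s < k), so only the entry r = k + 1 of the solution survives. -/
lemma tendsto_gradDivDiff_u {H : Finset (Fin N)} {x₀ : Fin N → ℝ} {y : ℝ}
    (h : ∀ i ∈ H, x₀ i = y) {k : ℕ} {S : Finset (Fin N)} (hS : S ⊆ H) (hk : S.card = k + 1)
    {r : ℕ} (h1 : 1 ≤ r) (hr : r ≤ H.card) :
    Tendsto (gradDivDiff S (u H r)) (𝓝[{x | Function.Injective x}] x₀)
      (𝓝 (if r = k + 1 then (-1 : ℝ) ^ k / (H.card.descFactorial (k + 1) : ℝ) else 0)) := by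
  induction r using Nat.strong_induction_on with
  | _ r ih =>
  obtain ⟨s, rfl⟩ : ∃ s, r = s + 1 := ⟨r - 1, by omega⟩
  set L : ℕ → ℝ := fun r =>
    if r = k + 1 then (-1 : ℝ) ^ k / (H.card.descFactorial (k + 1) : ℝ) else 0 with hL
  have hkH : k + 1 ≤ H.card := hk ▸ Finset.card_le_card hS
  have hrec : ∀ x, gradDivDiff S (u H (s + 1)) x = gradDivDiff S (eTilde H (s + 1)) x -
      ∑ j ∈ Finset.Icc 1 s, eTilde H (s + 1 - j) x * gradDivDiff S (u H j) x := by
    intro x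
    have h2 : gradDivDiff S (eTilde H (s + 1)) x =
        ∑ j ∈ Finset.Icc 1 (s + 1), eTilde H (s + 1 - j) x * gradDivDiff S (u H j) x := by
      unfold gradDivDiff
      rw [← divDiff_sum]
      simp only [fderiv_eTilde_eq_sum]
    rw [h2, Finset.sum_Icc_succ_top (by omega), Nat.sub_self, eTilde_zero]
    ring
  have hcont : ∀ (J : Finset (Fin N)) (m : ℕ), Tendsto (esym J m)
      (𝓝[{x | Function.Injective x}] x₀) (𝓝 (esym J m x₀)) := fun J m =>
    ((contDiff_esym J m (m := 0)).continuous.tendsto x₀).mono_left nhdsWithin_le_nhds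
  have hcont' : ∀ m : ℕ, Tendsto (eTilde H m)
      (𝓝[{x | Function.Injective x}] x₀) (𝓝 (eTilde H m x₀)) := fun m =>
    ((contDiff_eTilde H m (m := 0)).continuous.tendsto x₀).mono_left nhdsWithin_le_nhds
  have ht1 : Tendsto (gradDivDiff S (eTilde H (s + 1))) (𝓝[{x | Function.Injective x}] x₀)
      (𝓝 ((if k ≤ s then (-1 : ℝ) ^ k * esym (H \ S) (s - k) x₀ else 0) /
        (H.card.descFactorial (s + 1) : ℝ))) := by
    refine Tendsto.congr' (f₁ := fun x =>
      (if k ≤ s then (-1 : ℝ) ^ k * esym (H \ S) (s - k) x else 0) /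
        (H.card.descFactorial (s + 1) : ℝ)) ?_ ?_
    · filter_upwards [self_mem_nhdsWithin] with x hx
      exact (gradDivDiff_eTilde hx s hS hk).symm
    · refine Tendsto.div_const ?_ _
      split_ifs
      · exact (hcont _ _).const_mul _
      · exact tendsto_const_nhds
  have ht2 : Tendsto (fun x => ∑ j ∈ Finset.Icc 1 s,
      eTilde H (s + 1 - j) x * gradDivDiff S (u H j) x) (𝓝[{x | Function.Injective x}] x₀)
      (𝓝 (∑ j ∈ Finset.Icc 1 s, eTilde H (s + 1 - j) x₀ * L j)) := by
    refine tendsto_finsetSum _ fun j hj => ?_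
    rw [Finset.mem_Icc] at hj
    exact (hcont' _).mul (ih j (by omega) hj.1 (by omega))
  have ht := ht1.sub ht2
  refine (ht.congr fun x => (hrec x).symm).mono_right (le_of_eq (congrArg 𝓝 ?_))
  change _ = L (s + 1)
  rcases lt_trichotomy s k with hsk | rfl | hsk
  · rw [if_neg (by omega), Finset.sum_eq_zero]
    · simp only [hL]
      rw [if_neg (by omega)]; simp
    · intro j hj
      rw [Finset.mem_Icc] at hj
      simp only [hL]
      rw [if_neg (by omega), mul_zero]
  · rw [if_pos le_rfl, Finset.sum_eq_zero]
    · simp [hL]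
    · intro j hj
      rw [Finset.mem_Icc] at hj
      simp only [hL]
      rw [if_neg (by omega), mul_zero]
  · rw [if_pos hsk.le, Finset.sum_eq_single_of_mem (k + 1) (Finset.mem_Icc.2 ⟨by omega, by omega⟩)]
    · simp only [hL, if_true]
      rw [if_neg (by omega)]
      obtain ⟨m, rfl⟩ : ∃ m, s = k + m := ⟨s - k, by omega⟩
      rw [show k + m - k = m by omega, show k + m + 1 - (k + 1) = m by omega,
        esym_of_eq (fun i hi => h i (Finset.mem_sdiff.1 hi).1),
        eTilde_of_eq h (by omega), Finset.card_sdiff_of_subset hS, hk,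
        show k + m + 1 = m + (k + 1) by omega, ← Nat.sub_add_cancel hkH]
      set q := H.card - (k + 1)
      -- Splitting the falling factorial after k + 1 factors matches the binomial coefficient of e_m
      -- on the q nodes outside S with the m! in ẽ_m.
      have hd : (q + (k + 1)).descFactorial (m + (k + 1)) =
          (q + (k + 1)).descFactorial (k + 1) * (m.factorial * q.choose m) := by
        rw [← Nat.descFactorial_eq_factorial_mul_choose, add_comm m,
          ← Nat.descFactorial_mul_descFactorial (n := q + (k + 1)) (Nat.le_add_right (k + 1) m)]
        rw [show q + (k + 1) - (k + 1) = q by omega, show k + 1 + m - (k + 1) = m by omega]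
        ring
      rw [Nat.add_sub_cancel, hd]
      have hq : m ≤ q := by omega
      have e1 : ((q.choose m : ℕ) : ℝ) ≠ 0 := by
        rw [Nat.cast_ne_zero]; exact (Nat.choose_pos hq).ne'
      have e2 : (((q + (k + 1)).descFactorial (k + 1) : ℕ) : ℝ) ≠ 0 := by
        rw [Nat.cast_ne_zero]; exact (Nat.descFactorial_pos.2 (by omega)).ne'
      have e3 : ((m.factorial : ℕ) : ℝ) ≠ 0 := by positivity
      push_cast
      field_simp
      ring
    · intro j hj hjk
      simp only [hL]
      rw [if_neg hjk, mul_zero]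

lemma fderiv_uHat (H : Finset (Fin N)) (r : ℕ) (x v : Fin N → ℝ) :
    fderiv ℝ (uHat H r) x v = (H.card.descFactorial r : ℝ) * fderiv ℝ (u H r) x v := by
  have : uHat H r = fun x => (H.card.descFactorial r : ℝ) * u H r x := rfl
  rw [this, fderiv_const_mul ((contDiff_u H r (m := 1)).differentiable (by simp) x)]
  rfl

lemma tendsto_gradDivDiff_uHat {H : Finset (Fin N)} {x₀ : Fin N → ℝ} {y : ℝ}
    (h : ∀ i ∈ H, x₀ i = y) {k : ℕ} {S : Finset (Fin N)} (hS : S ⊆ H) (hk : S.card = k + 1)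
    {r : ℕ} (h1 : 1 ≤ r) (hr : r ≤ H.card) :
    Tendsto (gradDivDiff S (uHat H r)) (𝓝[{x | Function.Injective x}] x₀)
      (𝓝 (if r = k + 1 then (-1 : ℝ) ^ k else 0)) := by
  have h2 : gradDivDiff S (uHat H r) = fun x =>
      (H.card.descFactorial r : ℝ) * gradDivDiff S (u H r) x := by
    funext x
    simp only [gradDivDiff, divDiff, fderiv_uHat, Finset.mul_sum, mul_div_assoc]
  rw [h2]
  refine ((tendsto_gradDivDiff_u h hS hk h1 hr).const_mul _).mono_right
    (le_of_eq (congrArg 𝓝 ?_))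
  split_ifs with hrk
  · subst hrk
    have : (H.card.descFactorial (k + 1) : ℝ) ≠ 0 := by
      rw [Nat.cast_ne_zero]; exact (Nat.descFactorial_pos.2 hr).ne'
    field_simp
  · simp

/-- The solution of a linear system whose matrix tends to a diagonal matrix of signs. -/
lemma tendsto_of_linear_system {X : Type*} {l : Filter X} {n : ℕ}
    {A : X → Fin n → Fin n → ℝ} {g c : X → Fin n → ℝ} {g₀ : Fin n → ℝ}
    (hA : ∀ k j, Tendsto (fun x => A x k j) l (𝓝 (if j = k then (-1 : ℝ) ^ (k : ℕ) else 0)))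
    (hg : ∀ k, Tendsto (fun x => g x k) l (𝓝 (g₀ k)))
    (hc : ∀ᶠ x in l, ∀ k, g x k = ∑ j, c x j * A x k j) (j : Fin n) :
    Tendsto (fun x => c x j) l (𝓝 ((-1 : ℝ) ^ (j : ℕ) * g₀ j)) := by
  set D : Matrix (Fin n) (Fin n) ℝ := Matrix.diagonal fun k => (-1 : ℝ) ^ (k : ℕ) with hD
  have hdet : D.det ≠ 0 := by
    rw [hD, Matrix.det_diagonal]
    exact Finset.prod_ne_zero_iff.2 fun k _ => pow_ne_zero _ (by norm_num)
  have hAD : Tendsto (fun x => (Matrix.of (A x))) l (𝓝 D) := by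
    refine tendsto_pi_nhds.2 fun k => tendsto_pi_nhds.2 fun j => ?_
    have := hA k j
    rw [hD, Matrix.diagonal_apply]
    simp only [eq_comm (a := k)]
    exact this
  have hdetc : Tendsto (fun x => (Matrix.of (A x)).det) l (𝓝 D.det) :=
    (continuous_id.matrix_det.tendsto D).comp hAD
  have hadj : Tendsto (fun x => (Matrix.of (A x)).adjugate) l (𝓝 D.adjugate) :=
    (continuous_id.matrix_adjugate.tendsto D).comp hAD
  -- Cramer's rule: determinant and adjugate are continuous, and invertibility is needed only
  -- eventually.
  have hsol : Tendsto (fun x => ((Matrix.of (A x)).det)⁻¹ • (Matrix.of (A x)).adjugate.mulVec (g x))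
      l (𝓝 ((D.det)⁻¹ • D.adjugate.mulVec g₀)) := by
    refine (hdetc.inv₀ hdet).smul (tendsto_pi_nhds.2 fun k => ?_)
    simp only [Matrix.mulVec, dotProduct]
    exact tendsto_finsetSum _ fun j _ =>
      (tendsto_pi_nhds.1 (tendsto_pi_nhds.1 hadj k) j).mul (hg j)
  have heq : ∀ (B : Matrix (Fin n) (Fin n) ℝ) (w : Fin n → ℝ), B.det ≠ 0 →
      (B.det)⁻¹ • B.adjugate.mulVec (B.mulVec w) = w := by
    intro B w hB
    rw [Matrix.mulVec_mulVec, Matrix.adjugate_mul, Matrix.smul_mulVec, Matrix.one_mulVec,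
      smul_smul, inv_mul_cancel₀ hB, one_smul]
  have hlim : (D.det)⁻¹ • D.adjugate.mulVec g₀ = fun k : Fin n => (-1 : ℝ) ^ (k : ℕ) * g₀ k := by
    have : g₀ = D.mulVec fun k : Fin n => (-1 : ℝ) ^ (k : ℕ) * g₀ k := by
      funext k
      rw [hD, Matrix.mulVec_diagonal, ← mul_assoc, ← mul_pow]
      simp
    conv_lhs => rw [this]
    exact heq D _ hdet
  rw [hlim] at hsol
  refine (tendsto_pi_nhds.1 hsol j).congr' ?_
  filter_upwards [hc, hdetc.eventually_ne hdet] with x hx hne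
  have : g x = (Matrix.of (A x)).mulVec (c x) := by
    funext k
    rw [hx k, Matrix.mulVec, dotProduct]
    exact Finset.sum_congr rfl fun j _ => mul_comm _ _
  rw [this, heq _ _ hne]

/-! ### The derivative of the coordinate map -/

lemma prod_sub_eq_sum_esym (H : Finset (Fin N)) (x : Fin N → ℝ) (z : ℝ) :
    ∏ i ∈ H, (z - x i) =
      ∑ r ∈ Finset.range (H.card + 1), (-1 : ℝ) ^ r * (esym H r x * z ^ (H.card - r)) := by
  have h := congrArg (Polynomial.eval z) (Multiset.prod_X_sub_X_eq_sum_esymm (H.val.map x))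
  rw [Polynomial.eval_multiset_prod, Multiset.map_map, Multiset.map_map, Multiset.card_map,
    Finset.card_val, Polynomial.eval_finsetSum] at h
  have h1 : ∏ i ∈ H, (z - x i) = (H.val.map ((Polynomial.eval z ∘ fun t => Polynomial.X -
      Polynomial.C t) ∘ x)).prod := by
    rw [Finset.prod]
    exact congrArg _ (Multiset.map_congr rfl fun i _ => by simp)
  rw [h1]
  refine h.trans (Finset.sum_congr rfl fun r _ => ?_)
  simp [esym]

/-- If all coordinates are stationary along v, so is ∏ (z - x_l) for every fixed z. At z = x_i its
derivative reduces to -v_i ∏_{l ≠ i} (x_i - x_l), whose product is nonzero. -/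
lemma eq_zero_of_fderiv_uHat_eq_zero {H : Finset (Fin N)} {x v : Fin N → ℝ}
    (hx : Function.Injective x)
    (h : ∀ r, 1 ≤ r → r ≤ H.card → fderiv ℝ (uHat H r) x v = 0) {i : Fin N} (hi : i ∈ H) :
    v i = 0 := by
  have hu : ∀ r, 1 ≤ r → r ≤ H.card → fderiv ℝ (u H r) x v = 0 := by
    intro r h1 hr
    have := h r h1 hr
    rw [fderiv_uHat] at this
    refine (mul_eq_zero.1 this).resolve_left ?_
    exact_mod_cast (Nat.descFactorial_pos.2 hr).ne'
  have he : ∀ r, r ≤ H.card → fderiv ℝ (esym H r) x v = 0 := by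
    intro r hr
    have h1 : fderiv ℝ (eTilde H r) x v = 0 := by
      rw [fderiv_eTilde_eq_sum]
      refine Finset.sum_eq_zero fun j hj => ?_
      rw [Finset.mem_Icc] at hj
      rw [hu j hj.1 (by omega), mul_zero]
    rw [fderiv_eTilde, div_eq_zero_iff] at h1
    refine h1.resolve_right ?_
    exact_mod_cast (Nat.descFactorial_pos.2 hr).ne'
  have hd1 : HasDerivAt (fun t : ℝ => ∏ l ∈ H, (x i - (x + t • v) l)) 0 0 := by
    have h1 : ∀ r ∈ Finset.range (H.card + 1), HasDerivAt
        (fun t : ℝ => (-1 : ℝ) ^ r * (esym H r (x + t • v) * x i ^ (H.card - r))) 0 0 := by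
      intro r hr
      have h2 : HasDerivAt (fun t : ℝ => esym H r (x + t • v)) (fderiv ℝ (esym H r) x v) 0 :=
        ((contDiff_esym H r (m := 1)).differentiable (by simp) x).hasFDerivAt.hasLineDerivAt v
      rw [he r (by have := Finset.mem_range.1 hr; omega)] at h2
      simpa using (h2.mul_const (x i ^ (H.card - r))).const_mul ((-1 : ℝ) ^ r)
    have h3 := HasDerivAt.fun_sum h1
    simp only [prod_sub_eq_sum_esym]
    simpa using h3
  have hd2 : HasDerivAt (fun t : ℝ => ∏ l ∈ H, (x i - (x + t • v) l))
      (∑ m ∈ H, (∏ l ∈ H.erase m, (x i - (x + (0 : ℝ) • v) l)) • (-v m)) 0 := by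
    refine HasDerivAt.fun_finsetProd fun l _ => ?_
    have h1 : HasDerivAt (fun t : ℝ => x i - (x l + t * v l)) (-(1 * v l)) 0 :=
      (((hasDerivAt_id (0 : ℝ)).mul_const (v l)).const_add (x l)).const_sub (x i)
    simpa using h1
  have h3 := hd2.unique hd1
  rw [Finset.sum_eq_single_of_mem i hi] at h3
  · have h4 : ∏ l ∈ H.erase i, (x i - (x + (0 : ℝ) • v) l) ≠ 0 := by
      refine Finset.prod_ne_zero_iff.2 fun l hl => ?_
      simp only [zero_smul, add_zero]
      exact sub_ne_zero.2 fun h => Finset.ne_of_mem_erase hl (hx h).symm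
    exact neg_eq_zero.1 ((smul_eq_zero.1 h3).resolve_left h4)
  · intro m _ hm
    rw [Finset.prod_eq_zero (Finset.mem_erase.2 ⟨hm.symm, hi⟩) (by simp), zero_smul]

/-- The sum of squares of the deviations, in terms of the coordinates. -/
lemma sum_sq_sub_eq {H : Finset (Fin N)} (hH : H.Nonempty) (x : Fin N → ℝ) (y : ℝ) :
    ∑ i ∈ H, (x i - y) ^ 2 =
      (uHat H 1 x - H.card * y) ^ 2 / H.card - 2 * uHat H 2 x := by
  have hn : (H.card : ℝ) ≠ 0 := by
    rw [Nat.cast_ne_zero]; exact (Finset.card_pos.2 hH).ne'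
  have n1 := newton_eTilde H x (r := 1) le_rfl
  have n2 := newton_eTilde H x (r := 2) (by norm_num)
  have s1 : esym H 1 x = ∑ i ∈ H, x i := by
    rw [esym_eq_sum, Finset.powersetCard_one, Finset.sum_map]
    simp
  have s2 : ∑ i ∈ H, x i ^ 2 = esym H 1 x ^ 2 - 2 * esym H 2 x := by
    have h1 := sum_esym_erase H 1 x
    have h2 : ∀ i ∈ H, x i * esym (H.erase i) 1 x = x i * esym H 1 x - x i ^ 2 := by
      intro i hi
      rw [esym_eq_erase hi 0 x, esym_zero]; ring
    have h3 : ∑ i ∈ H, x i * esym (H.erase i) 1 x = 2 * esym H 2 x := by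
      have h4 : ∀ i ∈ H, x i * esym (H.erase i) 1 x = esym H 2 x - esym (H.erase i) 2 x := by
        intro i hi
        rw [esym_eq_erase hi 1 x]; ring
      rw [Finset.sum_congr rfl h4, Finset.sum_sub_distrib, sum_esym_erase, Finset.sum_const,
        nsmul_eq_mul]
      push_cast; ring
    rw [Finset.sum_congr rfl h2, Finset.sum_sub_distrib, ← Finset.sum_mul, ← s1] at h3
    linarith
  have e1 := esym_eq H 1 x
  have e2 := esym_eq H 2 x
  simp only [Finset.Icc_self, Finset.sum_singleton, Nat.sub_self, eTilde_zero, Nat.cast_one,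
    one_mul, mul_one] at n1
  rw [Finset.sum_Icc_succ_top (by norm_num)] at n2
  simp only [Finset.Icc_self, Finset.sum_singleton, Nat.sub_self, eTilde_zero] at n2
  have c2 : (H.card.descFactorial 2 : ℝ) = H.card * (H.card - 1) := by
    rw [Nat.descFactorial_succ, Nat.descFactorial_one, Nat.cast_mul, Nat.cast_sub
      (Finset.card_pos.2 hH)]
    push_cast; ring
  have : ∑ i ∈ H, (x i - y) ^ 2 = ∑ i ∈ H, x i ^ 2 - 2 * y * ∑ i ∈ H, x i + H.card * y ^ 2 := by
    simp only [sub_sq, Finset.sum_add_distrib, Finset.sum_sub_distrib, Finset.sum_const,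
      nsmul_eq_mul, Finset.mul_sum]
    congr 2
    exact Finset.sum_congr rfl fun i _ => by ring
  rw [this, s2, ← s1, uHat, uHat, e1, e2, c2, Nat.descFactorial_one]
  norm_num at n2
  rw [n1] at n2 ⊢
  field_simp
  linear_combination (-((H.card : ℝ) - 1)) * n2

/-! ### Trace functions -/

/-- No regularity of f is assumed: w i * f inherits it from φ, and if w i = 0 both sides vanish. -/
lemma fderiv_single_of_eventuallyEq_sum {φ : (Fin N → ℝ) → ℝ} {f : ℝ → ℝ} {w z : Fin N → ℝ}
    (hd : DifferentiableAt ℝ φ z) (h : ∀ᶠ x in 𝓝 z, φ x = ∑ i, w i * f (x i)) (i : Fin N) :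
    fderiv ℝ φ z (Pi.single i 1) = w i * deriv f (z i) := by
  have h1 : HasDerivAt (fun t : ℝ => φ (z + t • Pi.single i (1 : ℝ)))
      (fderiv ℝ φ z (Pi.single i 1)) 0 := hd.hasFDerivAt.hasLineDerivAt _
  have hc : Tendsto (fun t : ℝ => z + t • (Pi.single i (1 : ℝ) : Fin N → ℝ)) (𝓝 0) (𝓝 z) := by
    have : Continuous (fun t : ℝ => z + t • (Pi.single i (1 : ℝ) : Fin N → ℝ)) := by fun_prop
    simpa using this.tendsto 0
  have h2 : (fun t : ℝ => φ (z + t • Pi.single i (1 : ℝ))) =ᶠ[𝓝 0] fun t =>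
      w i * f (t + z i) + ∑ l ∈ Finset.univ.erase i, w l * f (z l) := by
    filter_upwards [hc.eventually h] with t ht
    rw [ht, ← Finset.add_sum_erase _ _ (Finset.mem_univ i)]
    congr 1
    · simp [add_comm]
    · refine Finset.sum_congr rfl fun l hl => ?_
      simp [Finset.ne_of_mem_erase hl]
  have h3 : HasDerivAt (fun t : ℝ => w i * f (t + z i)) (fderiv ℝ φ z (Pi.single i 1)) 0 := by
    simpa using (h2.hasDerivAt_iff.1 h1).sub_const (∑ l ∈ Finset.univ.erase i, w l * f (z l))
  rw [← h3.deriv, deriv_const_mul_field, deriv_comp_add_const, zero_add]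

lemma fderiv_apply_eq_sum (φ : (Fin N → ℝ) → ℝ) (z v : Fin N → ℝ) :
    fderiv ℝ φ z v = ∑ i, v i * fderiv ℝ φ z (Pi.single i 1) := by
  conv_lhs => rw [← Finset.univ_sum_single v, map_sum]
  refine Finset.sum_congr rfl fun i _ => ?_
  rw [← smul_eq_mul, ← map_smul, ← Pi.single_smul, smul_eq_mul, mul_one]

/-- The weights w are there for the induction: a directional derivative of such a sum is a sum of
the same shape for f', with weights multiplied by the entries of the direction. -/
lemma iteratedFDeriv_of_eventuallyEq_sum {x₀ : Fin N → ℝ} {g : ℕ} {φ : (Fin N → ℝ) → ℝ}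
    {f : ℝ → ℝ} {w : Fin N → ℝ} (hφ : ContDiffAt ℝ g φ x₀)
    (h : ∀ᶠ x in 𝓝 x₀, φ x = ∑ i, w i * f (x i)) (v : Fin g → Fin N → ℝ) :
    iteratedFDeriv ℝ g φ x₀ v = ∑ i, w i * (∏ q, v q i) * iteratedDeriv g f (x₀ i) := by
  induction g generalizing φ f w with
  | zero => simp [h.self_of_nhds]
  | succ g ih =>
    rw [iteratedFDeriv_succ_snoc hφ]
    have h1 : ∀ᶠ x in 𝓝 x₀, fderiv ℝ φ x (v (Fin.last g)) =
        ∑ i, (w i * v (Fin.last g) i) * deriv f (x i) := by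
      filter_upwards [h.eventually_nhds, hφ.eventually (by simp)] with z hz hdz
      rw [fderiv_apply_eq_sum]
      refine Finset.sum_congr rfl fun i _ => ?_
      rw [fderiv_single_of_eventuallyEq_sum (hdz.differentiableAt (by simp)) hz]
      ring
    rw [ih ((hφ.fderiv_right (m := g) (by simp)).clm_apply contDiffAt_const) h1]
    refine Finset.sum_congr rfl fun i _ => ?_
    rw [iteratedDeriv_succ', Fin.prod_univ_castSucc]
    simp only [Fin.init]
    ring

/-- The first vector is supported at a 0, and all later ones have entry 1 there, so one term of the
diagonal form survives. -/
lemma iteratedFDeriv_helmert_of_eventuallyEq_sum {x₀ : Fin N → ℝ} {φ : (Fin N → ℝ) → ℝ}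
    {f : ℝ → ℝ} {a : ℕ → Fin N} {n k : ℕ} (ha : Set.InjOn a (Finset.range n)) (hk : k < n)
    (hφ : ContDiffAt ℝ (k + 1 : ℕ) φ x₀) (h : ∀ᶠ x in 𝓝 x₀, φ x = ∑ i, f (x i)) :
    iteratedFDeriv ℝ (k + 1) φ x₀ (fun q => helmert a q) = iteratedDeriv (k + 1) f (x₀ (a 0)) := by
  rw [iteratedFDeriv_of_eventuallyEq_sum (w := fun _ => 1) (f := f) hφ (by simpa using h),
    Finset.sum_eq_single_of_mem (a 0) (Finset.mem_univ _)]
  · rw [Finset.prod_eq_one, one_mul, one_mul]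
    intro q _
    rcases Nat.eq_zero_or_pos (q : ℕ) with hq | hq
    · simp [hq, helmert]
    · exact helmert_apply_lt ha (by have := q.2; omega) hq
  · intro i _ hi
    rw [Finset.prod_eq_zero (Finset.mem_univ (0 : Fin (k + 1))), mul_zero, zero_mul]
    simp [helmert, hi]

/-! ### The coordinate map -/

section Blocks
variable {M : ℕ} {x₀ : Fin N → ℝ} {H : Fin M → Finset (Fin N)} {y : Fin M → ℝ}

lemma contDiff_coords {m : WithTop ℕ∞} : ContDiff ℝ m (coords H) :=
  contDiff_pi.2 fun p => contDiff_uHat (H p.1) (p.2 + 1)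

lemma hasFDerivAt_coords (x : Fin N → ℝ) : HasFDerivAt (coords H) (fderiv ℝ (coords H) x) x :=
  ((contDiff_coords (m := 1)).differentiable (by simp) x).hasFDerivAt

lemma fderiv_coords_apply (x v : Fin N → ℝ) (p : Idx H) :
    fderiv ℝ (coords H) x v p = fderiv ℝ (uHat (H p.1) (p.2 + 1)) x v := by
  have h := (hasFDerivAt_pi'.1 (hasFDerivAt_coords (H := H) x) p).fderiv
  exact (congrArg (fun L => L v) h).symm

lemma mem_block_iff (hcover : ∀ i, ∃ α, i ∈ H α) (hval : ∀ α, ∀ i ∈ H α, x₀ i = y α)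
    (hy : Function.Injective y) {i : Fin N} {α : Fin M} : i ∈ H α ↔ x₀ i = y α := by
  refine ⟨hval α i, fun h => ?_⟩
  obtain ⟨β, hβ⟩ := hcover i
  have : β = α := hy ((hval β i hβ).symm.trans h)
  exact this ▸ hβ

lemma card_idx (hcover : ∀ i, ∃ α, i ∈ H α) (hval : ∀ α, ∀ i ∈ H α, x₀ i = y α)
    (hy : Function.Injective y) : Fintype.card (Idx H) = N := by
  rw [Fintype.card_sigma]
  simp only [Fintype.card_fin]
  have h1 : (Finset.univ : Finset (Fin N)) = Finset.univ.biUnion H := by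
    ext i
    simpa using hcover i
  rw [← Finset.card_biUnion, ← h1, Finset.card_univ, Fintype.card_fin]
  intro α _ β _ hne
  refine Finset.disjoint_left.2 fun i h h' => hne (hy ?_)
  rw [← hval α i h, ← hval β i h']

lemma injective_fderiv_coords (hcover : ∀ i, ∃ α, i ∈ H α) {x : Fin N → ℝ}
    (hx : Function.Injective x) : Function.Injective (fderiv ℝ (coords H) x) := by
  refine (injective_iff_map_eq_zero _).2 fun v hv => funext fun i => ?_
  obtain ⟨α, hα⟩ := hcover i
  refine eq_zero_of_fderiv_uHat_eq_zero hx (fun r h1 hr => ?_) hα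
  have h2 := congrFun hv ⟨α, ⟨r - 1, by omega⟩⟩
  rw [fderiv_coords_apply] at h2
  simpa [Nat.sub_add_cancel h1] using h2

/-- At points with pairwise distinct coordinates, a function on the space of coordinates is
differentiable if its composition with the coordinate map is. -/
lemma differentiableAt_of_comp_coords (hcover : ∀ i, ∃ α, i ∈ H α)
    (hval : ∀ α, ∀ i ∈ H α, x₀ i = y α) (hy : Function.Injective y) {x : Fin N → ℝ}
    (hx : Function.Injective x) {φ : (Fin N → ℝ) → ℝ} {ψ : (Idx H → ℝ) → ℝ}
    (h : ∀ᶠ z in 𝓝 x, φ z = ψ (coords H z)) (hφ : DifferentiableAt ℝ φ x) :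
    DifferentiableAt ℝ ψ (coords H x) := by
  have hfin : Module.finrank ℝ (Fin N → ℝ) = Module.finrank ℝ (Idx H → ℝ) := by
    rw [Module.finrank_fintype_fun_eq_card, Module.finrank_fintype_fun_eq_card, Fintype.card_fin,
      card_idx hcover hval hy]
  -- The derivative is injective between spaces of equal dimension, hence invertible, and the
  -- inverse function theorem expresses ψ locally as φ after a differentiable inverse.
  let e : (Fin N → ℝ) ≃L[ℝ] (Idx H → ℝ) :=
    (LinearEquiv.ofInjectiveOfFinrankEq (fderiv ℝ (coords H) x : (Fin N → ℝ) →ₗ[ℝ] (Idx H → ℝ))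
      (injective_fderiv_coords hcover hx) hfin).toContinuousLinearEquiv
  have he : (e : (Fin N → ℝ) →L[ℝ] (Idx H → ℝ)) = fderiv ℝ (coords H) x := by
    ext v; rfl
  have hst : HasStrictFDerivAt (coords H) (e : (Fin N → ℝ) →L[ℝ] (Idx H → ℝ)) x := by
    rw [he]
    exact (contDiff_coords (m := 1)).contDiffAt.hasStrictFDerivAt (by simp)
  have hinv := hst.to_localInverse.hasFDerivAt
  have hright := hst.eventually_right_inverse
  have hx' : hst.localInverse (coords H) e x (coords H x) = x := hst.localInverse_apply_image
  have hev : ψ =ᶠ[𝓝 (coords H x)] fun q => φ (hst.localInverse (coords H) e x q) := by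
    have hc := hinv.continuousAt.tendsto
    rw [hx'] at hc
    filter_upwards [hright, hc.eventually h] with q hq1 hq2
    rw [hq2, hq1]
  refine hev.differentiableAt_iff.2 ?_
  refine DifferentiableAt.comp (coords H x) (g := φ) ?_ hinv.differentiableAt
  rwa [hx']

lemma fderiv_eq_sum_coords {x : Fin N → ℝ} {φ : (Fin N → ℝ) → ℝ} {ψ : (Idx H → ℝ) → ℝ}
    (h : ∀ᶠ z in 𝓝 x, φ z = ψ (coords H z)) (hψ : DifferentiableAt ℝ ψ (coords H x))
    (v : Fin N → ℝ) :
    fderiv ℝ φ x v = ∑ p : Idx H, fderiv ℝ ψ (coords H x) (Pi.single p 1) *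
      fderiv ℝ (uHat (H p.1) (p.2 + 1)) x v := by
  have h1 : HasFDerivAt (fun z => ψ (coords H z))
      ((fderiv ℝ ψ (coords H x)).comp (fderiv ℝ (coords H) x)) x :=
    hψ.hasFDerivAt.comp x (hasFDerivAt_coords x)
  have h2 : φ =ᶠ[𝓝 x] fun z => ψ (coords H z) := h
  rw [h2.fderiv_eq, h1.fderiv, ContinuousLinearMap.comp_apply]
  conv_lhs => rw [← Finset.univ_sum_single (fderiv ℝ (coords H) x v), map_sum]
  refine Finset.sum_congr rfl fun p _ => ?_
  rw [← fderiv_coords_apply, mul_comm, ← smul_eq_mul, ← map_smul, ← Pi.single_smul, smul_eq_mul,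
    mul_one]

/-- Coordinates of other blocks do not depend on the variables with index in S, so the system
decouples into blocks. -/
lemma gradDivDiff_eq_sum_coords (hval : ∀ α, ∀ i ∈ H α, x₀ i = y α) (hy : Function.Injective y)
    {x : Fin N → ℝ} {φ : (Fin N → ℝ) → ℝ} {ψ : (Idx H → ℝ) → ℝ}
    (h : ∀ᶠ z in 𝓝 x, φ z = ψ (coords H z)) (hψ : DifferentiableAt ℝ ψ (coords H x))
    {α : Fin M} {S : Finset (Fin N)} (hS : S ⊆ H α) :
    gradDivDiff S φ x = ∑ j : Fin (H α).card, fderiv ℝ ψ (coords H x) (Pi.single ⟨α, j⟩ 1) *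
      gradDivDiff S (uHat (H α) (j + 1)) x := by
  unfold gradDivDiff
  rw [← divDiff_sum]
  refine divDiff_congr fun i hi => ?_
  rw [fderiv_eq_sum_coords h hψ, Fintype.sum_sigma, Finset.sum_eq_single_of_mem α
    (Finset.mem_univ _)]
  intro β _ hβ
  refine Finset.sum_eq_zero fun j _ => ?_
  rw [fderiv_eq_zero_of_congr (fun _ _ h => uHat_congr _ h) x
    ((contDiff_uHat _ _ (m := 1)).differentiable (by simp) x), mul_zero]
  intro hiβ
  exact hβ (hy ((hval β i hiβ).symm.trans (hval α i (hS hi))))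

/-- The coordinates determine the elementary symmetric functions of every block. -/
lemma esym_eq_of_coords_eq {x x' : Fin N → ℝ} (h : coords H x = coords H x') (α : Fin M) {r : ℕ}
    (hr : r ≤ (H α).card) : esym (H α) r x = esym (H α) r x' := by
  have hu : ∀ r, 1 ≤ r → r ≤ (H α).card → u (H α) r x = u (H α) r x' := by
    intro r h1 hr
    have h2 : uHat (H α) (r - 1 + 1) x = uHat (H α) (r - 1 + 1) x' :=
      congrFun h ⟨α, ⟨r - 1, by omega⟩⟩
    rw [Nat.sub_add_cancel h1] at h2
    refine mul_left_cancel₀ ?_ h2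
    exact_mod_cast (Nat.descFactorial_pos.2 hr).ne'
  have he : ∀ r, r ≤ (H α).card → eTilde (H α) r x = eTilde (H α) r x' := by
    intro r
    induction r using Nat.strong_induction_on with
    | _ r ih =>
    intro hr
    rcases Nat.eq_zero_or_pos r with rfl | h1
    · simp
    have hr0 : (r : ℝ) ≠ 0 := by positivity
    apply mul_left_cancel₀ hr0
    rw [newton_eTilde _ _ h1, newton_eTilde _ _ h1]
    refine Finset.sum_congr rfl fun j hj => ?_
    rw [Finset.mem_Icc] at hj
    rw [hu j hj.1 (by omega), ih (r - j) (by omega) (by omega)]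
  rw [esym_eq, esym_eq, he r hr]

/-- The coordinates fix the coefficients of ∏ (X - x_i), whose roots are the values with
multiplicity. -/
lemma map_eq_of_coords_eq {x x' : Fin N → ℝ} (h : coords H x = coords H x') (α : Fin M) :
    (H α).val.map x = (H α).val.map x' := by
  have hp : (((H α).val.map x).map fun t => Polynomial.X - Polynomial.C t).prod =
      (((H α).val.map x').map fun t => Polynomial.X - Polynomial.C t).prod := by
    rw [Multiset.prod_X_sub_X_eq_sum_esymm, Multiset.prod_X_sub_X_eq_sum_esymm]
    simp only [Multiset.card_map]
    refine Finset.sum_congr rfl fun r hr => ?_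
    have := esym_eq_of_coords_eq h α (r := r)
      (by have := Finset.mem_range.1 hr; rw [Finset.card_val] at this; omega)
    rw [esym, esym] at this
    rw [this]
  have := congrArg Polynomial.roots hp
  rwa [Polynomial.roots_multiset_prod_X_sub_C, Polynomial.roots_multiset_prod_X_sub_C] at this

/-- Points with the same coordinates differ by a permutation that preserves the blocks. -/
lemma exists_perm_of_coords_eq (hcover : ∀ i, ∃ α, i ∈ H α) (hval : ∀ α, ∀ i ∈ H α, x₀ i = y α)
    (hy : Function.Injective y) {x x' : Fin N → ℝ} (h : coords H x = coords H x') :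
    ∃ τ : Equiv.Perm (Fin N), (∀ i, x₀ (τ i) = x₀ i) ∧ x' ∘ τ = x := by
  -- Pairing x i with x₀ i tags each value by its block, so a permutation matching the pairs
  -- automatically preserves the blocks.
  have key : Finset.univ.val.map (fun i => (x₀ i, x i)) =
      Finset.univ.val.map (fun i => (x₀ i, x' i)) := by
    ext ⟨c, t⟩
    rw [Multiset.count_map, Multiset.count_map]
    by_cases hc : ∃ α, c = y α
    · obtain ⟨α, rfl⟩ := hc
      have h1 := congrArg (Multiset.count t) (map_eq_of_coords_eq h α)
      rw [Multiset.count_map, Multiset.count_map] at h1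
      have h2 : ∀ z : Fin N → ℝ, (Multiset.filter (fun i => (y α, t) = (x₀ i, z i))
          (Finset.univ : Finset (Fin N)).val) =
          Multiset.filter (fun i => t = z i) (H α).val := by
        intro z
        rw [← Finset.filter_val, ← Finset.filter_val]
        congr 1
        ext i
        simp only [Finset.mem_filter, Finset.mem_univ, true_and, Prod.mk.injEq,
          mem_block_iff hcover hval hy, eq_comm (a := y α)]
      rw [h2, h2, h1]
    · have h2 : ∀ z : Fin N → ℝ, (Multiset.filter (fun i => (c, t) = (x₀ i, z i))
          (Finset.univ : Finset (Fin N)).val) = 0 := by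
        intro z
        refine Multiset.filter_eq_nil.2 fun i _ hi => hc ?_
        obtain ⟨α, hα⟩ := hcover i
        exact ⟨α, (Prod.mk.inj hi).1.trans (hval α i hα)⟩
      rw [h2, h2]
  obtain ⟨τ, hτ⟩ := (map_univ_eq_iff_exists_perm _ _).1 key
  refine ⟨τ, fun i => ?_, funext fun i => ?_⟩
  · exact congrArg Prod.fst (congrFun hτ i)
  · exact congrArg Prod.snd (congrFun hτ i)

/-- The coordinate map is proper at `x₀`. -/
lemma tendsto_of_coords (hne : ∀ α, (H α).Nonempty) (hcover : ∀ i, ∃ α, i ∈ H α)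
    (hval : ∀ α, ∀ i ∈ H α, x₀ i = y α) :
    comap (coords H) (𝓝 (coords H x₀)) ≤ 𝓝 x₀ := by
  have hp : ∀ p : Idx H, Tendsto (fun x => uHat (H p.1) (p.2 + 1) x)
      (comap (coords H) (𝓝 (coords H x₀))) (𝓝 (uHat (H p.1) (p.2 + 1) x₀)) := by
    have h : Tendsto (coords H) (comap (coords H) (𝓝 (coords H x₀))) (𝓝 (coords H x₀)) :=
      tendsto_comap
    exact fun p => (tendsto_pi_nhds.1 h) p
  have hr : ∀ α r, 1 ≤ r → Tendsto (fun x => uHat (H α) r x)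
      (comap (coords H) (𝓝 (coords H x₀))) (𝓝 (uHat (H α) r x₀)) := by
    intro α r h1
    rcases le_or_gt r (H α).card with h | h
    · have := hp ⟨α, ⟨r - 1, by omega⟩⟩
      simpa only [Nat.sub_add_cancel h1] using this
    -- For a block with one element û_2 is not among the coordinates, but it vanishes identically.
    · have : ∀ x, uHat (H α) r x = 0 := fun x => by
        rw [uHat, Nat.descFactorial_of_lt h]; simp
      simp only [this]
      exact tendsto_const_nhds
  refine tendsto_id'.1 (tendsto_pi_nhds.2 fun i => ?_)
  obtain ⟨α, hα⟩ := hcover i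
  -- This sum of squares is a continuous function of û_1 and û_2 alone and vanishes at x₀, so it
  -- controls every coordinate of the block.
  have hsum : Tendsto (fun x : Fin N → ℝ => ∑ l ∈ H α, (x l - y α) ^ 2)
      (comap (coords H) (𝓝 (coords H x₀))) (𝓝 0) := by
    have h0 : ∑ l ∈ H α, (x₀ l - y α) ^ 2 = 0 :=
      Finset.sum_eq_zero fun l hl => by rw [hval α l hl]; ring
    rw [← h0]
    simp only [sum_sq_sub_eq (hne α)]
    exact ((((hr α 1 le_rfl).sub_const _).pow 2).div_const _).sub ((hr α 2 (by norm_num)).const_mul 2)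
  have hsq : Tendsto (fun x : Fin N → ℝ => (x i - y α) ^ 2)
      (comap (coords H) (𝓝 (coords H x₀))) (𝓝 0) :=
    squeeze_zero (fun x => sq_nonneg _) (fun x => Finset.single_le_sum
      (f := fun l => (x l - y α) ^ 2) (fun l _ => sq_nonneg _) hα) hsum
  have habs : Tendsto (fun x : Fin N → ℝ => |x i - y α|)
      (comap (coords H) (𝓝 (coords H x₀))) (𝓝 0) := by
    have := (Real.continuous_sqrt.tendsto 0).comp hsq
    simpa only [Function.comp_def, Real.sqrt_sq_eq_abs, Real.sqrt_zero] using this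
  have hsub := (tendsto_zero_iff_abs_tendsto_zero _).2 habs
  have := hsub.add_const (y α)
  rw [hval α i hα]
  simpa using this

/-- Subtracting the common value c changes only `u` of degree 1, and what remains is homogeneous of
degree r. -/
lemma uHat_segment {J : Finset (Fin N)} {c : ℝ} (hc : ∀ i ∈ J, x₀ i = c) {r : ℕ} (h1 : 1 ≤ r)
    (hr : r ≤ J.card) (x : Fin N → ℝ) (s : ℝ) :
    uHat J r (x₀ + s • (x - x₀)) = uHat J r x₀ + s ^ r * (uHat J r x - uHat J r x₀) := by
  have key : ∀ s : ℝ, u J r (x₀ + s • (x - x₀)) =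
      s ^ r * u J r (fun i => x i - c) + if r = 1 then c else 0 := by
    intro s
    rw [← u_smul, ← u_add_const h1 hr]
    refine u_congr r fun i hi => ?_
    simp only [Pi.add_apply, Pi.smul_apply, Pi.sub_apply, smul_eq_mul, hc i hi]
    ring
  have k0 := key 0
  have k1 := key 1
  rw [zero_smul, add_zero, zero_pow (by omega), zero_mul, zero_add] at k0
  rw [one_smul, add_sub_cancel, one_pow, one_mul] at k1
  rw [uHat, uHat, uHat, key s, k0, k1]
  ring

end Blocks

/-! ### The mean value estimate on power curves. -/

/-- A mean value estimate along the curve `s ↦ q₀ + (s ^ (m p + 1) * w p)_p`. -/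
lemma abs_sub_sub_sum_le_of_powerCurve {ι : Type*} [Fintype ι] [DecidableEq ι]
    {ψ : (ι → ℝ) → ℝ} {m : ι → ℕ} {q₀ w L : ι → ℝ} {ε : ℝ} (hε : 0 ≤ ε)
    (hc : ContinuousOn (fun s : ℝ => ψ fun p => q₀ p + s ^ (m p + 1) * w p) (Set.Icc 0 1))
    (hd : ∀ s ∈ Set.Ioo (0 : ℝ) 1, DifferentiableAt ℝ ψ (fun p => q₀ p + s ^ (m p + 1) * w p))
    (hL : ∀ s ∈ Set.Ioo (0 : ℝ) 1, ∀ p,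
      |fderiv ℝ ψ (fun p => q₀ p + s ^ (m p + 1) * w p) (Pi.single p 1) - L p| ≤ ε) :
    |ψ (q₀ + w) - ψ q₀ - ∑ p, L p * w p| ≤ ε * (∑ p, ((m p : ℝ) + 1)) * ‖w‖ := by
  have hγ : ∀ s : ℝ, HasDerivAt (fun s : ℝ => fun p => q₀ p + s ^ (m p + 1) * w p)
      (fun p => ((m p : ℝ) + 1) * s ^ m p * w p) s := by
    intro s
    refine hasDerivAt_pi.2 fun p => ?_
    have := ((hasDerivAt_pow (m p + 1) s).mul_const (w p)).const_add (q₀ p)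
    simpa using this
  have hderiv : ∀ s ∈ Set.Ioo (0 : ℝ) 1,
      HasDerivAt (fun s : ℝ => (ψ fun p => q₀ p + s ^ (m p + 1) * w p) -
        ∑ p, L p * (q₀ p + s ^ (m p + 1) * w p))
      (∑ p, (fderiv ℝ ψ (fun p => q₀ p + s ^ (m p + 1) * w p) (Pi.single p 1) - L p) *
        (((m p : ℝ) + 1) * s ^ m p * w p)) s := by
    intro s hs
    have h1 := (hd s hs).hasFDerivAt.comp_hasDerivAt s (hγ s)
    have h2 : HasDerivAt (fun s : ℝ => ∑ p, L p * (q₀ p + s ^ (m p + 1) * w p))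
        (∑ p, L p * (((m p : ℝ) + 1) * s ^ m p * w p)) s :=
      HasDerivAt.fun_sum fun p _ => (hasDerivAt_pi.1 (hγ s) p).const_mul (L p)
    have h3 := h1.sub h2
    refine h3.congr_deriv ?_
    conv_lhs => rw [← Finset.univ_sum_single (fun p => ((m p : ℝ) + 1) * s ^ m p * w p), map_sum]
    rw [← Finset.sum_sub_distrib]
    refine Finset.sum_congr rfl fun p _ => ?_
    rw [sub_mul]
    congr 1
    have e : ∀ t : ℝ, (Pi.single p t : ι → ℝ) = t • Pi.single p 1 := fun t => by
      rw [← Pi.single_smul, smul_eq_mul, mul_one]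
    rw [e, map_smul, smul_eq_mul, mul_comm]
  have hcont : ContinuousOn (fun s : ℝ => (ψ fun p => q₀ p + s ^ (m p + 1) * w p) -
        ∑ p, L p * (q₀ p + s ^ (m p + 1) * w p)) (Set.Icc 0 1) :=
    hc.sub (by fun_prop)
  -- The mean value theorem needs only continuity at the endpoints, so differentiability of ψ at q₀
  -- is not required. The velocity of the curve is bounded by (m p + 1) ‖w‖ in each component.
  obtain ⟨s, hs, h⟩ := exists_hasDerivAt_eq_slope _ _ zero_lt_one hcont hderiv
  have e : ψ (q₀ + w) - ψ q₀ - ∑ p, L p * w p =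
      ∑ p, (fderiv ℝ ψ (fun p => q₀ p + s ^ (m p + 1) * w p) (Pi.single p 1) - L p) *
        (((m p : ℝ) + 1) * s ^ m p * w p) := by
    rw [h]
    simp only [one_pow, one_mul, sub_zero, div_one, ne_eq, Nat.succ_ne_zero, not_false_eq_true,
      zero_pow, zero_mul, add_zero, mul_add, Finset.sum_add_distrib]
    have : (fun p => q₀ p + w p) = q₀ + w := rfl
    rw [this]
    ring
  rw [e, Finset.mul_sum, Finset.sum_mul]
  refine (Finset.abs_sum_le_sum_abs _ _).trans (Finset.sum_le_sum fun p _ => ?_)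
  have h1 := hL s hs p
  have h2 : |((m p : ℝ) + 1) * s ^ m p * w p| ≤ ((m p : ℝ) + 1) * ‖w‖ := by
    rw [abs_mul, abs_mul, abs_of_nonneg (by positivity : (0 : ℝ) ≤ (m p : ℝ) + 1), mul_assoc]
    refine mul_le_mul_of_nonneg_left ?_ (by positivity)
    rw [abs_pow, abs_of_pos hs.1]
    have h3 : s ^ m p ≤ 1 := pow_le_one₀ hs.1.le hs.2.le
    have h4 : |w p| ≤ ‖w‖ := norm_le_pi_norm w p
    calc s ^ m p * |w p| ≤ 1 * ‖w‖ := mul_le_mul h3 h4 (abs_nonneg _) zero_le_one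
      _ = ‖w‖ := one_mul _
  rw [abs_mul, mul_assoc ε]
  exact mul_le_mul h1 h2 (abs_nonneg _) hε

/-! ### Invariant functions near the point and their representing functions. -/

section Local
variable {M : ℕ} {x₀ : Fin N → ℝ} {H : Fin M → Finset (Fin N)} {y : Fin M → ℝ}
  {φ : (Fin N → ℝ) → ℝ}

lemma contDiffAt_one_of_blocks (hne : ∀ α, (H α).Nonempty) (hcover : ∀ i, ∃ α, i ∈ H α)
    (hφ : ∀ α, ContDiffAt ℝ ((H α).card : ℕ) φ x₀) : ContDiffAt ℝ 1 φ x₀ := by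
  rcases isEmpty_or_nonempty (Fin N) with hN | ⟨⟨i⟩⟩
  -- For N = 0 there is no block to provide regularity, but the domain is a single point.
  · have : φ = fun _ => φ x₀ := funext fun x => congrArg φ (Subsingleton.elim _ _)
    rw [this]
    exact contDiffAt_const
  · obtain ⟨α, _⟩ := hcover i
    exact (hφ α).of_le (by exact_mod_cast (hne α).card_pos)

lemma exists_ball_invariant_contDiffOn
    (hsymm : ∀ τ : Equiv.Perm (Fin N), (∀ i, x₀ (τ i) = x₀ i) →
      ∀ᶠ x in 𝓝 x₀, φ (x ∘ τ) = φ x)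
    (hφ : ∀ α, ContDiffAt ℝ ((H α).card : ℕ) φ x₀) :
    ∃ ρ > 0, (∀ α, ContDiffOn ℝ ((H α).card : ℕ) φ (Metric.ball x₀ ρ)) ∧
      ∀ τ : Equiv.Perm (Fin N), (∀ i, x₀ (τ i) = x₀ i) →
        ∀ x ∈ Metric.ball x₀ ρ, φ (x ∘ τ) = φ x := by
  have h1 : ∀ᶠ x in 𝓝 x₀, ∀ α, ContDiffAt ℝ ((H α).card : ℕ) φ x :=
    eventually_all.2 fun α => (hφ α).eventually (by simp)
  have h2 : ∀ᶠ x in 𝓝 x₀, ∀ τ : Equiv.Perm (Fin N), (∀ i, x₀ (τ i) = x₀ i) →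
      φ (x ∘ τ) = φ x :=
    eventually_all.2 fun τ => by
      by_cases h : ∀ i, x₀ (τ i) = x₀ i
      · exact (hsymm τ h).mono fun x hx _ => hx
      · exact Eventually.of_forall fun x hx => absurd hx h
  obtain ⟨ρ, hρ, h⟩ := Metric.eventually_nhds_iff_ball.1 (h1.and h2)
  exact ⟨ρ, hρ, fun α x hx => ((h x hx).1 α).contDiffWithinAt, fun τ hτ x hx => (h x hx).2 τ hτ⟩

/-- A function that is invariant under the permutations preserving the blocks factors through
the coordinate map. -/
lemma exists_eq_comp_coords (hcover : ∀ i, ∃ α, i ∈ H α) (hval : ∀ α, ∀ i ∈ H α, x₀ i = y α)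
    (hy : Function.Injective y) {s : Set (Fin N → ℝ)}
    (hs : ∀ τ : Equiv.Perm (Fin N), (∀ i, x₀ (τ i) = x₀ i) → ∀ x ∈ s, φ (x ∘ τ) = φ x) :
    ∃ ψ : (Idx H → ℝ) → ℝ, ∀ x ∈ s, φ x = ψ (coords H x) := by
  classical
  -- The value at any preimage in s is taken; two preimages differ by a permutation under which φ is
  -- invariant.
  refine ⟨fun q => if h : ∃ x ∈ s, coords H x = q then φ h.choose else 0, fun x hx => ?_⟩
  have h : ∃ x' ∈ s, coords H x' = coords H x := ⟨x, hx, rfl⟩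
  dsimp only
  rw [dif_pos h]
  obtain ⟨τ, hτ, e⟩ := exists_perm_of_coords_eq hcover hval hy h.choose_spec.2.symm
  rw [← hs τ hτ _ h.choose_spec.1, e]

lemma blockDeriv_eq_of_invariant {α : Fin M} (hval : ∀ α, ∀ i ∈ H α, x₀ i = y α)
    (hsymm : ∀ τ : Equiv.Perm (Fin N), (∀ i, x₀ (τ i) = x₀ i) →
      ∀ᶠ x in 𝓝 x₀, φ (x ∘ τ) = φ x)
    {a : ℕ → Fin N} (ha : Set.InjOn a (Finset.range (H α).card))
    (him : (Finset.range (H α).card).image a = H α) {k : ℕ} (hk : k < (H α).card) :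
    blockDeriv (H α) (k + 1) φ x₀ =
      (-1) ^ k / k.factorial * iteratedFDeriv ℝ (k + 1) φ x₀ fun q => helmert a q := by
  have hmem : ∀ p < (H α).card, a p ∈ H α := fun p hp => by
    have h : a p ∈ (Finset.range (H α).card).image a :=
      Finset.mem_image_of_mem a (Finset.mem_range.2 hp)
    rwa [him] at h
  have := blockDeriv_eq_iteratedFDeriv_helmert ha hk (φ := φ) (x := x₀) fun p hp q hq v => by
    have e : ∀ l, x₀ (Equiv.swap (a p) (a q) l) = x₀ l :=
      apply_swap_eq ((hval α _ (hmem p hp)).trans (hval α _ (hmem q hq)).symm)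
    exact iteratedFDeriv_comp_perm (funext e) (hsymm _ e) v
  rwa [him] at this

/-- The partial derivatives of a representing function at generic points tend to the block
derivatives. -/
lemma tendsto_fderiv_single (hne : ∀ α, (H α).Nonempty)
    (hval : ∀ α, ∀ i ∈ H α, x₀ i = y α) (hy : Function.Injective y)
    (hsymm : ∀ τ : Equiv.Perm (Fin N), (∀ i, x₀ (τ i) = x₀ i) →
      ∀ᶠ x in 𝓝 x₀, φ (x ∘ τ) = φ x)
    (hφ : ∀ α, ContDiffAt ℝ ((H α).card : ℕ) φ x₀) {ψ : (Idx H → ℝ) → ℝ}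
    (h : ∀ᶠ x in 𝓝 x₀, φ x = ψ (coords H x))
    (hψ : ∀ᶠ x in 𝓝 x₀, Function.Injective x → DifferentiableAt ℝ ψ (coords H x))
    (α : Fin M) (j : Fin (H α).card) :
    Tendsto (fun x => fderiv ℝ ψ (coords H x) (Pi.single ⟨α, j⟩ 1))
      (𝓝[{x | Function.Injective x}] x₀) (𝓝 (blockDeriv (H α) (j + 1) φ x₀)) := by
  obtain ⟨ρ, hρ, hC, hI⟩ := exists_ball_invariant_contDiffOn hsymm hφ
  obtain ⟨a, ha, him⟩ := exists_enumeration (hne α)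
  have hmem : ∀ p < (H α).card, a p ∈ H α := fun p hp => by
    have h : a p ∈ (Finset.range (H α).card).image a :=
      Finset.mem_image_of_mem a (Finset.mem_range.2 hp)
    rwa [him] at h
  have heq : ∀ p < (H α).card, ∀ q < (H α).card, x₀ (a p) = x₀ (a q) := fun p hp q hq =>
    (hval α _ (hmem p hp)).trans (hval α _ (hmem q hq)).symm
  have hsub : ∀ k : Fin (H α).card, (Finset.range (k + 1)).image a ⊆ H α := fun k i hi => by
    obtain ⟨p, hp, rfl⟩ := Finset.mem_image.1 hi
    exact hmem p (by have := Finset.mem_range.1 hp; omega)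
  have hcard : ∀ k : Fin (H α).card, ((Finset.range (k + 1)).image a).card = (k : ℕ) + 1 := by
    intro k
    rw [Finset.card_image_of_injOn, Finset.card_range]
    refine ha.mono fun i hi => ?_
    simp only [Finset.coe_range, Set.mem_Iio] at hi ⊢
    omega
  -- Row k is the chain rule after the divided difference over the first k + 1 indices of the block.
  have key := tendsto_of_linear_system (l := 𝓝[{x | Function.Injective x}] x₀)
    (A := fun x k j => gradDivDiff ((Finset.range (k + 1)).image a) (uHat (H α) (j + 1)) x)
    (g := fun x k => gradDivDiff ((Finset.range (k + 1)).image a) φ x)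
    (c := fun x j => fderiv ℝ ψ (coords H x) (Pi.single ⟨α, j⟩ 1))
    (g₀ := fun k => iteratedFDeriv ℝ (k + 1) φ x₀ (fun q => helmert a q) / (k : ℕ).factorial)
    (fun k j => by
      have := tendsto_gradDivDiff_uHat (hval α) (hsub k) (hcard k) (r := j + 1) (by omega)
        (by omega)
      simpa only [Nat.add_right_cancel_iff, Fin.val_inj] using this)
    (fun k => tendsto_gradDivDiff hρ ha heq k.2
      ((hC α).of_le (by exact_mod_cast k.2))
      fun p hp q hq x hx => hI _ (apply_swap_eq (heq p (by omega) q (by omega))) x hx)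
    (by
      filter_upwards [self_mem_nhdsWithin, mem_nhdsWithin_of_mem_nhds h.eventually_nhds,
        mem_nhdsWithin_of_mem_nhds hψ] with x hx h1 h2 k
      exact gradDivDiff_eq_sum_coords hval hy h1 (h2 hx) (hsub k)) j
  rw [blockDeriv_eq_of_invariant hval hsymm ha him j.2]
  convert key using 2
  ring

lemma coords_segment (hval : ∀ α, ∀ i ∈ H α, x₀ i = y α) (x : Fin N → ℝ) (s : ℝ) :
    coords H (x₀ + s • (x - x₀)) =
      fun p => coords H x₀ p + s ^ ((p.2 : ℕ) + 1) * (coords H x - coords H x₀) p :=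
  funext fun p => uHat_segment (hval p.1) (by omega) p.2.2 x s

lemma blockForm_apply (w : Idx H → ℝ) :
    blockForm H φ x₀ w = ∑ p : Idx H, blockDeriv (H p.1) (p.2 + 1) φ x₀ * w p := by
  simp [blockForm]

/-- A point with pairwise distinct coordinates near `x₀` can be moved to `x₀` along a segment of
such points. -/
lemma injective_segment {x : Fin N → ℝ} (hx : Function.Injective x) {s : ℝ} (hs : 0 < s)
    (h : ∀ i j, x₀ i ≠ x₀ j → (x₀ + s • (x - x₀)) i ≠ (x₀ + s • (x - x₀)) j) :
    Function.Injective (x₀ + s • (x - x₀)) := by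
  intro i j hij
  by_cases e : x₀ i = x₀ j
  · simp only [Pi.add_apply, Pi.smul_apply, Pi.sub_apply, smul_eq_mul, e] at hij
    refine hx (mul_left_cancel₀ hs.ne' ?_)
    linarith
  · exact absurd hij (h i j e)

/-- For x with distinct coordinates, the open segment to x₀ consists of such points, where the
partial derivatives of ψ are close to their limits; its image is a power curve, so the mean value
estimate applies. -/
lemma eventually_abs_sub_le
    (hval : ∀ α, ∀ i ∈ H α, x₀ i = y α) (hφ : ContDiffAt ℝ 1 φ x₀) {ψ : (Idx H → ℝ) → ℝ}
    (h : ∀ᶠ x in 𝓝 x₀, φ x = ψ (coords H x))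
    (hψ : ∀ᶠ x in 𝓝 x₀, Function.Injective x → DifferentiableAt ℝ ψ (coords H x))
    (hlim : ∀ p : Idx H, Tendsto (fun x => fderiv ℝ ψ (coords H x) (Pi.single p 1))
      (𝓝[{x | Function.Injective x}] x₀) (𝓝 (blockDeriv (H p.1) (p.2 + 1) φ x₀)))
    {ε : ℝ} (hε : 0 < ε) :
    ∀ᶠ x in 𝓝 x₀, |φ x - φ x₀ - blockForm H φ x₀ (coords H x - coords H x₀)| ≤
      ε * (∑ p : Idx H, (((p.2 : ℕ) : ℝ) + 1)) * ‖coords H x - coords H x₀‖ := by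
  have h1 : ∀ᶠ x in 𝓝 x₀, Function.Injective x →
      ∀ p : Idx H, |fderiv ℝ ψ (coords H x) (Pi.single p 1) -
        blockDeriv (H p.1) (p.2 + 1) φ x₀| ≤ ε := by
    have : ∀ᶠ x in 𝓝[{x | Function.Injective x}] x₀, ∀ p : Idx H,
        |fderiv ℝ ψ (coords H x) (Pi.single p 1) - blockDeriv (H p.1) (p.2 + 1) φ x₀| ≤ ε :=
      eventually_all.2 fun p => (Metric.tendsto_nhds.1 (hlim p) ε hε).mono fun x hx => hx.le
    exact eventually_nhdsWithin_iff.1 this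
  have h2 : ∀ᶠ x in 𝓝 x₀, ∀ i j, x₀ i ≠ x₀ j → x i ≠ x j := by
    refine eventually_all.2 fun i => eventually_all.2 fun j => ?_
    by_cases e : x₀ i = x₀ j
    · exact Eventually.of_forall fun x hx => absurd e hx
    · have hc : Tendsto (fun x : Fin N → ℝ => x i - x j) (𝓝 x₀) (𝓝 (x₀ i - x₀ j)) :=
        ((continuous_apply i).sub (continuous_apply j)).tendsto x₀
      exact (hc.eventually_ne (sub_ne_zero.2 e)).mono fun x hx _ h => hx (sub_eq_zero.2 h)
  have h3 : ∀ᶠ x in 𝓝 x₀, ContDiffAt ℝ 1 φ x := hφ.eventually (by simp)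
  obtain ⟨ρ, hρ, hB⟩ := Metric.eventually_nhds_iff_ball.1 (h.and (hψ.and (h1.and (h2.and h3))))
  have hseg : ∀ x ∈ Metric.ball x₀ ρ, ∀ s ∈ Set.Icc (0 : ℝ) 1,
      x₀ + s • (x - x₀) ∈ Metric.ball x₀ ρ := by
    intro x hx s hs
    exact (convex_ball x₀ ρ).add_smul_sub_mem (Metric.mem_ball_self hρ) hx hs
  have hinj : ∀ x ∈ Metric.ball x₀ ρ, Function.Injective x →
      |φ x - φ x₀ - blockForm H φ x₀ (coords H x - coords H x₀)| ≤
      ε * (∑ p : Idx H, (((p.2 : ℕ) : ℝ) + 1)) * ‖coords H x - coords H x₀‖ := by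
    intro x hx hxi
    have hsi : ∀ s ∈ Set.Ioo (0 : ℝ) 1, Function.Injective (x₀ + s • (x - x₀)) := fun s hs =>
      injective_segment hxi hs.1 (hB _ (hseg x hx s ⟨hs.1.le, hs.2.le⟩)).2.2.2.1
    have key := abs_sub_sub_sum_le_of_powerCurve (ψ := ψ) (m := fun p : Idx H => (p.2 : ℕ))
      (q₀ := coords H x₀) (w := coords H x - coords H x₀)
      (L := fun p => blockDeriv (H p.1) (p.2 + 1) φ x₀) hε.le
      (by
        have hc : ContinuousOn (fun s : ℝ => φ (x₀ + s • (x - x₀))) (Set.Icc 0 1) := by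
          intro s hs
          have c1 : ContinuousAt φ (x₀ + s • (x - x₀)) :=
            (hB _ (hseg x hx s hs)).2.2.2.2.continuousAt
          exact (ContinuousAt.comp (f := fun s : ℝ => x₀ + s • (x - x₀)) c1
            (by fun_prop)).continuousWithinAt
        refine hc.congr fun s hs => ?_
        change _ = φ (x₀ + s • (x - x₀))
        rw [(hB _ (hseg x hx s hs)).1, coords_segment hval])
      (fun s hs => by
        rw [← coords_segment hval]
        exact (hB _ (hseg x hx s ⟨hs.1.le, hs.2.le⟩)).2.1 (hsi s hs))
      (fun s hs p => by
        rw [← coords_segment hval]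
        exact (hB _ (hseg x hx s ⟨hs.1.le, hs.2.le⟩)).2.2.1 (hsi s hs) p)
    rw [add_sub_cancel] at key
    rwa [blockForm_apply, (hB x hx).1, (hB x₀ (Metric.mem_ball_self hρ)).1]
  filter_upwards [Metric.ball_mem_nhds x₀ hρ] with x hx
  have hcφ : ContinuousAt φ x := (hB x hx).2.2.2.2.continuousAt
  have hcc : Continuous (coords H) := (contDiff_coords (m := 0)).continuous
  have t1 : ContinuousAt
      (fun x => |φ x - φ x₀ - blockForm H φ x₀ (coords H x - coords H x₀)|) x :=
    ((hcφ.sub continuousAt_const).sub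
      ((blockForm H φ x₀).continuous.comp (hcc.sub continuous_const)).continuousAt).abs
  have t2 : ContinuousAt (fun x => ε * (∑ p : Idx H, (((p.2 : ℕ) : ℝ) + 1)) *
      ‖coords H x - coords H x₀‖) x :=
    (continuous_const.mul (hcc.sub continuous_const).norm).continuousAt
  -- Both sides are continuous in x, so density of the points with distinct coordinates gives the
  -- estimate everywhere in the ball.
  refine le_of_tendsto_of_tendsto (t1.mono_left nhdsWithin_le_nhds)
    (t2.mono_left (nhdsWithin_le_nhds (s := {x | Function.Injective x}))) ?_
  filter_upwards [self_mem_nhdsWithin,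
    mem_nhdsWithin_of_mem_nhds (Metric.isOpen_ball.mem_nhds hx)] with z hz hzB
  exact hinj z hzB hz

lemma hasFDerivWithinAt_range_coords (hne : ∀ α, (H α).Nonempty) (hcover : ∀ i, ∃ α, i ∈ H α)
    (hval : ∀ α, ∀ i ∈ H α, x₀ i = y α) (hφ : ContDiffAt ℝ 1 φ x₀) {ψ : (Idx H → ℝ) → ℝ}
    (h : ∀ᶠ x in 𝓝 x₀, φ x = ψ (coords H x))
    (hψ : ∀ᶠ x in 𝓝 x₀, Function.Injective x → DifferentiableAt ℝ ψ (coords H x))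
    (hlim : ∀ p : Idx H, Tendsto (fun x => fderiv ℝ ψ (coords H x) (Pi.single p 1))
      (𝓝[{x | Function.Injective x}] x₀) (𝓝 (blockDeriv (H p.1) (p.2 + 1) φ x₀))) :
    HasFDerivWithinAt ψ (blockForm H φ x₀) (Set.range (coords H)) (coords H x₀) := by
  refine HasFDerivWithinAt.of_isLittleO (Asymptotics.isLittleO_iff.2 fun c hc => ?_)
  set C : ℝ := ∑ p : Idx H, (((p.2 : ℕ) : ℝ) + 1)
  have hC : 0 ≤ C := Finset.sum_nonneg fun p _ => by positivity
  -- The denominator is C + 1 because C = 0 if there are no coordinates.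
  have h1 := eventually_abs_sub_le hval hφ h hψ hlim (ε := c / (C + 1)) (by positivity)
  -- An estimate for x near x₀ becomes one for all points of the image near `coords H x₀`, whichever
  -- preimage is used.
  have h2 := tendsto_of_coords hne hcover hval (h1.and h)
  obtain ⟨t, ht, hsub⟩ := h2
  filter_upwards [mem_nhdsWithin_of_mem_nhds ht, self_mem_nhdsWithin] with q hq hqr
  obtain ⟨x, rfl⟩ := hqr
  obtain ⟨h3, h4⟩ := hsub (show x ∈ coords H ⁻¹' t from hq)
  rw [h4, h.self_of_nhds] at h3
  rw [Real.norm_eq_abs]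
  refine h3.trans (mul_le_mul_of_nonneg_right ?_ (norm_nonneg _))
  rw [div_mul_eq_mul_div, div_le_iff₀ (by positivity)]
  nlinarith

end Local

end BlockCoord

end

/-- `x₀` is any point, with blocks `H α` of equal coordinates and distinct common values `y α`;
`φ` is invariant near `x₀` under the permutations preserving the blocks, and sufficiently often
continuously differentiable at `x₀`. The set of values of real points under the coordinate map has
`coords H x₀` on its boundary in general, so the derivatives of the representing function `ψ` there
are described in each of the available senses: relative to that set, as limits of the
derivatives at generic nearby points, and as ordinary partial derivatives if `ψ` happens to be
continuously differentiable on a full neighbourhood. -/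
theorem theorem3p11 {N M : ℕ} (x₀ : Fin N → ℝ) (H : Fin M → Finset (Fin N)) (y : Fin M → ℝ)
    (hne : ∀ α, (H α).Nonempty) (hcover : ∀ i, ∃ α, i ∈ H α)
    (hval : ∀ α, ∀ i ∈ H α, x₀ i = y α) (hy : Function.Injective y)
    (φ : (Fin N → ℝ) → ℝ)
    (hsymm : ∀ τ : Equiv.Perm (Fin N), (∀ i, x₀ (τ i) = x₀ i) →
      ∀ᶠ x in 𝓝 x₀, φ (x ∘ τ) = φ x)
    (hφ : ∀ α, ContDiffAt ℝ ((H α).card : ℕ) φ x₀) :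
    -- `φ` can be expressed in the coordinates near `x₀`
    (∃ ψ : (BlockCoord.Idx H → ℝ) → ℝ, ∀ᶠ x in 𝓝 x₀, φ x = ψ (BlockCoord.coords H x)) ∧
    -- the derivatives of any representing function are the `∂_{H_α}^d φ`
    (∀ ψ : (BlockCoord.Idx H → ℝ) → ℝ, (∀ᶠ x in 𝓝 x₀, φ x = ψ (BlockCoord.coords H x)) →
      HasFDerivWithinAt ψ (BlockCoord.blockForm H φ x₀) (Set.range (BlockCoord.coords H))
        (BlockCoord.coords H x₀) ∧
      (∀ᶠ x in 𝓝 x₀, Function.Injective x → DifferentiableAt ℝ ψ (BlockCoord.coords H x)) ∧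
      (∀ (α : Fin M) (j : Fin (H α).card),
        Tendsto (fun x => fderiv ℝ ψ (BlockCoord.coords H x) (Pi.single ⟨α, j⟩ 1))
          (𝓝[{x | Function.Injective x}] x₀)
          (𝓝 (BlockCoord.blockDeriv (H α) (j + 1) φ x₀))) ∧
      (ContDiffAt ℝ 1 ψ (BlockCoord.coords H x₀) →
        ∀ (α : Fin M) (j : Fin (H α).card),
          fderiv ℝ ψ (BlockCoord.coords H x₀) (Pi.single ⟨α, j⟩ 1) =
            BlockCoord.blockDeriv (H α) (j + 1) φ x₀)) ∧
    -- the case of a trace function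
    (∀ f : ℝ → ℝ, (∀ᶠ x in 𝓝 x₀, φ x = ∑ i, f (x i)) →
      ∀ (α : Fin M) (j : Fin (H α).card),
        BlockCoord.blockDeriv (H α) (j + 1) φ x₀ =
          (-1 : ℝ) ^ (j : ℕ) * iteratedDeriv (j + 1) f (y α) / ((j : ℕ).factorial : ℝ)) := by
  have hφ1 := BlockCoord.contDiffAt_one_of_blocks hne hcover hφ
  refine ⟨?_, fun ψ h => ?_, fun f h α j => ?_⟩
  · obtain ⟨ρ, hρ, -, hI⟩ := BlockCoord.exists_ball_invariant_contDiffOn hsymm hφ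
    obtain ⟨ψ, hψ⟩ := BlockCoord.exists_eq_comp_coords (φ := φ) hcover hval hy hI
    exact ⟨ψ, eventually_of_mem (Metric.ball_mem_nhds x₀ hρ) hψ⟩
  · have hd : ∀ᶠ x in 𝓝 x₀, Function.Injective x →
        DifferentiableAt ℝ ψ (BlockCoord.coords H x) := by
      filter_upwards [h.eventually_nhds, hφ1.eventually (by simp)] with x h1 h2 hx
      exact BlockCoord.differentiableAt_of_comp_coords hcover hval hy hx h1
        (h2.differentiableAt (by simp))
    have hlim := BlockCoord.tendsto_fderiv_single hne hval hy hsymm hφ h hd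
    refine ⟨BlockCoord.hasFDerivWithinAt_range_coords hne hcover hval hφ1 h hd
      fun p => hlim p.1 p.2, hd, hlim, fun hψ α j => ?_⟩
    -- If ψ is C¹, its derivative at `coords H x₀` is the limit of its derivatives at generic
    -- points, and those limits are already known.
    have hc : Tendsto (fun x => fderiv ℝ ψ (BlockCoord.coords H x))
        (𝓝[{x | Function.Injective x}] x₀) (𝓝 (fderiv ℝ ψ (BlockCoord.coords H x₀))) :=
      ((hψ.continuousAt_fderiv (by simp)).tendsto.comp
        (BlockCoord.contDiff_coords (m := 0)).continuous.continuousAt).mono_left nhdsWithin_le_nhds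
    have := BlockCoord.neBot_injective x₀
    exact tendsto_nhds_unique
      (((ContinuousLinearMap.apply ℝ ℝ (Pi.single (⟨α, j⟩ : BlockCoord.Idx H) (1 : ℝ))).continuous.tendsto
        _).comp hc) (hlim α j)
  · obtain ⟨a, ha, him⟩ := BlockCoord.exists_enumeration (hne α)
    have h0 : x₀ (a 0) = y α := hval α _ (by
      have h : a 0 ∈ (Finset.range (H α).card).image a :=
        Finset.mem_image_of_mem a (Finset.mem_range.2 (hne α).card_pos)
      rwa [him] at h)
    rw [BlockCoord.blockDeriv_eq_of_invariant hval hsymm ha him j.2,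
      BlockCoord.iteratedFDeriv_helmert_of_eventuallyEq_sum ha j.2
        ((hφ α).of_le (by exact_mod_cast j.2)) h, h0]
    ring
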